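/- **Proposition 3.2.** Let $a\in\mathbb C$ with $\operatorname{Re}a>-1$, let $n\in\mathbb Z_{\ge 0}$, and for $|\arg t|<\pi$ let $$w(x;t)=x^2(x+t)^a e^{-x},\qquad x>0 .$$ Let $p_k(x)=p_k(x;t)=\gamma_kx^k+\gamma_{k,1}x^{k-1}+\cdots$ be the normalised orthogonal polynomials for this weight: $\deg p_k=k$, $\int_0^\infty w\,p_k\,x^m\,dx=0$ for $0\le m<k$, and $\gamma_k\int_0^\infty w\,p_k\,x^k\,dx=1$. Let $\mathcal D$ be the set of all $t$ with $|\arg t|<\pi$ for which $p_0,\dots,p_{n+1}$ exist. Put $a_0=0$, $\gamma_{0,1}=0$, $a_k=\gamma_{k-1}/\gamma_k$ for $k\ge1$, $b_k=\gamma_{k,1}/\gamma_k-\gamma_{k+1,1}/\gamma_{k+1}$, and $$\theta_n(t)=2n+a+3-t-b_n,\qquad \kappa_n(t)=(n+1)t-a_n^2-\frac{\gamma_{n,1}}{\gamma_n}.$$ The set $\mathcal D$ is open and contains all sufficiently small $t$ with $|\arg t|<\pi$. If $a$ is real, then $\mathcal D\supset(0,\infty)$, and for $t>0$ one has $\theta_n(t)\neq0$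 and, if moreover $a\ne0$, also $\theta_n(t)+t\ne0$. 1. (Differential equations.) For $t\in\mathcal D$ (with $\dot{}=d/dt$), $$t\dot\theta_n=2\kappa_n+\theta_n(2n+a+3-t-\theta_n),$$ and, if $\theta_n(t)\ne0$ and $\theta_n(t)+t\neq0$, $$t\dot\kappa_n=\Big(\frac1{\theta_n+t}+\frac1{\theta_n}\Big)\kappa_n^2+\Big(2n+a+3-(2n+a+2)\frac{t}{\theta_n+t}\Big)\kappa_n-[n^2+(n+1)(a+2)]t-\frac{t^2}{\theta_n}+(n+1)(n+a+1)\frac{t^2}{\theta_n+t}.$$ 2. (Painlevé V.) Let $v_1+v_2+v_3+v_4=0$, $v_2-v_1=-2$, $v_3-v_1=n+a$, $v_4-v_1=n$ (so $v_3-v_4=a$), and let $H$ be Okamoto's Hamiltonian $$tH=q(q-1)^2p^2-\big\{(v_2-v_1)(q-1)^2-2(v_1+v_2)q(q-1)+tq\big\}p+(v_3-v_1)(v_4-v_1)(q-1).$$ Under the change of variables $$\theta=t\frac{q}{1-q},\qquad \kappa=t(1+qp)$$ the two differential equations of part 1, for arbitrary functions $\theta,\kappa$ in place of $\theta_n,\kappa_n$,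 are equivalent, on any open set on which $t\neq0$ and $q\ne0,1$, to Hamilton's equations $\dot q=\partial H/\partial p$, $\dot p=-\partial H/\partial q$. In particular there are functions $q,p$ such that, at all $t\in\mathcal D$ with $\theta_n(t)\ne0$ and $\theta_n(t)+t\ne0$, one has $q\neq 0,1$, $\theta_n=tq/(1-q)$, $\kappa_n=t(1+qp)$, the pair $(q,p)$ satisfies Hamilton's equations, and $q$ satisfies the fifth Painlevé equation $$\ddot q=\Big(\frac1{2q}+\frac1{q-1}\Big)\dot q^2-\frac{\dot q}{t}+\frac{(q-1)^2}{t^2}\Big(\alpha q+\frac{\beta}{q}\Big)+\gamma\frac{q}{t}+\delta\frac{q(q+1)}{q-1}$$ with $$\alpha=\frac{a^2}2,\quad \beta=-2,\quad \gamma=-(2n+a+3),\quad \delta=-\frac12 .$$ 3. (Boundary data.) If $a\notin\mathbb Z_{\ge0}$, then as $t\to0$ with $|\arg t|<\pi$, $$\theta_n(t)=-\frac{2}{a+2}t-\frac{2a(2n+a+3)}{(a+3)(a+2)^2(a+1)}t^2+O(t^3)-\frac{2}{(a+2)(a+1)\Gamma^2(a+3)}\frac{\Gamma(a+n+3)}{\Gamma(n+1)}t^{a+3}(1+O(t))+O(t^{2a+6}),$$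 $$\kappa_n(t)=\frac{2n+a+2}{a+2}t+\frac{4n(n+a+2)a}{(a+3)(a+2)^2(a+1)}t^2+O(t^3)+\frac{2}{(a+2)(a+1)\Gamma^2(a+3)}\frac{\Gamma(a+n+3)}{\Gamma(n)}t^{a+3}(1+O(t))+O(t^{2a+6}),$$ where in each line the part $c_1t+c_2t^2+O(t^3)$ and the factor $1+O(t)$ are functions analytic at $t=0$, powers of $t$ are principal branches, and $1/\Gamma(0)=0$. -/

import Mathlib

open Polynomial Filter Topology Asymptotics MeasureTheory

namespace DeformedLaguerre

noncomputable section

/-- The deformed Laguerre weight `w(x;t) = x ^ 2 (x + t) ^ a e ^ (-x)` on `x > 0`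
(principal branch; `t` ranges over the plane cut along the non-positive real axis). -/
def weight (a t : ℂ) (x : ℝ) : ℂ :=
  (x : ℂ) ^ 2 * ((x : ℂ) + t) ^ a * Complex.exp (-(x : ℂ))

/-- The integral of `w(x;t) P(x) x ^ m` over `0 < x < ∞`. -/
def pairing (a t : ℂ) (P : ℂ[X]) (m : ℕ) : ℂ :=
  ∫ x in Set.Ioi (0 : ℝ), weight a t x * P.eval (x : ℂ) * (x : ℂ) ^ m

/-- `p 0, …, p N` are the normalised orthogonal polynomials of degrees `0, …, N` for the weight
`w(·;t)`: `∫ w p_k x ^ m = 0` for `m < k`, and `γ_k h_k = 1`, where `γ_k` is the coefficient of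
`x ^ k` in `p_k` and `h_k = ∫ w p_k x ^ k`. -/
def IsOrthonormalSystem (a t : ℂ) (N : ℕ) (p : ℕ → ℂ[X]) : Prop :=
  ∀ k ≤ N, (p k).natDegree = k ∧ (∀ m < k, pairing a t (p k) m = 0) ∧
    (p k).coeff k * pairing a t (p k) k = 1

/-- The set of all `t` with `|arg t| < π` for which the normalised orthogonal polynomials of
degrees `0, …, N` exist. -/
def opsDomain (a : ℂ) (N : ℕ) : Set ℂ :=
  {t | t ∈ Complex.slitPlane ∧ ∃ p, IsOrthonormalSystem a t N p}

/-- `γ_n`, the coefficient of `x ^ n` in `p_n`. -/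
def lead (p : ℕ → ℂ[X]) (n : ℕ) : ℂ := (p n).coeff n

/-- `γ_{n,1}`, the coefficient of `x ^ (n - 1)` in `p_n`, with `γ_{0,1} = 0`. -/
def subLead (p : ℕ → ℂ[X]) : ℕ → ℂ
  | 0 => 0
  | n + 1 => (p (n + 1)).coeff n

/-- `a_n = γ_{n-1} / γ_n` for `n ≥ 1`, and `a_0 = 0`. -/
def recA (p : ℕ → ℂ[X]) : ℕ → ℂ
  | 0 => 0
  | n + 1 => lead p n / lead p (n + 1)

/-- `b_n = γ_{n,1} / γ_n - γ_{n+1,1} / γ_{n+1}`. -/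
def recB (p : ℕ → ℂ[X]) (n : ℕ) : ℂ :=
  subLead p n / lead p n - subLead p (n + 1) / lead p (n + 1)

/-- `θ_n = 2n + a + 3 - t - b_n`. -/
def theta (a t : ℂ) (p : ℕ → ℂ[X]) (n : ℕ) : ℂ :=
  2 * n + a + 3 - t - recB p n

/-- `κ_n = (n + 1) t - a_n ^ 2 - γ_{n,1} / γ_n`. -/
def kappa (t : ℂ) (p : ℕ → ℂ[X]) (n : ℕ) : ℂ :=
  (n + 1) * t - recA p n ^ 2 - subLead p n / lead p n

/-- The differential equation for `θ`, at the point `t`. -/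
def ThetaEquationAt (a : ℂ) (n : ℕ) (θ κ : ℂ → ℂ) (t : ℂ) : Prop :=
  DifferentiableAt ℂ θ t ∧
    t * deriv θ t = 2 * κ t + θ t * (2 * n + a + 3 - t - θ t)

/-- The differential equation for `κ`, at a point `t` (meant for `θ t ≠ 0` and `θ t + t ≠ 0`). -/
def KappaEquationAt (a : ℂ) (n : ℕ) (θ κ : ℂ → ℂ) (t : ℂ) : Prop :=
  DifferentiableAt ℂ κ t ∧
    t * deriv κ t =
      (1 / (θ t + t) + 1 / θ t) * κ t ^ 2
        + (2 * n + a + 3 - (2 * n + a + 2) * (t / (θ t + t))) * κ t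
        - (n ^ 2 + (n + 1) * (a + 2)) * t - t ^ 2 / θ t
        + (n + 1) * (n + a + 1) * (t ^ 2 / (θ t + t))

/-- Okamoto's fifth Painlevé Hamiltonian with parameters `v₁ + v₂ + v₃ + v₄ = 0`:
`t H = q (q - 1)² p² - ((v₂ - v₁)(q - 1)² - 2 (v₁ + v₂) q (q - 1) + t q) p
  + (v₃ - v₁)(v₄ - v₁)(q - 1)`. -/
def okamotoHamiltonian (v₁ v₂ v₃ v₄ t q p : ℂ) : ℂ :=
  (q * (q - 1) ^ 2 * p ^ 2
    - ((v₂ - v₁) * (q - 1) ^ 2 - 2 * (v₁ + v₂) * q * (q - 1) + t * q) * p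
    + (v₃ - v₁) * (v₄ - v₁) * (q - 1)) / t

/-- Hamilton's equations `dq/dt = ∂H/∂p`, `dp/dt = -∂H/∂q` at the point `t`. -/
def OkamotoSystemAt (v₁ v₂ v₃ v₄ : ℂ) (q p : ℂ → ℂ) (t : ℂ) : Prop :=
  DifferentiableAt ℂ q t ∧ DifferentiableAt ℂ p t ∧
    deriv q t = deriv (fun y => okamotoHamiltonian v₁ v₂ v₃ v₄ t (q t) y) (p t) ∧
    deriv p t = -deriv (fun x => okamotoHamiltonian v₁ v₂ v₃ v₄ t x (p t)) (q t)

/-- The fifth Painlevé equation with parameters `α, β, γ, δ`, at the point `t`. -/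
def PainleveVAt (α β γ δ : ℂ) (q : ℂ → ℂ) (t : ℂ) : Prop :=
  DifferentiableAt ℂ q t ∧ DifferentiableAt ℂ (deriv q) t ∧
    deriv (deriv q) t =
      (1 / (2 * q t) + 1 / (q t - 1)) * deriv q t ^ 2 - deriv q t / t
        + (q t - 1) ^ 2 / t ^ 2 * (α * q t + β / q t)
        + γ * q t / t + δ * q t * (q t + 1) / (q t - 1)

/-- The expansion
`f(t) = c₁ t + c₂ t² + O(t³) + d t ^ (a + 3) (1 + O(t)) + O(t ^ (2a + 6))` as `t → 0` with
`|arg t| < π`. The part `c₁ t + c₂ t² + O(t³)` and the factor `1 + O(t)` are analytic at `0`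
(so that the coefficient `d` is meaningful also when `Re a ≥ 0`). -/
def HasBoundaryExpansion (a c₁ c₂ d : ℂ) (f : ℂ → ℂ) : Prop :=
  ∃ A C : ℂ → ℂ, AnalyticAt ℂ A 0 ∧ AnalyticAt ℂ C 0 ∧ C 0 = 1 ∧
    ((fun t => A t - (c₁ * t + c₂ * t ^ 2)) =O[𝓝 0] fun t => t ^ 3) ∧
    ((fun t => f t - (A t + d * t ^ (a + 3) * C t))
      =O[𝓝[Complex.slitPlane] 0] fun t => t ^ (2 * a + 6))

end

end DeformedLaguerre

/-! Let L_t(P) = ∫ x (x+t)^a e^{-x} P. Then W_t(P) = L_t(xP) is integration against the weight w,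
and L_t(P) = ∫ w P/x. Integration by parts shows that D_t(P) = L_t(xP) - L_t(xP') - 2 L_t(P) equals
a ∫ w P/(x+t), which is also dW_t/dt. The differential equations use only the identity D_t((x+t)P) =
a W_t(P) (`IsPearson`), the derivative formula and analyticity of the moments (`IsPearsonFamilyAt`).

For the monic orthogonal polynomials π_n with squared norms h_n, put ρ_n = h_n/h_{n-1}, R_n =
L(π_n²)/h_n and r_n = L(π_n π_{n-1})/h_{n-1}. The Pearson identity applied to π_n² and π_n π_{n-1}
gives θ_n = -2tR_n and κ_n = t(1 - 2r_n). Deforming the functional gives θ_n' = 2(r_{n+1} - r_n) and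
κ_n' = 1 - 2r_n - 2ρ_n(R_{n-1} - R_n). The three term recurrence removes r_{n+1} (`poleOff_succ`).
Two quadratic relations, one for each singular point 0 and -t, remove ρ_n and R_{n-1}
(`normRatio_mul_poleDiag`, `normRatio_mul_one_sub_poleDiag`). The passage to Hamilton's equations
and to Painlevé V is then a rational substitution. For real a and t > 0, the nonvanishing statements
express positivity of integrals of squares.

For the boundary data, substituting y = x + t writes the moments through Γ(a+1+j, t) = Γ(a+1+j) -
t^{a+1+j} · (entire). Hence θ_n and κ_n are F(t, t^{a+3}) with F analytic at (0,0)
(`splitFunctional`, `shift_splitFunctional`), and a Taylor expansion in the second variable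
suffices. On ε = 0 the functional, with complete gamma moments, is again a Pearson family, so the
same equations force the Taylor coefficients in t (`deriv_zero_of_system`). On t = 0 the variable ε
adds a point mass at 0 to the classical Laguerre weight x^{a+2} e^{-x}, and the first variation is
explicit from π_n(0) and h_n. -/

namespace DeformedLaguerre
-- Orthogonal polynomials of a linear functional.
noncomputable section

/-- The monic orthogonal polynomials of a linear functional, by the Gram-Schmidt process. -/
def monicOrtho (W : ℂ[X] →ₗ[ℂ] ℂ) (n : ℕ) : ℂ[X] :=
  X ^ n - ∑ j : Fin n, C (W (X ^ n * monicOrtho W j) / W (monicOrtho W j ^ 2)) * monicOrtho W j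
termination_by n
decreasing_by all_goals exact j.2

/-- The squared norms of the monic orthogonal polynomials. -/
def sqNorm (W : ℂ[X] →ₗ[ℂ] ℂ) (n : ℕ) : ℂ := W (monicOrtho W n ^ 2)

variable {W : ℂ[X] →ₗ[ℂ] ℂ}

theorem monicOrtho_eq (W : ℂ[X] →ₗ[ℂ] ℂ) (n : ℕ) :
    monicOrtho W n = X ^ n - ∑ j ∈ Finset.range n,
      C (W (X ^ n * monicOrtho W j) / sqNorm W j) * monicOrtho W j := by
  rw [monicOrtho, Finset.sum_range]
  rfl

theorem monicOrtho_zero (W : ℂ[X] →ₗ[ℂ] ℂ) : monicOrtho W 0 = 1 := by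
  rw [monicOrtho_eq]; simp

theorem functional_C_mul (W : ℂ[X] →ₗ[ℂ] ℂ) (c : ℂ) (P : ℂ[X]) : W (C c * P) = c * W P := by
  rw [← smul_eq_C_mul, map_smul, smul_eq_mul]

theorem monicOrtho_monic_natDegree (W : ℂ[X] →ₗ[ℂ] ℂ) (n : ℕ) :
    (monicOrtho W n).Monic ∧ (monicOrtho W n).natDegree = n := by
  induction n using Nat.strong_induction_on with
  | _ n ih =>
    have hlt : (∑ j ∈ Finset.range n,
        C (W (X ^ n * monicOrtho W j) / sqNorm W j) * monicOrtho W j).degree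
          < (X ^ n : ℂ[X]).degree := by
      rw [degree_X_pow]
      refine (degree_sum_le _ _).trans_lt ((Finset.sup_lt_iff (WithBot.bot_lt_coe n)).2 ?_)
      intro j hj
      have hj := Finset.mem_range.1 hj
      rw [← smul_eq_C_mul]
      refine lt_of_le_of_lt (degree_smul_le _ _) ?_
      refine lt_of_le_of_lt degree_le_natDegree ?_
      rw [(ih j hj).2]
      exact WithBot.coe_lt_coe.2 hj
    have h1 := (monic_X_pow (R := ℂ) n).sub_of_left hlt
    rw [← monicOrtho_eq] at h1
    refine ⟨h1, ?_⟩
    rw [monicOrtho_eq]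
    refine natDegree_eq_of_degree_eq_some ?_
    rw [degree_sub_eq_left_of_degree_lt hlt, degree_X_pow]

theorem monicOrtho_monic (W : ℂ[X] →ₗ[ℂ] ℂ) (n : ℕ) : (monicOrtho W n).Monic :=
  (monicOrtho_monic_natDegree W n).1

theorem natDegree_monicOrtho (W : ℂ[X] →ₗ[ℂ] ℂ) (n : ℕ) : (monicOrtho W n).natDegree = n :=
  (monicOrtho_monic_natDegree W n).2

theorem coeff_monicOrtho_self (W : ℂ[X] →ₗ[ℂ] ℂ) (n : ℕ) : (monicOrtho W n).coeff n = 1 := by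
  have := (monicOrtho_monic W n).coeff_natDegree
  rwa [natDegree_monicOrtho] at this

theorem degree_monicOrtho (W : ℂ[X] →ₗ[ℂ] ℂ) (n : ℕ) : (monicOrtho W n).degree = n := by
  rw [degree_eq_natDegree (monicOrtho_monic W n).ne_zero, natDegree_monicOrtho]

theorem monicOrtho_ortho {n : ℕ} (h : ∀ j < n, sqNorm W j ≠ 0) :
    ∀ j < n, W (monicOrtho W n * monicOrtho W j) = 0 := by
  induction n using Nat.strong_induction_on with
  | _ n ih =>
    intro j hj
    have key : ∀ i ∈ Finset.range n, i ≠ j →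
        C (W (X ^ n * monicOrtho W i) / sqNorm W i) * monicOrtho W i * monicOrtho W j ∈
          LinearMap.ker W := by
      intro i hi hij
      have hi := Finset.mem_range.1 hi
      rw [LinearMap.mem_ker, mul_assoc, functional_C_mul]
      rcases lt_or_gt_of_ne hij with hl | hl
      · rw [mul_comm (monicOrtho W i), ih j hj (fun k hk => h k (hk.trans hj)) i hl, mul_zero]
      · rw [ih i hi (fun k hk => h k (hk.trans hi)) j hl, mul_zero]
    rw [monicOrtho_eq, sub_mul, map_sub, Finset.sum_mul, map_sum,
      Finset.sum_eq_single_of_mem j (Finset.mem_range.2 hj) (fun i hi hij => key i hi hij),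
      mul_assoc, functional_C_mul, ← pow_two]
    have := h j hj
    change _ - _ / sqNorm W j * sqNorm W j = 0
    field_simp
    ring

theorem degree_sub_monicOrtho_lt {P : ℂ[X]} {m : ℕ} (hP : P.degree < (m + 1 : ℕ)) :
    (P - C (P.coeff m) * monicOrtho W m).degree < m := by
  rw [degree_lt_iff_coeff_zero] at hP ⊢
  intro k hk
  rw [coeff_sub, coeff_C_mul]
  rcases hk.eq_or_lt with rfl | hk
  · rw [coeff_monicOrtho_self]; ring
  · rw [hP k hk, coeff_eq_zero_of_natDegree_lt (p := monicOrtho W m)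
      (by rwa [natDegree_monicOrtho])]; ring

/-- Removing the top coefficient times the monic orthogonal polynomial of that degree lowers the
degree, so P is a combination of those of index below n. -/
theorem functional_monicOrtho_mul_of_degree_lt {n : ℕ} (h : ∀ j < n, sqNorm W j ≠ 0) {P : ℂ[X]}
    (hP : P.degree < n) : W (monicOrtho W n * P) = 0 := by
  suffices H : ∀ m ≤ n, ∀ P : ℂ[X], P.degree < m → W (monicOrtho W n * P) = 0 from
    H n le_rfl P hP
  intro m
  induction m with
  | zero =>
    intro _ P hP
    have : P = 0 := by simpa using hP
    simp [this]
  | succ m ih =>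
    intro hm P hP
    have h1 := ih (by omega) _ (degree_sub_monicOrtho_lt (W := W) hP)
    rw [mul_sub, map_sub, mul_left_comm, functional_C_mul,
      monicOrtho_ortho h m (by omega), mul_zero, sub_zero] at h1
    exact h1

theorem functional_monicOrtho_mul {n : ℕ} (h : ∀ j < n, sqNorm W j ≠ 0) {P : ℂ[X]}
    (hP : P.natDegree ≤ n) : W (monicOrtho W n * P) = P.coeff n * sqNorm W n := by
  have hd : P.degree < (n + 1 : ℕ) := by
    refine degree_le_natDegree.trans_lt ?_
    exact_mod_cast Nat.lt_succ_of_le hP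
  have h1 := functional_monicOrtho_mul_of_degree_lt h (degree_sub_monicOrtho_lt (W := W) hd)
  rw [mul_sub, map_sub, mul_left_comm, functional_C_mul, ← pow_two, sub_eq_zero] at h1
  exact h1

theorem functional_eq_zero_of_monomials {Q : ℂ[X]} {k : ℕ} (hQ : ∀ m < k, W (Q * X ^ m) = 0)
    {P : ℂ[X]} (hP : P.natDegree < k) : W (Q * P) = 0 := by
  rw [as_sum_range_C_mul_X_pow' P hP, Finset.mul_sum, map_sum]
  refine Finset.sum_eq_zero fun i hi => ?_
  rw [mul_left_comm, functional_C_mul, hQ i (Finset.mem_range.1 hi), mul_zero]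

/-- Orthonormal systems of a functional are the normalised monic orthogonal polynomials. -/
theorem orthonormal_eq {N : ℕ} {p : ℕ → ℂ[X]}
    (hp : ∀ k ≤ N, (p k).natDegree = k ∧ (∀ m < k, W (p k * X ^ m) = 0) ∧
      (p k).coeff k * W (p k * X ^ k) = 1) :
    ∀ k ≤ N, p k = C ((p k).coeff k) * monicOrtho W k ∧
      (p k).coeff k ^ 2 * sqNorm W k = 1 := by
  intro k
  induction k using Nat.strong_induction_on with
  | _ k ih =>
    intro hk
    -- Nondegeneracy is not assumed: γ_j² h_j = 1 at the earlier indices forces h_j ≠ 0.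
    have hn : ∀ j < k, sqNorm W j ≠ 0 := fun j hj h0 => by
      have := (ih j hj (hj.le.trans hk)).2
      rw [h0] at this
      simp at this
    obtain ⟨hdeg, horth, hnorm⟩ := hp k hk
    have hXk := functional_monicOrtho_mul (W := W) hn (P := X ^ k) (natDegree_X_pow_le _)
    rw [coeff_X_pow_self, one_mul] at hXk
    have hdP : (p k).degree < (k + 1 : ℕ) := by
      refine degree_le_natDegree.trans_lt ?_
      rw [hdeg]
      exact_mod_cast Nat.lt_succ_self k
    have hdQ := degree_sub_monicOrtho_lt (W := W) hdP
    have heq : p k = C ((p k).coeff k) * monicOrtho W k := by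
      by_contra hne
      have hQ0 := sub_ne_zero.2 hne
      set Q := p k - C ((p k).coeff k) * monicOrtho W k with hQ
      have hQd : Q.natDegree < k := (natDegree_lt_iff_degree_lt hQ0).2 hdQ
      have hQo : ∀ m < k, W (Q * X ^ m) = 0 := by
        intro m hm
        rw [hQ, sub_mul, map_sub, horth m hm, mul_assoc, functional_C_mul,
          functional_monicOrtho_mul_of_degree_lt hn, mul_zero, sub_zero]
        rw [degree_X_pow]
        exact_mod_cast hm
      -- Pairing Q with the orthogonal polynomial of its own degree gives 0 by `hQo`, but also its
      -- leading coefficient times a nonzero norm.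
      have h1 := functional_eq_zero_of_monomials (W := W) hQo
        (P := monicOrtho W Q.natDegree) (by rwa [natDegree_monicOrtho])
      rw [mul_comm, functional_monicOrtho_mul (fun j hj => hn j (hj.trans hQd)) le_rfl] at h1
      exact mul_ne_zero (leadingCoeff_ne_zero.2 hQ0) (hn _ hQd) h1
    refine ⟨heq, ?_⟩
    have h2 : W (p k * X ^ k) = (p k).coeff k * sqNorm W k := by
      conv_lhs => rw [heq]
      rw [mul_assoc, functional_C_mul, hXk]
    rw [← hnorm, h2]
    ring

theorem exists_orthonormal {N : ℕ} (hn : ∀ k ≤ N, sqNorm W k ≠ 0) :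
    ∃ p : ℕ → ℂ[X], ∀ k ≤ N, (p k).natDegree = k ∧ (∀ m < k, W (p k * X ^ m) = 0) ∧
      (p k).coeff k * W (p k * X ^ k) = 1 := by
  -- Either square root will do as leading coefficient, since only its square enters the
  -- normalisation.
  have hex : ∀ k, ∃ c : ℂ, c ^ 2 = (sqNorm W k)⁻¹ := fun k =>
    IsAlgClosed.exists_pow_nat_eq _ two_pos
  choose c hc using hex
  refine ⟨fun k => C (c k) * monicOrtho W k, fun k hk => ?_⟩
  have hck : c k ≠ 0 := fun h0 => by
    have := hc k
    rw [h0] at this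
    exact inv_ne_zero (hn k hk) (by rw [← this]; simp)
  have hlt : ∀ j < k, sqNorm W j ≠ 0 := fun j hj => hn j (hj.le.trans hk)
  refine ⟨by rw [natDegree_C_mul hck, natDegree_monicOrtho], fun m hm => ?_, ?_⟩
  · rw [mul_assoc, functional_C_mul, functional_monicOrtho_mul_of_degree_lt hlt, mul_zero]
    rw [degree_X_pow]
    exact_mod_cast hm
  · rw [mul_assoc, functional_C_mul, functional_monicOrtho_mul hlt (natDegree_X_pow_le _),
      coeff_X_pow_self, coeff_C_mul, coeff_monicOrtho_self]
    have h3 : c k ^ 2 * sqNorm W k = 1 := by rw [hc k, inv_mul_cancel₀ (hn k hk)]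
    linear_combination h3

end

/-! ### Analytic dependence on parameters and first variations. -/

noncomputable section

theorem functional_eq_sum (W : ℂ[X] →ₗ[ℂ] ℂ) {P : ℂ[X]} {N : ℕ} (hP : P.natDegree < N) :
    W P = ∑ i ∈ Finset.range N, P.coeff i * W (X ^ i) := by
  conv_lhs => rw [as_sum_range_C_mul_X_pow' P hP, map_sum]
  exact Finset.sum_congr rfl fun i _ => functional_C_mul W _ _

section Analytic

variable {E : Type*} [NormedAddCommGroup E] [NormedSpace ℂ E]

/-- A family of polynomials of bounded degree with coefficients analytic at `x₀`. -/
def PolyAnalyticAt (P : E → ℂ[X]) (x₀ : E) : Prop :=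
  (∃ N, ∀ x, (P x).natDegree ≤ N) ∧ ∀ i, AnalyticAt ℂ (fun x => (P x).coeff i) x₀

variable {P Q : E → ℂ[X]} {x₀ : E}

theorem polyAnalyticAt_const (R : ℂ[X]) : PolyAnalyticAt (fun _ : E => R) x₀ :=
  ⟨⟨R.natDegree, fun _ => le_rfl⟩, fun _ => analyticAt_const⟩

theorem PolyAnalyticAt.sub (hP : PolyAnalyticAt P x₀) (hQ : PolyAnalyticAt Q x₀) :
    PolyAnalyticAt (fun x => P x - Q x) x₀ := by
  obtain ⟨⟨N, hN⟩, hP⟩ := hP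
  obtain ⟨⟨M, hM⟩, hQ⟩ := hQ
  refine ⟨⟨max N M, fun x => (natDegree_sub_le _ _).trans (max_le_max (hN x) (hM x))⟩,
    fun i => ?_⟩
  simp only [coeff_sub]
  exact (hP i).sub (hQ i)

theorem PolyAnalyticAt.mul (hP : PolyAnalyticAt P x₀) (hQ : PolyAnalyticAt Q x₀) :
    PolyAnalyticAt (fun x => P x * Q x) x₀ := by
  obtain ⟨⟨N, hN⟩, hP⟩ := hP
  obtain ⟨⟨M, hM⟩, hQ⟩ := hQ
  refine ⟨⟨N + M, fun x => natDegree_mul_le.trans (add_le_add (hN x) (hM x))⟩, fun i => ?_⟩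
  simp only [coeff_mul]
  exact Finset.analyticAt_fun_sum _ fun ij _ => (hP _).mul (hQ _)

theorem PolyAnalyticAt.pow (hP : PolyAnalyticAt P x₀) (m : ℕ) :
    PolyAnalyticAt (fun x => P x ^ m) x₀ := by
  induction m with
  | zero => simpa using polyAnalyticAt_const (E := E) 1
  | succ m ih => simpa only [pow_succ] using ih.mul hP

theorem PolyAnalyticAt.C_mul {c : E → ℂ} (hc : AnalyticAt ℂ c x₀) (hP : PolyAnalyticAt P x₀) :
    PolyAnalyticAt (fun x => C (c x) * P x) x₀ := by
  refine PolyAnalyticAt.mul ⟨⟨0, fun x => (natDegree_C _).le⟩, fun i => ?_⟩ hP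
  simp only [coeff_C]
  split_ifs
  · exact hc
  · exact analyticAt_const

theorem polyAnalyticAt_sum {ι : Type*} (s : Finset ι) {P : ι → E → ℂ[X]}
    (h : ∀ i ∈ s, PolyAnalyticAt (P i) x₀) : PolyAnalyticAt (fun x => ∑ i ∈ s, P i x) x₀ := by
  classical
  induction s using Finset.induction_on with
  | empty => simpa using polyAnalyticAt_const (E := E) 0
  | insert a s ha ih =>
    have h1 := (h a (Finset.mem_insert_self _ _)).sub
      ((polyAnalyticAt_const 0).sub (ih fun i hi => h i (Finset.mem_insert_of_mem hi)))
    simp only [Finset.sum_insert ha]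
    convert h1 using 2
    ring

/-- The uniform degree bound makes W(P) a finite sum of coefficient times moment with a fixed number
of terms. -/
theorem PolyAnalyticAt.functional {W : E → ℂ[X] →ₗ[ℂ] ℂ}
    (hW : ∀ k, AnalyticAt ℂ (fun x => W x (X ^ k)) x₀) (hP : PolyAnalyticAt P x₀) :
    AnalyticAt ℂ (fun x => W x (P x)) x₀ := by
  obtain ⟨⟨N, hN⟩, hP⟩ := hP
  simp only [fun x => functional_eq_sum (W x) (Nat.lt_succ_of_le (hN x))]
  exact Finset.analyticAt_fun_sum _ fun i _ => (hP i).mul (hW i)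

/-- Gram-Schmidt divides only by the norms of index below n. -/
theorem polyAnalyticAt_monicOrtho {W : E → ℂ[X] →ₗ[ℂ] ℂ}
    (hW : ∀ k, AnalyticAt ℂ (fun x => W x (X ^ k)) x₀) {n : ℕ}
    (hn : ∀ j < n, sqNorm (W x₀) j ≠ 0) : PolyAnalyticAt (fun x => monicOrtho (W x) n) x₀ := by
  induction n using Nat.strong_induction_on with
  | _ n ih =>
    simp only [monicOrtho_eq _ n]
    refine (polyAnalyticAt_const _).sub (polyAnalyticAt_sum _ fun j hj => ?_)
    have hj := Finset.mem_range.1 hj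
    have hPj := ih j hj fun k hk => hn k (hk.trans hj)
    exact PolyAnalyticAt.C_mul ((((polyAnalyticAt_const _).mul hPj).functional hW).div
      ((hPj.pow 2).functional hW) (hn j hj)) hPj

theorem analyticAt_sqNorm {W : E → ℂ[X] →ₗ[ℂ] ℂ}
    (hW : ∀ k, AnalyticAt ℂ (fun x => W x (X ^ k)) x₀) {n : ℕ}
    (hn : ∀ j < n, sqNorm (W x₀) j ≠ 0) : AnalyticAt ℂ (fun x => sqNorm (W x) n) x₀ :=
  ((polyAnalyticAt_monicOrtho hW hn).pow 2).functional hW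

theorem eventually_sqNorm_ne_zero {W : E → ℂ[X] →ₗ[ℂ] ℂ}
    (hW : ∀ k, AnalyticAt ℂ (fun x => W x (X ^ k)) x₀) {n : ℕ}
    (hn : ∀ j < n, sqNorm (W x₀) j ≠ 0) : ∀ᶠ x in 𝓝 x₀, ∀ j < n, sqNorm (W x) j ≠ 0 := by
  have : ∀ᶠ x in 𝓝 x₀, ∀ j ∈ Finset.range n, sqNorm (W x) j ≠ 0 := by
    rw [eventually_all_finset]
    intro j hj
    have hj := Finset.mem_range.1 hj
    exact (analyticAt_sqNorm hW fun k hk => hn k (hk.trans hj)).continuousAt.eventually_ne (hn j hj)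
  exact this.mono fun x hx j hj => hx j (Finset.mem_range.2 hj)

end Analytic

section Derivative

/-- A family of polynomials of bounded degree whose coefficients have the coefficients of `P'`
as derivatives at `t`. -/
def HasPolyDerivAt (P : ℂ → ℂ[X]) (P' : ℂ[X]) (t : ℂ) : Prop :=
  (∃ N, P'.natDegree ≤ N ∧ ∀ x, (P x).natDegree ≤ N) ∧
    ∀ i, HasDerivAt (fun x => (P x).coeff i) (P'.coeff i) t

variable {P Q : ℂ → ℂ[X]} {P' Q' : ℂ[X]} {t : ℂ}

theorem hasPolyDerivAt_const (R : ℂ[X]) : HasPolyDerivAt (fun _ => R) 0 t :=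
  ⟨⟨R.natDegree, by simp, fun _ => le_rfl⟩, fun i => by simpa using hasDerivAt_const t _⟩

theorem HasPolyDerivAt.mul (hP : HasPolyDerivAt P P' t) (hQ : HasPolyDerivAt Q Q' t) :
    HasPolyDerivAt (fun x => P x * Q x) (P' * Q t + P t * Q') t := by
  obtain ⟨⟨N, hN', hN⟩, hP⟩ := hP
  obtain ⟨⟨M, hM', hM⟩, hQ⟩ := hQ
  refine ⟨⟨N + M, ?_, fun x => natDegree_mul_le.trans (add_le_add (hN x) (hM x))⟩, fun i => ?_⟩
  · exact natDegree_add_le_of_degree_le (natDegree_mul_le.trans (add_le_add hN' (hM t)))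
      (natDegree_mul_le.trans (add_le_add (hN t) hM'))
  · simp only [coeff_add, coeff_mul, ← Finset.sum_add_distrib]
    exact HasDerivAt.fun_sum fun ij _ => (hP _).mul (hQ _)

theorem HasPolyDerivAt.functional {W : ℂ → ℂ[X] →ₗ[ℂ] ℂ} {W' : ℂ[X] →ₗ[ℂ] ℂ}
    (hW : ∀ k, HasDerivAt (fun x => W x (X ^ k)) (W' (X ^ k)) t) (hP : HasPolyDerivAt P P' t) :
    HasDerivAt (fun x => W x (P x)) (W' (P t) + W t P') t := by
  obtain ⟨⟨N, hN', hN⟩, hP⟩ := hP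
  simp only [fun x => functional_eq_sum (W x) (Nat.lt_succ_of_le (hN x)),
    functional_eq_sum W' (Nat.lt_succ_of_le (hN t)),
    functional_eq_sum (W t) (Nat.lt_succ_of_le hN'), ← Finset.sum_add_distrib]
  refine HasDerivAt.fun_sum fun i _ => ?_
  exact ((hP i).mul (hW i)).congr_deriv (by ring)

theorem PolyAnalyticAt.exists_hasPolyDerivAt (hP : PolyAnalyticAt P t) :
    ∃ P', HasPolyDerivAt P P' t := by
  obtain ⟨⟨N, hN⟩, hP⟩ := hP
  have hcoef : ∀ i, (∑ k ∈ Finset.range (N + 1),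
      monomial k (deriv (fun x => (P x).coeff k) t)).coeff i =
        deriv (fun x => (P x).coeff i) t := by
    intro i
    simp only [finsetSum_coeff, coeff_monomial, Finset.sum_ite_eq', Finset.mem_range]
    split_ifs with h
    · rfl
    · have : (fun x => (P x).coeff i) = fun _ => 0 := by
        funext x
        exact coeff_eq_zero_of_natDegree_lt ((hN x).trans_lt (by omega))
      rw [this, deriv_const]
  refine ⟨_, ⟨N, ?_, hN⟩, fun i => by rw [hcoef]; exact (hP i).differentiableAt.hasDerivAt⟩
  refine natDegree_sum_le_of_forall_le _ _ fun k hk => (natDegree_monomial_le _).trans ?_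
  have := Finset.mem_range.1 hk
  omega

variable {W : ℂ → ℂ[X] →ₗ[ℂ] ℂ} {W' : ℂ[X] →ₗ[ℂ] ℂ}

/-- The leading coefficient is constantly 1, so the derivative drops in degree and is orthogonal to
the polynomial itself. This is what makes the first variations explicit. -/
theorem exists_hasPolyDerivAt_monicOrtho (hWa : ∀ k, AnalyticAt ℂ (fun x => W x (X ^ k)) t)
    {n : ℕ} (hn : ∀ j < n, sqNorm (W t) j ≠ 0) :
    ∃ P', HasPolyDerivAt (fun x => monicOrtho (W x) n) P' t ∧ P'.degree < n := by
  obtain ⟨P', hP'⟩ := (polyAnalyticAt_monicOrtho hWa hn).exists_hasPolyDerivAt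
  refine ⟨P', hP', ?_⟩
  rw [degree_lt_iff_coeff_zero]
  intro m hm
  have h1 := hP'.2 m
  have h2 : (fun x => (monicOrtho (W x) n).coeff m) = fun _ => if m = n then 1 else 0 := by
    funext x
    split_ifs with h
    · rw [h, coeff_monicOrtho_self]
    · exact coeff_eq_zero_of_natDegree_lt (by rw [natDegree_monicOrtho]; omega)
  rw [h2] at h1
  exact h1.unique (hasDerivAt_const _ _)

/-- The derivative of the squared norm under a deformation of the functional. -/
theorem hasDerivAt_sqNorm (hWa : ∀ k, AnalyticAt ℂ (fun x => W x (X ^ k)) t)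
    (hW : ∀ k, HasDerivAt (fun x => W x (X ^ k)) (W' (X ^ k)) t)
    {n : ℕ} (hn : ∀ j < n, sqNorm (W t) j ≠ 0) :
    HasDerivAt (fun x => sqNorm (W x) n) (W' (monicOrtho (W t) n ^ 2)) t := by
  obtain ⟨P', hP', hdeg⟩ := exists_hasPolyDerivAt_monicOrtho hWa hn
  have h1 := (hP'.mul hP').functional hW
  rw [map_add, mul_comm P', functional_monicOrtho_mul_of_degree_lt hn hdeg] at h1
  simpa [sqNorm, pow_two] using h1

/-- The derivative of the subleading coefficient under a deformation of the functional. -/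
theorem hasDerivAt_coeff_monicOrtho (hWa : ∀ k, AnalyticAt ℂ (fun x => W x (X ^ k)) t)
    (hW : ∀ k, HasDerivAt (fun x => W x (X ^ k)) (W' (X ^ k)) t)
    {n : ℕ} (hn : ∀ j ≤ n, sqNorm (W t) j ≠ 0) :
    HasDerivAt (fun x => (monicOrtho (W x) (n + 1)).coeff n)
      (-(W' (monicOrtho (W t) (n + 1) * monicOrtho (W t) n)) / sqNorm (W t) n) t := by
  have hn1 : ∀ j < n + 1, sqNorm (W t) j ≠ 0 := fun j hj => hn j (by omega)
  have hn0 : ∀ j < n, sqNorm (W t) j ≠ 0 := fun j hj => hn j hj.le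
  obtain ⟨P', hP', hPd⟩ := exists_hasPolyDerivAt_monicOrtho hWa hn1
  obtain ⟨Q', hQ', hQd⟩ := exists_hasPolyDerivAt_monicOrtho hWa hn0
  have h1 := (hP'.mul hQ').functional hW
  -- The formula comes from differentiating W(π_{n+1} π_n) = 0: the variation of π_n contributes
  -- nothing, and that of π_{n+1} contributes its coefficient of x^n times h_n.
  have h0 : (fun x => W x (monicOrtho (W x) (n + 1) * monicOrtho (W x) n)) =ᶠ[𝓝 t]
      fun _ => 0 := by
    filter_upwards [eventually_sqNorm_ne_zero hWa hn1] with x hx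
    exact monicOrtho_ortho hx n (by omega)
  have h2 := (h1.congr_of_eventuallyEq h0.symm).unique (hasDerivAt_const _ _)
  have hPn : P'.natDegree ≤ n := by
    rw [natDegree_le_iff_coeff_eq_zero]
    exact fun k hk => (degree_lt_iff_coeff_zero _ _).1 hPd k hk
  rw [map_add, mul_comm P', functional_monicOrtho_mul hn0 hPn,
    functional_monicOrtho_mul_of_degree_lt hn1 (hQd.trans (by exact_mod_cast Nat.lt_succ_self n))]
    at h2
  convert hP'.2 n using 1
  rw [neg_div, ← sub_eq_zero, ← neg_eq_zero]
  field_simp [hn n le_rfl]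
  linear_combination h2

end Derivative

end

/-! ### Algebra of the Pearson equation. -/

noncomputable section

/-- The functional `P ↦ L (x P)`. -/
def shiftFunctional (L : ℂ[X] →ₗ[ℂ] ℂ) : ℂ[X] →ₗ[ℂ] ℂ := L ∘ₗ LinearMap.mulLeft ℂ X

theorem shiftFunctional_apply (L : ℂ[X] →ₗ[ℂ] ℂ) (P : ℂ[X]) : shiftFunctional L P = L (X * P) := rfl

/-- If `L P = ∫ x (x + t) ^ a e ^ (-x) P`, this is `P ↦ a ∫ x ^ 2 (x + t) ^ (a - 1) e ^ (-x) P`,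
the derivative of `shiftFunctional L` with respect to `t`. -/
def rateFunctional (L : ℂ[X] →ₗ[ℂ] ℂ) : ℂ[X] →ₗ[ℂ] ℂ :=
  shiftFunctional L - shiftFunctional L ∘ₗ derivative - (2 : ℂ) • L

theorem rateFunctional_apply (L : ℂ[X] →ₗ[ℂ] ℂ) (P : ℂ[X]) :
    rateFunctional L P = L (X * P) - L (X * derivative P) - 2 * L P := rfl

/-- The Pearson equation of the weight `x (x + t) ^ a e ^ (-x)`, as a property of functionals. -/
def IsPearson (a t : ℂ) (L : ℂ[X] →ₗ[ℂ] ℂ) : Prop :=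
  ∀ P, rateFunctional L ((X + C t) * P) = a * shiftFunctional L P

/-- The monic orthogonal polynomials of `shiftFunctional L`. -/
abbrev ortho (L : ℂ[X] →ₗ[ℂ] ℂ) (n : ℕ) : ℂ[X] := monicOrtho (shiftFunctional L) n

/-- The squared norms of the monic orthogonal polynomials of `shiftFunctional L`. -/
abbrev norm2 (L : ℂ[X] →ₗ[ℂ] ℂ) (n : ℕ) : ℂ := sqNorm (shiftFunctional L) n

/-- The subleading coefficient of the `n`-th monic orthogonal polynomial. -/
def subCoeff (L : ℂ[X] →ₗ[ℂ] ℂ) : ℕ → ℂ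
  | 0 => 0
  | n + 1 => (ortho L (n + 1)).coeff n

/-- The ratio of consecutive squared norms. -/
def normRatio (L : ℂ[X] →ₗ[ℂ] ℂ) : ℕ → ℂ
  | 0 => 0
  | n + 1 => norm2 L (n + 1) / norm2 L n

/-- `∫ p_n ^ 2 w / x`, for the orthonormal polynomial `p_n`. -/
def poleDiag (L : ℂ[X] →ₗ[ℂ] ℂ) (n : ℕ) : ℂ := L (ortho L n ^ 2) / norm2 L n

/-- `poleDiag L (n - 1)`, and `0` for `n = 0`. -/
def poleDiagPred (L : ℂ[X] →ₗ[ℂ] ℂ) : ℕ → ℂ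
  | 0 => 0
  | n + 1 => poleDiag L n

/-- `∫ π_n π_{n-1} w / x` divided by the squared norm of `π_{n-1}`, for monic `π_n`. -/
def poleOff (L : ℂ[X] →ₗ[ℂ] ℂ) : ℕ → ℂ
  | 0 => 0
  | n + 1 => L (ortho L (n + 1) * ortho L n) / norm2 L n

variable {a t : ℂ} {L : ℂ[X] →ₗ[ℂ] ℂ} {n : ℕ}

/-- P - P(0) is divisible by x, which cancels the pole 1/x; the quotient has degree below n and is
orthogonal to π_n. -/
theorem functional_eq_eval_zero (h : ∀ j < n, norm2 L j ≠ 0) {P : ℂ[X]} (hP : P.natDegree ≤ n) :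
    L (ortho L n * P) = P.eval 0 * L (ortho L n) := by
  have h1 : P = X * divX P + C (P.eval 0) := by
    conv_lhs => rw [← divX_mul_X_add P, coeff_zero_eq_eval_zero]
    ring
  have h2 : shiftFunctional L (ortho L n * divX P) = 0 := by
    by_cases hd : divX P = 0
    · simp [hd]
    · refine functional_monicOrtho_mul_of_degree_lt h ?_
      rcases n with _ | n
      · rw [Nat.le_zero, natDegree_eq_zero] at hP
        obtain ⟨c, rfl⟩ := hP
        simp at hd
      · refine (natDegree_lt_iff_degree_lt hd).1 ?_
        rw [natDegree_divX_eq_natDegree_tsub_one]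
        omega
  rw [shiftFunctional_apply] at h2
  conv_lhs => rw [h1]
  rw [mul_add, map_add, mul_comm _ (C _), functional_C_mul, ← h2]
  rw [show ortho L n * (X * P.divX) = X * (ortho L n * P.divX) by ring, h2, zero_add]

theorem exists_eq_mul_add_eval (P : ℂ[X]) (t : ℂ) :
    ∃ Q : ℂ[X], P = (X + C t) * Q + C (P.eval (-t)) ∧ (P.natDegree = 0 → Q = 0) ∧
      Q.natDegree ≤ P.natDegree - 1 := by
  refine ⟨P /ₘ (X - C (-t)), ?_, fun h => ?_, ?_⟩
  · conv_lhs => rw [← modByMonic_add_div P (X - C (-t)), modByMonic_X_sub_C_eq_C_eval]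
    rw [C_neg, sub_neg_eq_add]
    ring
  · obtain ⟨c, rfl⟩ := natDegree_eq_zero.1 h
    refine (divByMonic_eq_zero_iff (monic_X_sub_C _)).2 ?_
    rw [degree_X_sub_C]
    exact degree_C_lt
  · rw [natDegree_divByMonic _ (monic_X_sub_C _), natDegree_X_sub_C]

/-- The counterpart of `functional_eq_eval_zero` at the singular point -t, with the Pearson equation
cancelling the factor x + t. -/
theorem rate_eq_eval (hL : IsPearson a t L) (h : ∀ j < n, norm2 L j ≠ 0) {P : ℂ[X]}
    (hP : P.natDegree ≤ n) :
    rateFunctional L (ortho L n * P) = P.eval (-t) * rateFunctional L (ortho L n) := by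
  obtain ⟨Q, hQ, hQ0, hQd⟩ := exists_eq_mul_add_eval P t
  have h2 : shiftFunctional L (ortho L n * Q) = 0 := by
    by_cases hd : Q = 0
    · simp [hd]
    · refine functional_monicOrtho_mul_of_degree_lt h ((natDegree_lt_iff_degree_lt hd).1 ?_)
      have : P.natDegree ≠ 0 := fun h => hd (hQ0 h)
      omega
  conv_lhs => rw [hQ]
  rw [mul_add, map_add, mul_comm _ (C _), functional_C_mul,
    show ortho L n * ((X + C t) * Q) = (X + C t) * (ortho L n * Q) by ring, hL, h2]
  ring

/-- The derivative of π_n² is 2 π_n π_n', which W kills. Thus the integral with pole at -t is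
expressed by the one with pole at 0. -/
theorem rate_sq (h : ∀ j ≤ n, norm2 L j ≠ 0) :
    rateFunctional L (ortho L n ^ 2) = (1 - 2 * poleDiag L n) * norm2 L n := by
  have h1 : L (X * derivative (ortho L n ^ 2)) = 0 := by
    rw [← shiftFunctional_apply, derivative_pow,
      show C ((2 : ℕ) : ℂ) * ortho L n ^ (2 - 1) * derivative (ortho L n) =
        C 2 * (ortho L n * derivative (ortho L n)) by simp; ring, functional_C_mul,
      functional_monicOrtho_mul_of_degree_lt (fun j hj => h j hj.le), mul_zero]
    rcases n with _ | n
    · simp [ortho, monicOrtho_zero]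
    · rw [← degree_monicOrtho (shiftFunctional L) (n + 1)]
      exact degree_derivative_lt (monicOrtho_monic _ _).ne_zero
  have hn := h n le_rfl
  rw [rateFunctional_apply, h1, poleDiag, ← shiftFunctional_apply]
  change norm2 L n - 0 - _ = _
  field_simp
  ring

/-- In the derivative of the product only π_{n+1}' π_n survives; π_{n+1}' has leading coefficient n
+ 1, whence the term (n+1) h_n. -/
theorem rate_mul_prev (h : ∀ j ≤ n, norm2 L j ≠ 0) :
    rateFunctional L (ortho L (n + 1) * ortho L n) =
      -(n + 1 + 2 * poleOff L (n + 1)) * norm2 L n := by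
  have hn := h n le_rfl
  have hlt : ∀ j < n + 1, norm2 L j ≠ 0 := fun j hj => h j (by omega)
  have hlt' : ∀ j < n, norm2 L j ≠ 0 := fun j hj => h j hj.le
  have h0 : L (X * (ortho L (n + 1) * ortho L n)) = 0 := by
    rw [← shiftFunctional_apply]
    exact monicOrtho_ortho hlt n (by omega)
  have hd : (derivative (ortho L (n + 1))).natDegree ≤ n :=
    (natDegree_derivative_le _).trans (by rw [natDegree_monicOrtho]; omega)
  have h1 : L (X * derivative (ortho L (n + 1) * ortho L n)) = (n + 1) * norm2 L n := by
    rw [← shiftFunctional_apply, derivative_mul, map_add,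
      functional_monicOrtho_mul_of_degree_lt hlt (P := derivative (ortho L n)),
      mul_comm (derivative _), functional_monicOrtho_mul hlt' hd, coeff_derivative,
      coeff_monicOrtho_self]
    · ring
    · refine degree_derivative_le.trans_lt ?_
      rw [degree_monicOrtho]
      exact_mod_cast Nat.lt_succ_self n
  rw [rateFunctional_apply, h0, h1, poleOff]
  field_simp
  ring

theorem natDegree_X_mul_ortho (L : ℂ[X] →ₗ[ℂ] ℂ) (n : ℕ) : (X * ortho L n).natDegree = n + 1 := by
  rw [natDegree_X_mul (monicOrtho_monic _ _).ne_zero, natDegree_monicOrtho]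

theorem natDegree_X_mul_ortho_sub (L : ℂ[X] →ₗ[ℂ] ℂ) (n : ℕ) :
    (X * ortho L n - ortho L (n + 1)).natDegree ≤ n := by
  rw [natDegree_le_iff_coeff_eq_zero]
  intro k hk
  rw [coeff_sub]
  rcases (Nat.succ_le_of_lt hk).eq_or_lt with rfl | hk
  · rw [coeff_X_mul, coeff_monicOrtho_self, coeff_monicOrtho_self, sub_self]
  · rw [coeff_eq_zero_of_natDegree_lt (p := X * ortho L n) (by rwa [natDegree_X_mul_ortho]),
      coeff_eq_zero_of_natDegree_lt (p := ortho L (n + 1)) (by rwa [natDegree_monicOrtho]),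
      sub_self]

theorem coeff_X_mul_ortho_sub (L : ℂ[X] →ₗ[ℂ] ℂ) (n : ℕ) :
    (X * ortho L n - ortho L (n + 1)).coeff n = subCoeff L n - subCoeff L (n + 1) := by
  rw [coeff_sub]
  rcases n with _ | n
  · simp [subCoeff]
  · rw [coeff_X_mul]; rfl

theorem shift_X_mul_sq (h : ∀ j ≤ n, norm2 L j ≠ 0) :
    shiftFunctional L (X * ortho L n ^ 2) = (subCoeff L n - subCoeff L (n + 1)) * norm2 L n := by
  have h1 := functional_monicOrtho_mul (fun j hj => h j (le_of_lt hj))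
    (natDegree_X_mul_ortho_sub L n)
  have h2 : shiftFunctional L (ortho L (n + 1) * ortho L n) = 0 :=
    monicOrtho_ortho (fun j hj => h j (by omega)) n (by omega)
  rw [coeff_X_mul_ortho_sub, mul_sub, map_sub, mul_comm _ (ortho L (n + 1)), h2, sub_zero] at h1
  rw [← h1, show X * ortho L n ^ 2 = ortho L n * (X * ortho L n) by ring]

theorem coeff_X_mul_derivative (P : ℂ[X]) (k : ℕ) :
    (X * derivative P).coeff k = k * P.coeff k := by
  rcases k with _ | k
  · simp
  · rw [coeff_X_mul, coeff_derivative]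
    push_cast
    ring

theorem natDegree_X_mul_derivative_le (P : ℂ[X]) :
    (X * derivative P).natDegree ≤ P.natDegree := by
  rw [natDegree_le_iff_coeff_eq_zero]
  intro k hk
  rw [coeff_X_mul_derivative, coeff_eq_zero_of_natDegree_lt hk, mul_zero]

/-- The diagonal recurrence coefficient in terms of `∫ p_n ^ 2 w / x`. -/
theorem subCoeff_sub_succ (hL : IsPearson a t L) (h : ∀ j ≤ n, norm2 L j ≠ 0) :
    subCoeff L n - subCoeff L (n + 1) = 2 * n + 3 + a - t * (1 - 2 * poleDiag L n) := by
  have hn := h n le_rfl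
  -- The Pearson equation at π_n² is evaluated by splitting (x + t) π_n² into its two summands.
  have h1 := hL (ortho L n ^ 2)
  have h2 : L (X * derivative (X * ortho L n ^ 2)) = (2 * n + 1) * norm2 L n := by
    rw [← shiftFunctional_apply, derivative_mul, derivative_X, derivative_pow,
      show (1 * ortho L n ^ 2 + X * (C ((2 : ℕ) : ℂ) * ortho L n ^ (2 - 1) *
        derivative (ortho L n)) : ℂ[X]) = ortho L n ^ 2 +
        C 2 * (ortho L n * (X * derivative (ortho L n))) by simp; ring, map_add,
      functional_C_mul, functional_monicOrtho_mul (fun j hj => h j (le_of_lt hj))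
        ((natDegree_X_mul_derivative_le _).trans (natDegree_monicOrtho _ _).le),
      coeff_X_mul_derivative, coeff_monicOrtho_self]
    change norm2 L n + _ = _
    ring
  have h3 := rate_sq h
  have h4 : rateFunctional L (X * ortho L n ^ 2) =
      (subCoeff L n - subCoeff L (n + 1)) * norm2 L n - (2 * n + 1) * norm2 L n
        - 2 * norm2 L n := by
    rw [rateFunctional_apply, ← shiftFunctional_apply, shift_X_mul_sq h, h2]
    rfl
  rw [add_mul, map_add, functional_C_mul, h4, h3] at h1
  change _ = a * norm2 L n at h1
  refine mul_right_cancel₀ hn ?_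
  linear_combination h1

/-- The off-diagonal recurrence coefficient in terms of `∫ π_n π_{n-1} w / x`. -/
theorem normRatio_eq (hL : IsPearson a t L) (h : ∀ j < n, norm2 L j ≠ 0) :
    normRatio L n = -subCoeff L n + t * (n + 2 * poleOff L n) := by
  rcases n with _ | n
  · simp [normRatio, subCoeff, poleOff]
  have hn := h n (by omega)
  have h' : ∀ j ≤ n, norm2 L j ≠ 0 := fun j hj => h j (by omega)
  have hlt' : ∀ j < n, norm2 L j ≠ 0 := fun j hj => h' j hj.le
  have h1 := hL (ortho L (n + 1) * ortho L n)
  have h0 : shiftFunctional L (ortho L (n + 1) * ortho L n) = 0 := monicOrtho_ortho h n (by omega)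
  have h2 : shiftFunctional L (X * (ortho L (n + 1) * ortho L n)) = norm2 L (n + 1) := by
    rw [show X * (ortho L (n + 1) * ortho L n) = ortho L (n + 1) * (X * ortho L n) by ring,
      functional_monicOrtho_mul h (natDegree_X_mul_ortho L n).le, coeff_X_mul,
      coeff_monicOrtho_self, one_mul]
  -- The operator x d/dx acts on the leading term as n + 1. What remains has degree at most n and
  -- coefficient -`subCoeff` at x^n.
  have hd : (X * derivative (ortho L (n + 1)) - C ((n + 1 : ℕ) : ℂ) * ortho L (n + 1)).natDegree
      ≤ n := by
    rw [natDegree_le_iff_coeff_eq_zero]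
    intro k hk
    rw [coeff_sub, coeff_X_mul_derivative, coeff_C_mul]
    rcases (Nat.succ_le_of_lt hk).eq_or_lt with rfl | hk
    · rw [sub_self]
    · rw [coeff_eq_zero_of_natDegree_lt (p := ortho L (n + 1)) (by rwa [natDegree_monicOrtho])]
      ring
  have h3 := functional_monicOrtho_mul hlt' hd
  rw [coeff_sub, coeff_X_mul_derivative, coeff_C_mul, mul_sub, map_sub,
    mul_left_comm _ (C _), functional_C_mul, mul_comm _ (monicOrtho _ (n + 1))] at h3
  erw [h0] at h3
  have h4 : shiftFunctional L (ortho L (n + 1) * (X * derivative (ortho L n))) = 0 := by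
    refine functional_monicOrtho_mul_of_degree_lt h ?_
    refine degree_le_natDegree.trans_lt ?_
    have := (natDegree_X_mul_derivative_le (ortho L n)).trans (natDegree_monicOrtho _ _).le
    exact_mod_cast Nat.lt_succ_of_le this
  have h5 : L (X * derivative (X * (ortho L (n + 1) * ortho L n))) =
      -subCoeff L (n + 1) * norm2 L n := by
    rw [← shiftFunctional_apply, show derivative (X * (ortho L (n + 1) * ortho L n)) =
      ortho L (n + 1) * ortho L n + ortho L n * (X * derivative (ortho L (n + 1)))
        + ortho L (n + 1) * (X * derivative (ortho L n)) by
        simp only [derivative_mul, derivative_X]; ring, map_add, map_add, h0, h4]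
    have : subCoeff L (n + 1) = (ortho L (n + 1)).coeff n := rfl
    rw [this]
    push_cast at h3
    linear_combination h3
  have h6 : rateFunctional L (X * (ortho L (n + 1) * ortho L n)) =
      norm2 L (n + 1) + subCoeff L (n + 1) * norm2 L n := by
    rw [rateFunctional_apply, ← shiftFunctional_apply, h2, h5, ← shiftFunctional_apply, h0]
    ring
  rw [add_mul, map_add, functional_C_mul, h6, rate_mul_prev h', h0] at h1
  rw [normRatio, div_eq_iff hn]
  push_cast
  linear_combination h1

theorem L_mul_prev (h : ∀ j ≤ n, norm2 L j ≠ 0) :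
    L (ortho L (n + 1) * ortho L n) = (ortho L n).eval 0 * L (ortho L (n + 1)) :=
  functional_eq_eval_zero (fun j hj => h j (by omega)) (by rw [natDegree_monicOrtho]; omega)

/-- With `L_mul_prev` this evaluates one integral in two ways, the pole being reduced against
π_{n+1} or against π_n. Multiplying the two values gives the quadratic relation at 0. -/
theorem L_mul_prev' (h : ∀ j ≤ n, norm2 L j ≠ 0) :
    L (ortho L (n + 1) * ortho L n) = (ortho L (n + 1)).eval 0 * L (ortho L n) + norm2 L n := by
  have h1 : ortho L (n + 1) * ortho L n =
      X * (ortho L n * ortho L n) - ortho L n * (X * ortho L n - ortho L (n + 1)) := by ring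
  conv_lhs => rw [h1]
  rw [map_sub, functional_eq_eval_zero (fun j hj => h j (le_of_lt hj))
    (natDegree_X_mul_ortho_sub L n), ← shiftFunctional_apply, ← pow_two]
  simp only [eval_sub, eval_mul, eval_X]
  change norm2 L n - _ = _
  ring

theorem L_sq (h : ∀ j < n, norm2 L j ≠ 0) :
    L (ortho L n ^ 2) = (ortho L n).eval 0 * L (ortho L n) := by
  rw [pow_two]
  exact functional_eq_eval_zero h (natDegree_monicOrtho _ _).le

theorem rate_mul_prev_eval (hL : IsPearson a t L) (h : ∀ j ≤ n, norm2 L j ≠ 0) :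
    rateFunctional L (ortho L (n + 1) * ortho L n) =
      (ortho L n).eval (-t) * rateFunctional L (ortho L (n + 1)) :=
  rate_eq_eval hL (fun j hj => h j (by omega)) (by rw [natDegree_monicOrtho]; omega)

theorem rate_mul_prev_eval' (hL : IsPearson a t L) (h : ∀ j ≤ n, norm2 L j ≠ 0) :
    rateFunctional L (ortho L (n + 1) * ortho L n) =
      (ortho L (n + 1)).eval (-t) * rateFunctional L (ortho L n) + a * norm2 L n := by
  have h1 : ortho L (n + 1) * ortho L n = (X + C t) * (ortho L n * ortho L n)
      - ortho L n * (X * ortho L n - ortho L (n + 1)) - C t * (ortho L n * ortho L n) := by ring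
  conv_lhs => rw [h1]
  rw [map_sub, map_sub, rate_eq_eval hL (fun j hj => h j (le_of_lt hj))
    (natDegree_X_mul_ortho_sub L n), hL, functional_C_mul,
    rate_eq_eval hL (fun j hj => h j (le_of_lt hj)) (natDegree_monicOrtho _ _).le, ← pow_two]
  simp only [eval_sub, eval_mul, eval_X]
  change a * norm2 L n - _ - _ = _
  ring

theorem rate_sq_eval (hL : IsPearson a t L) (h : ∀ j < n, norm2 L j ≠ 0) :
    rateFunctional L (ortho L n ^ 2) =
      (ortho L n).eval (-t) * rateFunctional L (ortho L n) := by
  rw [pow_two]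
  exact rate_eq_eval hL h (natDegree_monicOrtho _ _).le

/-- The quadratic relation at the singular point `0`. -/
theorem normRatio_mul_poleDiag (h : ∀ j ≤ n, norm2 L j ≠ 0) :
    normRatio L n * poleDiag L n * poleDiagPred L n = poleOff L n ^ 2 - poleOff L n := by
  rcases n with _ | n
  · simp [normRatio, poleOff]
  have hn := h n (by omega)
  have hn1 := h (n + 1) le_rfl
  have h' : ∀ j ≤ n, norm2 L j ≠ 0 := fun j hj => h j (by omega)
  have e1 := L_mul_prev h'
  have e2 := L_mul_prev' h'
  have e3 := L_sq (L := L) (n := n + 1) fun j hj => h j hj.le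
  have e4 := L_sq (L := L) (n := n) fun j hj => h' j hj.le
  simp only [normRatio, poleDiagPred, poleDiag, poleOff, e3, e4]
  field_simp
  -- The product of the two evaluations regroups into L(π_n²) L(π_{n+1}²).
  have e5 : L (ortho L (n + 1) * ortho L n) * (L (ortho L (n + 1) * ortho L n) - norm2 L n) =
      (ortho L n).eval 0 * L (ortho L (n + 1)) * ((ortho L (n + 1)).eval 0 * L (ortho L n)) := by
    rw [← e1, e2]; ring
  linear_combination -e5

/-- The quadratic relation at the singular point `-t`. -/
theorem normRatio_mul_one_sub_poleDiag (hL : IsPearson a t L) (h : ∀ j ≤ n, norm2 L j ≠ 0) :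
    normRatio L n * (1 - 2 * poleDiag L n) * (1 - 2 * poleDiagPred L n) =
      (n + 2 * poleOff L n) * (n + 2 * poleOff L n + a) := by
  rcases n with _ | n
  · simp [normRatio, poleOff]
  have hn := h n (by omega)
  have hn1 := h (n + 1) le_rfl
  have h' : ∀ j ≤ n, norm2 L j ≠ 0 := fun j hj => h j (by omega)
  have e1 := rate_mul_prev_eval hL h'
  have e2 := rate_mul_prev_eval' hL h'
  have e3 := rate_sq_eval hL (n := n + 1) fun j hj => h j hj.le
  have e4 := rate_sq_eval hL (n := n) fun j hj => h' j hj.le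
  rw [rate_sq h] at e3
  rw [rate_sq h'] at e4
  rw [rate_mul_prev h'] at e1 e2
  simp only [normRatio, poleDiagPred]
  refine mul_right_cancel₀ (pow_ne_zero 2 hn) ?_
  have : norm2 L (n + 1) / norm2 L n * (1 - 2 * poleDiag L (n + 1)) * (1 - 2 * poleDiag L n)
      * norm2 L n ^ 2 = ((1 - 2 * poleDiag L (n + 1)) * norm2 L (n + 1)) *
        ((1 - 2 * poleDiag L n) * norm2 L n) := by field_simp
  rw [this, e3, e4]
  push_cast
  -- The same regrouping with D in place of L: the two evaluations of D(π_{n+1} π_n) differ by a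
  -- h_n.
  have e5 : (-(n + 1 + 2 * poleOff L (n + 1)) * norm2 L n) *
      (-(n + 1 + 2 * poleOff L (n + 1)) * norm2 L n - a * norm2 L n) =
      (ortho L n).eval (-t) * rateFunctional L (ortho L (n + 1)) *
      ((ortho L (n + 1)).eval (-t) * rateFunctional L (ortho L n)) := by
    rw [← e1, e2]; ring
  linear_combination -e5

theorem eq_zero_of_ortho {Q : ℂ[X]} (h : ∀ j < n, norm2 L j ≠ 0) (hd : Q.degree < n)
    (hQ : ∀ j < n, shiftFunctional L (ortho L j * Q) = 0) : Q = 0 := by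
  by_contra hne
  have hlt : Q.natDegree < n := (natDegree_lt_iff_degree_lt hne).2 hd
  have h1 := functional_monicOrtho_mul (W := shiftFunctional L) (n := Q.natDegree)
    (fun j hj => h j (hj.trans hlt)) le_rfl
  erw [hQ _ hlt] at h1
  exact mul_ne_zero (leadingCoeff_ne_zero.2 hne) (h _ hlt) h1.symm

theorem ortho_mul_of_lt {j m : ℕ} (h : ∀ i < m, norm2 L i ≠ 0) (hj : j < m) :
    shiftFunctional L (ortho L j * ortho L m) = 0 := by
  rw [mul_comm]
  exact monicOrtho_ortho h j hj

/-- The three term recurrence relation. -/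
theorem X_mul_ortho_succ (h : ∀ j ≤ n + 1, norm2 L j ≠ 0) :
    X * ortho L (n + 1) = ortho L (n + 2) +
      C (subCoeff L (n + 1) - subCoeff L (n + 2)) * ortho L (n + 1) +
      C (normRatio L (n + 1)) * ortho L n := by
  set b := subCoeff L (n + 1) - subCoeff L (n + 2) with hb
  have hn := h n (by omega)
  have h0 : ∀ j < n + 1, norm2 L j ≠ 0 := fun j hj => h j (by omega)
  have h1 : ∀ j < n + 2, norm2 L j ≠ 0 := fun j hj => h j (by omega)
  have h2 : ∀ j < n, norm2 L j ≠ 0 := fun j hj => h j (by omega)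
  -- Multiplication by x is symmetric for W, so x π_{n+1} pairs with π_j nontrivially only for j = n
  -- in this range.
  have hpair : ∀ j ≤ n, shiftFunctional L (ortho L j * (X * ortho L (n + 1))) =
      if j = n then norm2 L (n + 1) else 0 := by
    intro j hj
    rw [show ortho L j * (X * ortho L (n + 1)) = ortho L (n + 1) * (X * ortho L j) by ring,
      functional_monicOrtho_mul h0 ((natDegree_X_mul_ortho L j).le.trans (by omega)), coeff_X_mul]
    split_ifs with hjn
    · rw [hjn, coeff_monicOrtho_self, one_mul]
    · rw [coeff_eq_zero_of_natDegree_lt (p := ortho L j)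
        (by rw [natDegree_monicOrtho]; omega), zero_mul]
  have hdeg1 : (X * ortho L (n + 1) - ortho L (n + 2) - C b * ortho L (n + 1)).degree
      < ((n + 1 : ℕ) : WithBot ℕ) := by
    rw [hb, ← coeff_X_mul_ortho_sub]
    refine degree_sub_monicOrtho_lt (degree_le_natDegree.trans_lt ?_)
    exact_mod_cast Nat.lt_succ_of_le (natDegree_X_mul_ortho_sub L (n + 1))
  have hdeg : (X * ortho L (n + 1) - ortho L (n + 2) - C b * ortho L (n + 1)
      - C (normRatio L (n + 1)) * ortho L n).degree < ((n + 1 : ℕ) : WithBot ℕ) := by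
    refine (degree_sub_le _ _).trans_lt (max_lt hdeg1 ?_)
    rw [← smul_eq_C_mul]
    refine (degree_smul_le _ _).trans_lt ?_
    rw [degree_monicOrtho]
    exact_mod_cast Nat.lt_succ_self n
  have hz := eq_zero_of_ortho h0 hdeg fun j hj => by
    have hj' : j ≤ n := by omega
    rw [mul_sub, mul_sub, mul_sub, map_sub, map_sub, map_sub, hpair j hj',
      ortho_mul_of_lt h1 (by omega), mul_left_comm, functional_C_mul, ortho_mul_of_lt h0 hj,
      mul_left_comm, functional_C_mul]
    split_ifs with hjn
    · have : shiftFunctional L (ortho L n * ortho L n) = norm2 L n := by rw [← pow_two]; rfl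
      rw [hjn, this, normRatio, div_mul_cancel₀ _ hn]
      ring
    · rw [ortho_mul_of_lt h2 (by omega)]
      ring
  linear_combination hz

/-- Apply L to the three term recurrence times π_n; the factor ρ_n changes the normalisation of
L(π_n π_{n-1}) from h_n to h_{n-1}. -/
theorem poleOff_succ (h : ∀ j ≤ n, norm2 L j ≠ 0) :
    poleOff L (n + 1) = 1 - (subCoeff L n - subCoeff L (n + 1)) * poleDiag L n - poleOff L n := by
  have hn := h n le_rfl
  set b := subCoeff L n - subCoeff L (n + 1) with hb
  have key : ortho L (n + 1) * ortho L n = X * (ortho L n ^ 2) - C b * ortho L n ^ 2 -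
      (if n = 0 then 0 else C (normRatio L n) * (ortho L n * ortho L (n - 1))) := by
    rcases n with _ | n
    · have h1 := degree_sub_monicOrtho_lt (W := shiftFunctional L)
        (P := X * ortho L 0 - ortho L 1) (m := 0) (degree_le_natDegree.trans_lt (by
          exact_mod_cast Nat.lt_succ_of_le (natDegree_X_mul_ortho_sub L 0)))
      rw [coeff_X_mul_ortho_sub] at h1
      have h2 : X * ortho L 0 - ortho L 1 - C b * ortho L 0 = 0 := by
        rwa [Nat.cast_zero, Nat.WithBot.lt_zero_iff, degree_eq_bot] at h1
      rw [if_pos rfl]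
      linear_combination (-ortho L 0) * h2
    · rw [if_neg (Nat.succ_ne_zero n), Nat.add_sub_cancel]
      linear_combination (-ortho L (n + 1)) * X_mul_ortho_succ h
  have h3 : L (if n = 0 then 0 else C (normRatio L n) * (ortho L n * ortho L (n - 1))) =
      poleOff L n * norm2 L n := by
    rcases n with _ | n
    · simp [poleOff]
    · have hn' := h n (by omega)
      rw [if_neg (Nat.succ_ne_zero n), functional_C_mul, Nat.add_sub_cancel, poleOff, normRatio]
      field_simp
  rw [poleOff, key, map_sub, map_sub, h3, functional_C_mul, ← shiftFunctional_apply]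
  change (norm2 L n - _ - _) / _ = _
  rw [poleDiag]
  field_simp

end

/-! ### The differential equations for θ and κ. -/

noncomputable section

/-- The properties of the family `L t P = ∫ x (x + t) ^ a e ^ (-x) P` used for the differential
equations at `t`. -/
structure IsPearsonFamilyAt (a : ℂ) (L : ℂ → ℂ[X] →ₗ[ℂ] ℂ) (t : ℂ) : Prop where
  pearson : ∀ᶠ x in 𝓝 t, IsPearson a x (L x)
  analyticAt : ∀ k, AnalyticAt ℂ (fun x => L x (X ^ k)) t
  hasDerivAt : ∀ k,
    HasDerivAt (fun x => shiftFunctional (L x) (X ^ k)) (rateFunctional (L t) (X ^ k)) t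

variable {a t : ℂ} {L : ℂ → ℂ[X] →ₗ[ℂ] ℂ} {n : ℕ}

theorem IsPearsonFamilyAt.shift_analyticAt (hL : IsPearsonFamilyAt a L t) (k : ℕ) :
    AnalyticAt ℂ (fun x => shiftFunctional (L x) (X ^ k)) t := by
  simp only [shiftFunctional_apply, ← pow_succ']
  exact hL.analyticAt (k + 1)

theorem IsPearsonFamilyAt.eventually_norm2 (hL : IsPearsonFamilyAt a L t)
    (h : ∀ j < n, norm2 (L t) j ≠ 0) : ∀ᶠ x in 𝓝 t, ∀ j < n, norm2 (L x) j ≠ 0 :=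
  eventually_sqNorm_ne_zero (W := fun x => shiftFunctional (L x)) hL.shift_analyticAt h

theorem IsPearsonFamilyAt.hasDerivAt_subCoeff (hL : IsPearsonFamilyAt a L t)
    (h : ∀ j < n, norm2 (L t) j ≠ 0) :
    HasDerivAt (fun x => subCoeff (L x) n) (n + 2 * poleOff (L t) n) t := by
  rcases n with _ | n
  · simpa [subCoeff, poleOff] using hasDerivAt_const t (0 : ℂ)
  have h' : ∀ j ≤ n, norm2 (L t) j ≠ 0 := fun j hj => h j (by omega)
  have hn := h' n le_rfl
  have h1 := hasDerivAt_coeff_monicOrtho (W := fun x => shiftFunctional (L x))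
    hL.shift_analyticAt hL.hasDerivAt h'
  refine h1.congr_deriv ?_
  rw [rate_mul_prev h', neg_mul, neg_neg, mul_div_cancel_right₀ _ hn]
  push_cast
  ring

theorem IsPearsonFamilyAt.hasDerivAt_norm2 (hL : IsPearsonFamilyAt a L t)
    (h : ∀ j ≤ n, norm2 (L t) j ≠ 0) :
    HasDerivAt (fun x => norm2 (L x) n) ((1 - 2 * poleDiag (L t) n) * norm2 (L t) n) t := by
  rw [← rate_sq h]
  exact hasDerivAt_sqNorm (W := fun x => shiftFunctional (L x))
    hL.shift_analyticAt hL.hasDerivAt fun j hj => h j hj.le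

/-- The logarithmic derivative of h_n is 1 - 2R_n, so that of ρ_n is 2(R_{n-1} - R_n). -/
theorem IsPearsonFamilyAt.hasDerivAt_normRatio (hL : IsPearsonFamilyAt a L t)
    (h : ∀ j ≤ n, norm2 (L t) j ≠ 0) :
    HasDerivAt (fun x => normRatio (L x) n)
      (2 * normRatio (L t) n * (poleDiagPred (L t) n - poleDiag (L t) n)) t := by
  rcases n with _ | n
  · simpa [normRatio] using hasDerivAt_const t (0 : ℂ)
  have hn := h n (by omega)
  refine ((hL.hasDerivAt_norm2 h).div (hL.hasDerivAt_norm2 fun j hj => h j (by omega))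
    hn).congr_deriv ?_
  simp only [normRatio, poleDiagPred]
  field_simp
  ring

/-- The function `θ_n` of the functional at `t`. -/
def thetaOf (a t : ℂ) (L : ℂ[X] →ₗ[ℂ] ℂ) (n : ℕ) : ℂ :=
  2 * n + a + 3 - t - (subCoeff L n - subCoeff L (n + 1))

/-- The function `κ_n` of the functional at `t`. -/
def kappaOf (t : ℂ) (L : ℂ[X] →ₗ[ℂ] ℂ) (n : ℕ) : ℂ :=
  (n + 1) * t - normRatio L n - subCoeff L n

theorem thetaOf_eq {L : ℂ[X] →ₗ[ℂ] ℂ} (hL : IsPearson a t L) (h : ∀ j ≤ n, norm2 L j ≠ 0) :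
    thetaOf a t L n = -2 * t * poleDiag L n := by
  rw [thetaOf, subCoeff_sub_succ hL h]
  ring

theorem kappaOf_eq {L : ℂ[X] →ₗ[ℂ] ℂ} (hL : IsPearson a t L) (h : ∀ j < n, norm2 L j ≠ 0) :
    kappaOf t L n = t * (1 - 2 * poleOff L n) := by
  rw [kappaOf, normRatio_eq hL h]
  ring

theorem IsPearsonFamilyAt.hasDerivAt_thetaOf (hL : IsPearsonFamilyAt a L t)
    (h : ∀ j ≤ n, norm2 (L t) j ≠ 0) :
    HasDerivAt (fun x => thetaOf a x (L x) n)
      (2 * (poleOff (L t) (n + 1) - poleOff (L t) n)) t := by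
  have h1 := hL.hasDerivAt_subCoeff (n := n) fun j hj => h j hj.le
  have h2 := hL.hasDerivAt_subCoeff (n := n + 1) fun j hj => h j (by omega)
  refine (((hasDerivAt_id t).const_sub (2 * n + a + 3)).sub (h1.sub h2)).congr_deriv ?_
  push_cast
  ring

theorem IsPearsonFamilyAt.hasDerivAt_kappaOf (hL : IsPearsonFamilyAt a L t)
    (h : ∀ j ≤ n, norm2 (L t) j ≠ 0) :
    HasDerivAt (fun x => kappaOf x (L x) n)
      (1 - 2 * poleOff (L t) n
        - 2 * normRatio (L t) n * (poleDiagPred (L t) n - poleDiag (L t) n)) t := by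
  have h1 := hL.hasDerivAt_subCoeff (n := n) fun j hj => h j hj.le
  refine ((((hasDerivAt_id t).const_mul ((n : ℂ) + 1)).sub (hL.hasDerivAt_normRatio h)).sub
    h1).congr_deriv ?_
  ring

/-- The differential equation for `θ_n`. -/
theorem IsPearsonFamilyAt.thetaEquationAt (hL : IsPearsonFamilyAt a L t)
    (h : ∀ j ≤ n, norm2 (L t) j ≠ 0) :
    ThetaEquationAt a n (fun x => thetaOf a x (L x) n) (fun x => kappaOf x (L x) n) t := by
  have h1 := hL.hasDerivAt_thetaOf h
  have hp := hL.pearson.self_of_nhds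
  refine ⟨h1.differentiableAt, ?_⟩
  rw [h1.deriv, poleOff_succ h]
  simp only []
  rw [thetaOf_eq hp h, kappaOf_eq hp fun j hj => h j hj.le, subCoeff_sub_succ hp h]
  ring

theorem normRatio_mul_poleDiagPred {L : ℂ[X] →ₗ[ℂ] ℂ} (h : ∀ j ≤ n, norm2 L j ≠ 0)
    (hR : poleDiag L n ≠ 0) :
    normRatio L n * poleDiagPred L n = (poleOff L n ^ 2 - poleOff L n) / poleDiag L n := by
  rw [eq_div_iff hR, ← normRatio_mul_poleDiag h]
  ring

/-- Write ρ_n = ρ_n(1 - 2R_{n-1}) + 2ρ_n R_{n-1}; each quadratic relation supplies one summand in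
terms of R_n and r_n alone. -/
theorem normRatio_eq_div {L : ℂ[X] →ₗ[ℂ] ℂ} (hL : IsPearson a t L)
    (h : ∀ j ≤ n, norm2 L j ≠ 0) (hR : poleDiag L n ≠ 0) (hS : 1 - 2 * poleDiag L n ≠ 0) :
    normRatio L n = (n + 2 * poleOff L n) * (n + 2 * poleOff L n + a) / (1 - 2 * poleDiag L n)
      + 2 * ((poleOff L n ^ 2 - poleOff L n) / poleDiag L n) := by
  rw [← normRatio_mul_poleDiagPred h hR, ← normRatio_mul_one_sub_poleDiag hL h]
  field_simp
  ring

/-- The differential equation for `κ_n`. -/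
theorem IsPearsonFamilyAt.kappaEquationAt (hL : IsPearsonFamilyAt a L t)
    (h : ∀ j ≤ n, norm2 (L t) j ≠ 0) (hθ : thetaOf a t (L t) n ≠ 0)
    (hθt : thetaOf a t (L t) n + t ≠ 0) :
    KappaEquationAt a n (fun x => thetaOf a x (L x) n) (fun x => kappaOf x (L x) n) t := by
  have h1 := hL.hasDerivAt_kappaOf h
  have hp := hL.pearson.self_of_nhds
  refine ⟨h1.differentiableAt, ?_⟩
  rw [h1.deriv]
  simp only []
  rw [thetaOf_eq hp h] at hθ hθt ⊢
  rw [kappaOf_eq hp fun j hj => h j hj.le]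
  have ht : t ≠ 0 := by rintro rfl; simp at hθ
  have hR : poleDiag (L t) n ≠ 0 := by intro h0; simp [h0] at hθ
  have hS : 1 - 2 * poleDiag (L t) n ≠ 0 := by
    intro h0
    apply hθt
    linear_combination t * h0
  -- R_{n-1} occurs only in ρ_n R_{n-1}, which the relation at 0 eliminates. This also covers n = 0,
  -- where both quantities are 0 by convention.
  have e' : 2 * normRatio (L t) n * (poleDiagPred (L t) n - poleDiag (L t) n) =
      2 * (normRatio (L t) n * poleDiagPred (L t) n) - 2 * poleDiag (L t) n * normRatio (L t) n := by
    ring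
  rw [e', normRatio_mul_poleDiagPred h hR, normRatio_eq_div hp h hR hS]
  have e : -2 * t * poleDiag (L t) n + t = t * (1 - 2 * poleDiag (L t) n) := by ring
  rw [e]
  generalize poleDiag (L t) n = R at *
  generalize poleOff (L t) n = r at *
  have hS' : 1 - R * 2 ≠ 0 := by rwa [mul_comm]
  field_simp
  ring

end

/-! ### Hamilton's equations and Painlevé V. -/

noncomputable section

theorem hasDerivAt_okamoto_p (v₁ v₂ v₃ v₄ t q p : ℂ) :
    HasDerivAt (fun y => okamotoHamiltonian v₁ v₂ v₃ v₄ t q y)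
      ((2 * q * (q - 1) ^ 2 * p
        - ((v₂ - v₁) * (q - 1) ^ 2 - 2 * (v₁ + v₂) * q * (q - 1) + t * q)) / t) p := by
  have h1 : HasDerivAt (fun y : ℂ => y) 1 p := hasDerivAt_id p
  have h2 := ((((h1.pow 2).const_mul (q * (q - 1) ^ 2)).sub (h1.const_mul
    ((v₂ - v₁) * (q - 1) ^ 2 - 2 * (v₁ + v₂) * q * (q - 1) + t * q))).add_const
    ((v₃ - v₁) * (v₄ - v₁) * (q - 1))).div_const t
  refine h2.congr_deriv ?_
  simp
  ring

theorem hasDerivAt_okamoto_q (v₁ v₂ v₃ v₄ t q p : ℂ) :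
    HasDerivAt (fun x => okamotoHamiltonian v₁ v₂ v₃ v₄ t x p)
      ((((q - 1) ^ 2 + 2 * q * (q - 1)) * p ^ 2
        - (2 * (v₂ - v₁) * (q - 1) - 2 * (v₁ + v₂) * (2 * q - 1) + t) * p
        + (v₃ - v₁) * (v₄ - v₁)) / t) q := by
  have h1 : HasDerivAt (fun y : ℂ => y) 1 q := hasDerivAt_id q
  have h3 : HasDerivAt (fun y : ℂ => y - 1) 1 q := h1.sub_const 1
  have h2 := ((((h1.mul (h3.pow 2)).mul_const (p ^ 2)).sub (((((h3.pow 2).const_mul (v₂ - v₁)).sub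
    ((h1.const_mul (2 * (v₁ + v₂))).mul h3)).add (h1.const_mul t)).mul_const p)).add
    (h3.const_mul ((v₃ - v₁) * (v₄ - v₁)))).div_const t
  refine h2.congr_deriv ?_
  simp
  ring

variable {a : ℂ} {n : ℕ} {v₁ v₂ v₃ v₄ : ℂ}

/-- Hamilton's equations, written out. -/
theorem okamotoSystemAt_iff (hv : v₁ + v₂ + v₃ + v₄ = 0)
    (hv₂ : v₂ - v₁ = -2) (hv₃ : v₃ - v₁ = n + a) (hv₄ : v₄ - v₁ = n) {q p : ℂ → ℂ} {t : ℂ}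
    (ht : t ≠ 0) :
    OkamotoSystemAt v₁ v₂ v₃ v₄ q p t ↔
      DifferentiableAt ℂ q t ∧ DifferentiableAt ℂ p t ∧
      t * deriv q t = 2 * q t * (q t - 1) ^ 2 * p t + 2 * (q t - 1) ^ 2
        - (2 * n + a + 2) * q t * (q t - 1) - t * q t ∧
      t * deriv p t = -((q t - 1) ^ 2 + 2 * q t * (q t - 1)) * p t ^ 2
        + (-4 * (q t - 1) + (2 * n + a + 2) * (2 * q t - 1) + t) * p t - n * (n + a) := by
  have h12 : 2 * (v₁ + v₂) = -(2 * n + a + 2) := by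
    linear_combination hv + hv₂ - hv₃ - hv₄
  rw [OkamotoSystemAt, (hasDerivAt_okamoto_p _ _ _ _ _ _ _).deriv,
    (hasDerivAt_okamoto_q _ _ _ _ _ _ _).deriv, hv₂, hv₃, hv₄, h12, ← neg_div, eq_div_iff ht,
    eq_div_iff ht]
  refine and_congr_right fun _ => and_congr_right fun _ => and_congr ?_ ?_
  · constructor <;> intro h <;> linear_combination h
  · constructor <;> intro h <;> linear_combination h

/-- The change of variables turns Hamilton's equations into the equations for `θ` and `κ`. -/
theorem okamoto_to_thetaKappa {U : Set ℂ} {Θ K q r : ℂ → ℂ} (hU : IsOpen U)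
    (h : ∀ t ∈ U, t ≠ 0 ∧ q t ≠ 0 ∧ q t ≠ 1 ∧
      Θ t = t * (q t / (1 - q t)) ∧ K t = t * (1 + q t * r t)) {t : ℂ} (ht : t ∈ U)
    (hv : v₁ + v₂ + v₃ + v₄ = 0)
    (hv₂ : v₂ - v₁ = -2) (hv₃ : v₃ - v₁ = n + a) (hv₄ : v₄ - v₁ = n)
    (hO : OkamotoSystemAt v₁ v₂ v₃ v₄ q r t) :
    ThetaEquationAt a n Θ K t ∧ KappaEquationAt a n Θ K t := by
  obtain ⟨ht0, hq0, hq1, hΘ, hK⟩ := h t ht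
  obtain ⟨hq, hr, eq, er⟩ := (okamotoSystemAt_iff hv hv₂ hv₃ hv₄ ht0).1 hO
  have hq1' : 1 - q t ≠ 0 := sub_ne_zero.2 hq1.symm
  have hdΘ : HasDerivAt Θ (q t / (1 - q t) + t * (deriv q t / (1 - q t) ^ 2)) t := by
    have h1 := (hasDerivAt_id t).mul (hq.hasDerivAt.div (hq.hasDerivAt.const_sub 1) hq1')
    refine (h1.congr_of_eventuallyEq ?_).congr_deriv ?_
    · filter_upwards [hU.mem_nhds ht] with x hx using (h x hx).2.2.2.1
    · simp only [Pi.div_apply, id]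
      field_simp
      ring
  have hdK : HasDerivAt K (1 + q t * r t + t * (deriv q t * r t + q t * deriv r t)) t := by
    have h1 := (hasDerivAt_id t).mul ((hq.hasDerivAt.mul hr.hasDerivAt).const_add 1)
    refine (h1.congr_of_eventuallyEq ?_).congr_deriv ?_
    · filter_upwards [hU.mem_nhds ht] with x hx using (h x hx).2.2.2.2
    · simp
  have hΘt : t * (q t / (1 - q t)) + t = t / (1 - q t) := by field_simp; ring
  refine ⟨⟨hdΘ.differentiableAt, ?_⟩, ⟨hdK.differentiableAt, ?_⟩⟩
  · rw [hdΘ.deriv, hΘ, hK]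
    have : t * (q t / (1 - q t) + t * (deriv q t / (1 - q t) ^ 2)) =
      t * (q t / (1 - q t) + (t * deriv q t) / (1 - q t) ^ 2) := by ring
    rw [this, eq]
    field_simp
    ring
  · rw [hdK.deriv, hΘ, hK, hΘt]
    have : t * (1 + q t * r t + t * (deriv q t * r t + q t * deriv r t)) =
      t * (1 + q t * r t + ((t * deriv q t) * r t + q t * (t * deriv r t))) := by ring
    rw [this, eq, er]
    field_simp
    ring

/-- The change of variables turns the equations for `θ` and `κ` into Hamilton's equations. -/
theorem thetaKappa_to_okamoto {U : Set ℂ} {Θ K q r : ℂ → ℂ} (hU : IsOpen U)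
    (h : ∀ t ∈ U, t ≠ 0 ∧ q t ≠ 0 ∧ q t ≠ 1 ∧
      Θ t = t * (q t / (1 - q t)) ∧ K t = t * (1 + q t * r t)) {t : ℂ} (ht : t ∈ U)
    (hv : v₁ + v₂ + v₃ + v₄ = 0)
    (hv₂ : v₂ - v₁ = -2) (hv₃ : v₃ - v₁ = n + a) (hv₄ : v₄ - v₁ = n)
    (hT : ThetaEquationAt a n Θ K t) (hKe : KappaEquationAt a n Θ K t) :
    OkamotoSystemAt v₁ v₂ v₃ v₄ q r t := by
  obtain ⟨ht0, hq0, hq1, hΘ, hK⟩ := h t ht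
  obtain ⟨dΘ, eΘ⟩ := hT
  obtain ⟨dK, eK⟩ := hKe
  have hq1' : 1 - q t ≠ 0 := sub_ne_zero.2 hq1.symm
  -- Differentiability of q and r is part of the conclusion, so both are first recovered as rational
  -- functions of Θ and K on the open set.
  have hform : ∀ x ∈ U, q x = Θ x / (Θ x + x) := by
    intro x hx
    obtain ⟨hx0, -, hqx1, hΘx, -⟩ := h x hx
    have : 1 - q x ≠ 0 := sub_ne_zero.2 hqx1.symm
    rw [hΘx]
    have e : x * (q x / (1 - q x)) + x = x / (1 - q x) := by field_simp; ring
    rw [e]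
    field_simp
  have hΘt : Θ t + t = t / (1 - q t) := by rw [hΘ]; field_simp; ring
  have hΘt0 : Θ t + t ≠ 0 := by rw [hΘt]; exact div_ne_zero ht0 hq1'
  have hdq : HasDerivAt q ((deriv Θ t * t - Θ t) / (Θ t + t) ^ 2) t := by
    have h1 := dΘ.hasDerivAt.div (dΘ.hasDerivAt.add (hasDerivAt_id t)) hΘt0
    refine (h1.congr_of_eventuallyEq ?_).congr_deriv ?_
    · filter_upwards [hU.mem_nhds ht] with x hx using hform x hx
    · simp only [Pi.add_apply, id]
      congr 1
      ring
  have hformr : ∀ x ∈ U, r x = (K x / x - 1) / q x := by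
    intro x hx
    obtain ⟨hx0, hqx0, -, -, hKx⟩ := h x hx
    rw [hKx]
    field_simp
    ring
  have hdr : HasDerivAt r (((deriv K t * t - K t) / t ^ 2 * q t
      - (K t / t - 1) * deriv q t) / q t ^ 2) t := by
    have h1 := ((dK.hasDerivAt.div (hasDerivAt_id t) ht0).sub_const 1).div
      hdq.differentiableAt.hasDerivAt hq0
    refine (h1.congr_of_eventuallyEq ?_).congr_deriv ?_
    · filter_upwards [hU.mem_nhds ht] with x hx using hformr x hx
    · simp
  have eq : t * deriv q t = 2 * q t * (q t - 1) ^ 2 * r t + 2 * (q t - 1) ^ 2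
        - (2 * n + a + 2) * q t * (q t - 1) - t * q t := by
    rw [hdq.deriv, mul_comm (deriv Θ t), eΘ, hΘt, hK, hΘ]
    field_simp
    ring
  refine (okamotoSystemAt_iff hv hv₂ hv₃ hv₄ ht0).2
    ⟨hdq.differentiableAt, hdr.differentiableAt, eq, ?_⟩
  have e1 : t * deriv r t = ((t * deriv K t - K t) * q t
      - (K t - t) * (t * deriv q t)) / (t * q t ^ 2) := by
    rw [hdr.deriv]
    field_simp
  rw [e1, eq, eK, hΘt, hK, hΘ]
  field_simp
  ring

/-- The coordinate of the Hamiltonian system satisfies the fifth Painlevé equation. -/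
theorem painleveVAt_of_okamoto {U : Set ℂ} {q r : ℂ → ℂ} (hU : IsOpen U)
    (h : ∀ t ∈ U, t ≠ 0 ∧ q t ≠ 0 ∧ q t ≠ 1) (hv : v₁ + v₂ + v₃ + v₄ = 0)
    (hv₂ : v₂ - v₁ = -2) (hv₃ : v₃ - v₁ = n + a) (hv₄ : v₄ - v₁ = n)
    (hO : ∀ t ∈ U, OkamotoSystemAt v₁ v₂ v₃ v₄ q r t) {t : ℂ} (ht : t ∈ U) :
    PainleveVAt (a ^ 2 / 2) (-2) (-(2 * n + a + 3)) (-1 / 2) q t := by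
  obtain ⟨ht0, hq0, hq1⟩ := h t ht
  obtain ⟨hq, hr, eq, er⟩ := (okamotoSystemAt_iff hv hv₂ hv₃ hv₄ ht0).1 (hO t ht)
  -- The first Hamilton equation holds throughout the open set, so it can be differentiated. After
  -- substituting both first derivatives, Painlevé V is an identity of rational functions in t, q
  -- and r.
  have hform : ∀ x ∈ U, deriv q x = (2 * (q x * (q x - 1) ^ 2 * r x) + 2 * (q x - 1) ^ 2
        - (2 * n + a + 2) * (q x * (q x - 1)) - x * q x) / x := by
    intro x hx
    have hx0 := (h x hx).1
    obtain ⟨-, -, eqx, -⟩ := (okamotoSystemAt_iff hv hv₂ hv₃ hv₄ hx0).1 (hO x hx)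
    rw [eq_div_iff hx0, mul_comm, eqx]
    ring
  have hq' := hq.hasDerivAt
  have hq1' := hq'.sub_const 1
  have hd : HasDerivAt (deriv q)
      ((2 * ((deriv q t * (q t - 1) ^ 2 + q t * (2 * (q t - 1) * deriv q t)) * r t
        + q t * (q t - 1) ^ 2 * deriv r t) + 4 * (q t - 1) * deriv q t
        - (2 * n + a + 2) * (2 * q t - 1) * deriv q t - (q t + t * deriv q t) - deriv q t) / t)
      t := by
    have h1 := (((((((hq'.mul (hq1'.pow 2)).mul hr.hasDerivAt).const_mul 2).add
      ((hq1'.pow 2).const_mul 2)).sub ((hq'.mul hq1').const_mul (2 * (n : ℂ) + a + 2))).sub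
      ((hasDerivAt_id t).mul hq')).div (hasDerivAt_id t) ht0)
    refine (h1.congr_of_eventuallyEq ?_).congr_deriv ?_
    · filter_upwards [hU.mem_nhds ht] with x hx using hform x hx
    · simp only [Pi.add_apply, Pi.sub_apply, Pi.mul_apply, Pi.pow_apply, id]
      rw [hform t ht]
      field_simp
      simp
      ring
  refine ⟨hq, hd.differentiableAt, ?_⟩
  have hq1'' : q t - 1 ≠ 0 := sub_ne_zero.2 hq1
  have e2 : deriv r t = (-((q t - 1) ^ 2 + 2 * q t * (q t - 1)) * r t ^ 2
        + (-4 * (q t - 1) + (2 * n + a + 2) * (2 * q t - 1) + t) * r t - n * (n + a)) / t := by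
    rw [eq_div_iff ht0, mul_comm, er]
  rw [hd.deriv, e2, hform t ht]
  field_simp
  ring

end

/-! ### Functionals given by moments in the shifted variable y = x + t. -/

noncomputable section

/-- The functional with prescribed moments. -/
def momentFunctional (m : ℕ → ℂ) : ℂ[X] →ₗ[ℂ] ℂ :=
  lsum fun k => m k • (LinearMap.id : ℂ →ₗ[ℂ] ℂ)

theorem momentFunctional_X_pow (m : ℕ → ℂ) (k : ℕ) : momentFunctional m (X ^ k) = m k := by
  rw [momentFunctional, lsum_apply, X_pow_eq_monomial, sum_monomial_index]
  · simp
  · simp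

theorem functional_ext {V W : ℂ[X] →ₗ[ℂ] ℂ} (h : ∀ k, V (X ^ k) = W (X ^ k)) : V = W := by
  refine lhom_ext' fun k => LinearMap.ext_ring ?_
  simpa [← X_pow_eq_monomial] using h k

/-- The functional `P ↦ e ^ t Λ ((y - t) P (y - t))`, where `Λ` has the moments `l`. -/
def translated (l : ℕ → ℂ) (t : ℂ) : ℂ[X] →ₗ[ℂ] ℂ :=
  momentFunctional fun k => Complex.exp t * momentFunctional l ((X - C t) ^ (k + 1))

theorem translated_X_pow (l : ℕ → ℂ) (t : ℂ) (k : ℕ) : translated l t (X ^ k) =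
    Complex.exp t * momentFunctional l ((X - C t) ^ (k + 1)) :=
  momentFunctional_X_pow _ _

theorem translated_apply (l : ℕ → ℂ) (t : ℂ) (P : ℂ[X]) : translated l t P =
    Complex.exp t * momentFunctional l ((X - C t) * P.comp (X - C t)) := by
  have h : translated l t = Complex.exp t • (momentFunctional l ∘ₗ
      LinearMap.mulLeft ℂ (X - C t) ∘ₗ (aeval (X - C t : ℂ[X])).toLinearMap) := by
    refine functional_ext fun k => ?_
    rw [translated_X_pow]
    simp [pow_succ']
  rw [h]
  simp [comp_eq_aeval]

/-- Integration by parts for y^a e^{-y} on (t, ∞): ρ = t^a e^{-t} is the boundary value. With ρ = 0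
the same computation covers the complete gamma moments. -/
theorem momentFunctional_X_mul {a t ρ : ℂ} {l : ℕ → ℂ}
    (hl : ∀ j : ℕ, l (j + 1) = (a + 1 + j) * l j + t ^ (j + 1) * ρ) (F : ℂ[X]) :
    momentFunctional l (X * F) = momentFunctional l (derivative (X * F))
      + a * momentFunctional l F + ρ * t * F.eval t := by
  induction F using Polynomial.induction_on' with
  | add p q hp hq =>
    simp only [mul_add, map_add, eval_add]
    linear_combination hp + hq
  | monomial n c =>
    rw [← C_mul_X_pow_eq_monomial, show (X * (C c * X ^ n) : ℂ[X]) = C c * X ^ (n + 1) by ring,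
      derivative_C_mul_X_pow, functional_C_mul, functional_C_mul, functional_C_mul,
      Nat.add_sub_cancel]
    simp only [momentFunctional_X_pow, hl, eval_mul, eval_C, eval_pow, eval_X]
    push_cast
    ring

theorem isPearson_translated {a t ρ : ℂ} {l : ℕ → ℂ}
    (hl : ∀ j : ℕ, l (j + 1) = (a + 1 + j) * l j + t ^ (j + 1) * ρ) :
    IsPearson a t (translated l t) := by
  intro P
  -- The double zero at y = t makes the boundary term vanish, so ρ does not appear in the Pearson
  -- equation.
  have h := momentFunctional_X_mul hl ((X - C t) ^ 2 * P.comp (X - C t))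
  have e : derivative (X * ((X - C t) ^ 2 * P.comp (X - C t))) =
      C 2 * ((X - C t) * (X * P.comp (X - C t))) +
        (X - C t) * ((X - C t) * (P.comp (X - C t) + X * (derivative P).comp (X - C t))) := by
    simp only [derivative_mul, derivative_X, derivative_pow, derivative_sub, derivative_C,
      derivative_comp]
    simp
    ring
  rw [e, map_add, functional_C_mul] at h
  simp only [rateFunctional_apply, shiftFunctional_apply, translated_apply, mul_comp, X_comp,
    add_comp, C_comp, derivative_mul, derivative_add, derivative_X, derivative_C]
  simp only [sub_add_cancel, zero_comp, add_zero, one_mul, one_comp]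
  have e2 : (X - C t) * ((X - C t) * (X * P.comp (X - C t))) =
    X * ((X - C t) ^ 2 * P.comp (X - C t)) := by ring
  have e3 : (X - C t) * ((X - C t) * P.comp (X - C t)) = (X - C t) ^ 2 * P.comp (X - C t) := by
    ring
  rw [e2, e3, h]
  simp only [eval_mul, eval_pow, eval_sub, eval_X, eval_C, sub_self]
  ring

theorem hasPolyDerivAt_X_sub_C_pow (t : ℂ) (m : ℕ) :
    HasPolyDerivAt (fun x => (X - C x) ^ m) (-(C (m : ℂ) * (X - C t) ^ (m - 1))) t := by
  have h1 : HasPolyDerivAt (fun x => X - C x) (-1) t := by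
    refine ⟨⟨1, by simp, fun x => (natDegree_X_sub_C x).le⟩, fun i => ?_⟩
    simp only [coeff_sub, coeff_C, coeff_neg, coeff_one]
    split_ifs with h
    · exact (hasDerivAt_id t).const_sub _
    · simpa using hasDerivAt_const t _
  induction m with
  | zero => simpa using hasPolyDerivAt_const (t := t) 1
  | succ m ih =>
    have h2 := ih.mul h1
    simp only [← pow_succ] at h2
    convert h2 using 1
    rcases m with _ | m
    · simp
    · simp only [Nat.add_sub_cancel]
      push_cast
      rw [C_add]
      simp only [C_1]
      ring

theorem polyAnalyticAt_X_sub_C_pow (t : ℂ) (m : ℕ) :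
    PolyAnalyticAt (fun x : ℂ => (X - C x) ^ m) t := by
  refine PolyAnalyticAt.pow (PolyAnalyticAt.sub (polyAnalyticAt_const _) ?_) m
  refine ⟨⟨0, fun x => (natDegree_C _).le⟩, fun i => ?_⟩
  simp only [coeff_C]
  split_ifs
  · exact analyticAt_id
  · exact analyticAt_const

theorem analyticAt_translated {l : ℂ → ℕ → ℂ} {t : ℂ}
    (hl : ∀ j, AnalyticAt ℂ (fun x => l x j) t) (k : ℕ) :
    AnalyticAt ℂ (fun x => translated (l x) x (X ^ k)) t := by
  simp only [translated_X_pow]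
  refine analyticAt_cexp.mul ((polyAnalyticAt_X_sub_C_pow t (k + 1)).functional fun j => ?_)
  simpa only [momentFunctional_X_pow] using hl j

theorem momentFunctional_evaluation (c t : ℂ) (F : ℂ[X]) :
    momentFunctional (fun j => c * t ^ j) F = c * F.eval t := by
  induction F using Polynomial.induction_on' with
  | add p q hp hq => simp only [map_add, eval_add, hp, hq]; ring
  | monomial n d =>
    rw [← C_mul_X_pow_eq_monomial, functional_C_mul, momentFunctional_X_pow]
    simp
    ring

/-- Varying the lower limit of integration produces evaluation at y = t, where (y - t)^{k+2}
vanishes. Only the factor e^t and the translated polynomial contribute. -/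
theorem hasDerivAt_translated {l : ℂ → ℕ → ℂ} {t ρ : ℂ}
    (hl : ∀ j, HasDerivAt (fun x => l x j) (-ρ * t ^ j) t) (k : ℕ) :
    HasDerivAt (fun x => shiftFunctional (translated (l x) x) (X ^ k))
      (rateFunctional (translated (l t) t) (X ^ k)) t := by
  have h1 := (hasPolyDerivAt_X_sub_C_pow t (k + 2)).functional
    (W := fun x => momentFunctional (l x)) (W' := momentFunctional fun j => -ρ * t ^ j)
    (fun j => by simpa only [momentFunctional_X_pow] using hl j)
  have h2 := (Complex.hasDerivAt_exp t).mul h1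
  simp only [shiftFunctional_apply, ← pow_succ', translated_X_pow]
  refine h2.congr_deriv ?_
  have h3 : translated (l t) t (X * derivative (X ^ k)) = k * translated (l t) t (X ^ k) := by
    rcases k with _ | k
    · simp
    · rw [derivative_X_pow, Nat.add_sub_cancel, mul_left_comm, ← pow_succ', functional_C_mul]
  rw [rateFunctional_apply, h3, ← pow_succ', translated_X_pow, translated_X_pow,
    momentFunctional_evaluation]
  simp only [eval_pow, eval_sub, eval_X, eval_C, sub_self]
  rw [map_neg, functional_C_mul]
  have e : k + 2 - 1 = k + 1 := rfl
  rw [e]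
  push_cast
  ring

theorem isPearsonFamilyAt_translated {a t : ℂ} {l : ℂ → ℕ → ℂ} {ρ : ℂ → ℂ}
    (hl : ∀ᶠ x in 𝓝 t, ∀ j : ℕ, l x (j + 1) = (a + 1 + j) * l x j + x ^ (j + 1) * ρ x)
    (hl' : ∀ᶠ x in 𝓝 t, ∀ j : ℕ, HasDerivAt (fun y => l y j) (-ρ x * x ^ j) x) :
    IsPearsonFamilyAt a (fun x => translated (l x) x) t where
  pearson := hl.mono fun _ hx => isPearson_translated hx
  analyticAt k := analyticAt_translated (fun j => by
    rw [Complex.analyticAt_iff_eventually_differentiableAt]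
    exact hl'.mono fun x hx => (hx j).differentiableAt) k
  hasDerivAt k := hasDerivAt_translated hl'.self_of_nhds k

end

/-! ### The incomplete gamma function. -/

noncomputable section

/-- The entire function `γ(s, z) / z ^ s`, for the lower incomplete gamma function `γ`. -/
def lowerGammaSeries (s z : ℂ) : ℂ := ∑' i : ℕ, (-z) ^ i / ((i.factorial : ℂ) * (s + i))

theorem add_natCast_ne_zero {s : ℂ} (hs : 0 < s.re) (i : ℕ) : s + i ≠ 0 := by
  intro h
  have := congrArg Complex.re h
  simp at this
  have h2 : (0 : ℝ) ≤ i := Nat.cast_nonneg i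
  linarith

theorem norm_lowerGammaSeries_term_le {s : ℂ} (hs : 0 < s.re) {z : ℂ} {r : ℝ} (hz : ‖z‖ ≤ r)
    (i : ℕ) : ‖(-z) ^ i / ((i.factorial : ℂ) * (s + i))‖ ≤ r ^ i / i.factorial * s.re⁻¹ := by
  have h1 : s.re ≤ ‖s + i‖ := by
    refine le_trans ?_ (Complex.re_le_norm _)
    simp
  rw [norm_div, norm_mul, norm_pow, norm_neg, Complex.norm_natCast, ← div_div, div_eq_mul_inv]
  have h0 : 0 ≤ r := (norm_nonneg z).trans hz
  gcongr

theorem summable_lowerGammaSeries_bound (s : ℂ) (r : ℝ) :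
    Summable fun i : ℕ => r ^ i / i.factorial * s.re⁻¹ :=
  (Real.summable_pow_div_factorial r).mul_right _

theorem hasSum_lowerGammaSeries {s : ℂ} (hs : 0 < s.re) (z : ℂ) :
    HasSum (fun i : ℕ => (-z) ^ i / ((i.factorial : ℂ) * (s + i))) (lowerGammaSeries s z) :=
  (Summable.of_norm_bounded (summable_lowerGammaSeries_bound s ‖z‖)
    (norm_lowerGammaSeries_term_le hs le_rfl)).hasSum

theorem hasSum_exp_neg (z : ℂ) :
    HasSum (fun i : ℕ => (-z) ^ i / (i.factorial : ℂ)) (Complex.exp (-z)) := by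
  rw [Complex.exp_eq_exp_ℂ]
  exact NormedSpace.expSeries_div_hasSum_exp (-z)

theorem differentiable_lowerGammaSeries {s : ℂ} (hs : 0 < s.re) :
    Differentiable ℂ (lowerGammaSeries s) := by
  intro z
  have h := Complex.differentiableOn_tsum_of_summable_norm
    (summable_lowerGammaSeries_bound s (‖z‖ + 1)) (U := Metric.ball 0 (‖z‖ + 1))
    (F := fun (i : ℕ) (z : ℂ) => (-z) ^ i / ((i.factorial : ℂ) * (s + i)))
    (fun i => by fun_prop) Metric.isOpen_ball
    (fun i w hw => norm_lowerGammaSeries_term_le hs (mem_ball_zero_iff.1 hw).le i)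
  exact h.differentiableAt (Metric.isOpen_ball.mem_nhds (by simp))

/-- This equation makes z^s times the series an antiderivative of z^{s-1} e^{-z}. -/
theorem lowerGammaSeries_deriv {s : ℂ} (hs : 0 < s.re) (z : ℂ) :
    s * lowerGammaSeries s z + z * deriv (lowerGammaSeries s) z = Complex.exp (-z) := by
  have h := Complex.hasSum_deriv_of_summable_norm
    (summable_lowerGammaSeries_bound s (‖z‖ + 1)) (U := Metric.ball 0 (‖z‖ + 1)) (z := z)
    (F := fun (i : ℕ) (z : ℂ) => (-z) ^ i / ((i.factorial : ℂ) * (s + i)))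
    (fun i => by fun_prop) Metric.isOpen_ball
    (fun i w hw => norm_lowerGammaSeries_term_le hs (mem_ball_zero_iff.1 hw).le i) (by simp)
  refine (((hasSum_lowerGammaSeries hs z).mul_left s).add (h.mul_left z)).unique ?_
  refine (hasSum_exp_neg z).congr_fun fun i => ?_
  have hd : HasDerivAt (fun w : ℂ => (-w) ^ i / ((i.factorial : ℂ) * (s + i)))
      (i * (-z) ^ (i - 1) * -1 / ((i.factorial : ℂ) * (s + i))) z :=
    (((hasDerivAt_id z).neg.pow i).div_const _)
  rw [hd.deriv]
  have h1 := add_natCast_ne_zero hs i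
  have h2 : (i.factorial : ℂ) ≠ 0 := Nat.cast_ne_zero.2 i.factorial_ne_zero
  rcases i with _ | i
  · simp at h1 ⊢
    field_simp
  · rw [Nat.add_sub_cancel]
    field_simp
    ring

theorem lowerGammaSeries_add_one {s : ℂ} (hs : 0 < s.re) (z : ℂ) :
    z * lowerGammaSeries (s + 1) z = s * lowerGammaSeries s z - Complex.exp (-z) := by
  have h1 := ((hasSum_lowerGammaSeries hs z).mul_left s).sub (hasSum_exp_neg z)
  have h2 := (hasSum_lowerGammaSeries (s := s + 1) (by simp; linarith) z).mul_left z
  refine h2.unique ?_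
  -- The term with i = 0 vanishes, and shifting the index turns s + i into (s + 1) + i.
  rw [← hasSum_nat_add_iff' 1] at h1
  have h0 := add_natCast_ne_zero hs 0
  have e : ∑ i ∈ Finset.range 1,
      (s * ((-z) ^ i / ((i.factorial : ℂ) * (s + i))) - (-z) ^ i / (i.factorial : ℂ)) = 0 := by
    simp at h0 ⊢
    field_simp
    ring
  rw [e, sub_zero] at h1
  refine h1.congr_fun fun i => ?_
  have h3 := add_natCast_ne_zero hs (i + 1)
  have h4 : (i.factorial : ℂ) ≠ 0 := Nat.cast_ne_zero.2 i.factorial_ne_zero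
  have h5 : (i : ℂ) + 1 ≠ 0 := by exact_mod_cast Nat.succ_ne_zero i
  rw [Nat.factorial_succ]
  push_cast at h3 ⊢
  have h6 : s + 1 + i ≠ 0 := by rwa [add_assoc, add_comm 1]
  have h7 : s + (i + 1) = s + 1 + i := by ring
  rw [h7]
  field_simp
  ring

/-- The upper incomplete gamma function. -/
def incGamma (s z : ℂ) : ℂ := Complex.Gamma s - z ^ s * lowerGammaSeries s z

theorem hasDerivAt_cpow_mul_lowerGammaSeries {s z : ℂ} (hs : 0 < s.re)
    (hz : z ∈ Complex.slitPlane) :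
    HasDerivAt (fun z => z ^ s * lowerGammaSeries s z) (z ^ (s - 1) * Complex.exp (-z)) z := by
  have hz0 : z ≠ 0 := Complex.slitPlane_ne_zero hz
  have h1 : HasDerivAt (fun z : ℂ => z ^ s) (s * z ^ (s - 1)) z :=
    (Complex.hasStrictDerivAt_cpow_const hz).hasDerivAt
  refine (h1.mul (differentiable_lowerGammaSeries hs z).hasDerivAt).congr_deriv ?_
  have h2 : z ^ s = z ^ (s - 1) * z := by
    rw [Complex.cpow_sub _ _ hz0, Complex.cpow_one]
    field_simp
  rw [← lowerGammaSeries_deriv hs, h2]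
  ring

theorem hasDerivAt_incGamma {s z : ℂ} (hs : 0 < s.re) (hz : z ∈ Complex.slitPlane) :
    HasDerivAt (incGamma s) (-(z ^ (s - 1) * Complex.exp (-z))) z :=
  (hasDerivAt_cpow_mul_lowerGammaSeries hs hz).const_sub _

theorem incGamma_add_one {s z : ℂ} (hs : 0 < s.re) (hz : z ≠ 0) :
    incGamma (s + 1) z = s * incGamma s z + z ^ s * Complex.exp (-z) := by
  have hs0 : s ≠ 0 := by rintro rfl; simp at hs
  have h := lowerGammaSeries_add_one hs z
  rw [incGamma, incGamma, Complex.Gamma_add_one _ hs0, Complex.cpow_add _ _ hz, Complex.cpow_one]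
  linear_combination (-z ^ s) * h

theorem tendsto_incGamma_ofReal {s : ℂ} (hs : 0 < s.re) :
    Tendsto (fun x : ℝ => incGamma s x) atTop (𝓝 0) := by
  have h1 := (Complex.tendsto_partialGamma hs).const_sub (Complex.Gamma s)
  rw [← Complex.Gamma_eq_integral hs, sub_self] at h1
  refine h1.congr' ?_
  filter_upwards [eventually_ge_atTop (0 : ℝ)] with x hx
  rw [incGamma, Complex.partialGamma]
  congr 1
  have h2 := intervalIntegral.integral_eq_sub_of_hasDerivAt_of_le hx
    (f := fun y : ℝ => (y : ℂ) ^ s * lowerGammaSeries s y)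
    (f' := fun y : ℝ => (Real.exp (-y) : ℂ) * (y : ℂ) ^ (s - 1)) ?_ ?_ ?_
  · rw [h2]
    have hs0 : s ≠ 0 := by rintro rfl; simp at hs
    simp [Complex.zero_cpow hs0]
  · refine Continuous.continuousOn ?_
    exact (Complex.continuous_ofReal_cpow_const hs).mul
      ((differentiable_lowerGammaSeries hs).continuous.comp Complex.continuous_ofReal)
  · intro y hy
    have hy' : (y : ℂ) ∈ Complex.slitPlane := Complex.ofReal_mem_slitPlane.2 hy.1
    refine (hasDerivAt_cpow_mul_lowerGammaSeries hs hy').comp_ofReal.congr_deriv ?_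
    push_cast
    ring
  · rw [intervalIntegrable_iff_integrableOn_Ioc_of_le hx]
    exact (Complex.GammaIntegral_convergent hs).mono_set Set.Ioc_subset_Ioi_self

theorem norm_cpow_le_of_one_le {z b : ℂ} (hz : 1 ≤ ‖z‖) :
    ‖z ^ b‖ ≤ Real.exp (Real.pi * |b.im|) * ‖z‖ ^ ⌈b.re⌉₊ := by
  refine (Complex.norm_cpow_le z b).trans ?_
  rw [div_eq_mul_inv, mul_comm, ← Real.exp_neg]
  gcongr
  · rw [← neg_mul]
    refine (le_abs_self _).trans ?_
    rw [abs_mul, abs_neg]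
    gcongr
    exact Complex.abs_arg_le_pi z
  · rw [← Real.rpow_natCast]
    exact Real.rpow_le_rpow_of_exponent_le hz (Nat.le_ceil _)

theorem tendsto_pow_mul_exp_neg (C : ℝ) (N : ℕ) :
    Tendsto (fun x : ℝ => C * (2 * x) ^ N * Real.exp (-x)) atTop (𝓝 0) := by
  have h := (Real.tendsto_pow_mul_exp_neg_atTop_nhds_zero N).const_mul (C * 2 ^ N)
  rw [mul_zero] at h
  refine h.congr fun x => ?_
  ring

theorem ofReal_add_mem_slitPlane {t : ℂ} (ht : t ∈ Complex.slitPlane) {x : ℝ} (hx : 0 ≤ x) :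
    (x : ℂ) + t ∈ Complex.slitPlane := by
  rw [Complex.mem_slitPlane_iff] at ht ⊢
  simp only [Complex.add_re, Complex.add_im, Complex.ofReal_re, Complex.ofReal_im, zero_add]
  rcases ht with h | h
  · exact Or.inl (by linarith)
  · exact Or.inr h

/-- On the disc of radius |t| about a large x the derivative is exponentially small. The mean value
inequality therefore transfers the limit from the real axis to its translate. -/
theorem tendsto_incGamma {s : ℂ} (hs : 0 < s.re) (t : ℂ) :
    Tendsto (fun x : ℝ => incGamma s (x + t)) atTop (𝓝 0) := by
  have key : Tendsto (fun x : ℝ => incGamma s (x + t) - incGamma s x) atTop (𝓝 0) := by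
    refine squeeze_zero_norm' ?_ (tendsto_pow_mul_exp_neg
      (Real.exp (Real.pi * |(s - 1).im|) * Real.exp ‖t‖ * ‖t‖) ⌈(s - 1).re⌉₊)
    filter_upwards [eventually_gt_atTop (‖t‖ + 1)] with x hx
    have ht0 := norm_nonneg t
    have hball : ∀ z ∈ Metric.closedBall (x : ℂ) ‖t‖, |z.re - x| ≤ ‖t‖ := by
      intro z hz
      rw [mem_closedBall_iff_norm] at hz
      refine le_trans ?_ hz
      simpa using Complex.abs_re_le_norm (z - x)
    have hbound := Convex.norm_image_sub_le_of_norm_hasDerivWithin_le (𝕜 := ℂ) (f := incGamma s)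
      (f' := fun z => -(z ^ (s - 1) * Complex.exp (-z)))
      (s := Metric.closedBall (x : ℂ) ‖t‖)
      (C := Real.exp (Real.pi * |(s - 1).im|) * (2 * x) ^ ⌈(s - 1).re⌉₊ * Real.exp (‖t‖ - x))
      (x := (x : ℂ)) (y := (x : ℂ) + t)
      (fun z hz => (hasDerivAt_incGamma hs (Or.inl (by
        have := abs_le.1 (hball z hz)
        linarith))).hasDerivWithinAt) (fun z hz => ?_) (convex_closedBall _ _) (by simp)
      (by simp)
    · refine hbound.trans (le_of_eq ?_)
      rw [add_sub_cancel_left, Real.exp_sub, Real.exp_neg]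
      ring
    · have h1 := abs_le.1 (hball z hz)
      have h2 : 1 ≤ ‖z‖ := le_trans (by linarith) (Complex.re_le_norm z)
      have h3 : ‖z‖ ≤ 2 * x := by
        rw [mem_closedBall_iff_norm] at hz
        have : ‖z‖ ≤ ‖z - x‖ + ‖(x : ℂ)‖ := by simpa using norm_add_le (z - x) (x : ℂ)
        rw [Complex.norm_real, Real.norm_of_nonneg (by linarith)] at this
        linarith
      rw [norm_neg, norm_mul, Complex.norm_exp, Complex.neg_re]
      have h4 := norm_cpow_le_of_one_le (b := s - 1) h2
      have hx0 : 0 ≤ x := by linarith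
      refine mul_le_mul (h4.trans ?_) (Real.exp_le_exp.2 (by linarith)) (Real.exp_pos _).le
        (by positivity)
      gcongr
  have h := key.add (tendsto_incGamma_ofReal hs)
  rw [add_zero] at h
  exact h.congr fun x => by ring

end

/-! ### The integrals of the weight as moment functionals. -/

noncomputable section

/-- The function `(x + t) ^ a e ^ (-x)`. -/
def baseWeight (a t : ℂ) (x : ℝ) : ℂ := ((x : ℂ) + t) ^ a * Complex.exp (-(x : ℂ))

/-- Half of the exponential absorbs the growth of (x+t)^a and of Q. -/
theorem isBigO_baseWeight_mul (a t : ℂ) (Q : ℂ[X]) :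
    (fun x : ℝ => baseWeight a t x * Q.eval (x : ℂ)) =O[atTop]
      fun x => Real.exp (-(1 / 2) * x) := by
  induction Q using Polynomial.induction_on' with
  | add p q hp hq => simpa only [eval_add, mul_add] using hp.add hq
  | monomial k c =>
    set N := ⌈a.re⌉₊
    have h1 : (fun x : ℝ => x ^ (N + k) * Real.exp (-x)) =O[atTop]
        fun x => Real.exp (-(1 / 2) * x) := by
      have h2 := (isLittleO_pow_exp_pos_mul_atTop (N + k) (b := 1 / 2) (by norm_num)).isBigO.mul
        (isBigO_refl (fun x : ℝ => Real.exp (-x)) atTop)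
      refine h2.congr_right fun x => ?_
      rw [← Real.exp_add]
      ring_nf
    refine IsBigO.trans (IsBigO.of_bound (Real.exp (Real.pi * |a.im|) * 2 ^ N * ‖c‖) ?_) h1
    filter_upwards [eventually_gt_atTop (‖t‖ + 1)] with x hx
    have ht0 := norm_nonneg t
    have hx0 : 0 ≤ x := by linarith
    have hxn : ‖(x : ℂ)‖ = x := by rw [Complex.norm_real, Real.norm_of_nonneg hx0]
    have h3 : 1 ≤ ‖(x : ℂ) + t‖ := by
      have := norm_sub_le ((x : ℂ) + t) t
      rw [add_sub_cancel_right, hxn] at this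
      linarith
    have h4 : ‖(x : ℂ) + t‖ ≤ 2 * x := by
      have := norm_add_le (x : ℂ) t
      rw [hxn] at this
      linarith
    have h5 : ‖((x : ℂ) + t) ^ a‖ ≤ Real.exp (Real.pi * |a.im|) * (2 * x) ^ N :=
      (norm_cpow_le_of_one_le h3).trans (by gcongr)
    rw [baseWeight, eval_monomial, norm_mul, norm_mul, norm_mul, norm_pow, hxn, Complex.norm_exp,
      Complex.neg_re, Complex.ofReal_re, Real.norm_of_nonneg (by positivity)]
    calc ‖((x : ℂ) + t) ^ a‖ * Real.exp (-x) * (‖c‖ * x ^ k)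
        ≤ Real.exp (Real.pi * |a.im|) * (2 * x) ^ N * Real.exp (-x) * (‖c‖ * x ^ k) := by gcongr
      _ = Real.exp (Real.pi * |a.im|) * 2 ^ N * ‖c‖ * (x ^ (N + k) * Real.exp (-x)) := by
        rw [pow_add, mul_pow]; ring

variable {a t : ℂ}

theorem hasDerivAt_add_cpow (a : ℂ) (ht : t ∈ Complex.slitPlane) {x : ℝ} (hx : 0 ≤ x) :
    HasDerivAt (fun y : ℝ => ((y : ℂ) + t) ^ a) (a * ((x : ℂ) + t) ^ (a - 1)) x := by
  have h1 : HasDerivAt (fun y : ℂ => (y + t) ^ a) (a * ((x : ℂ) + t) ^ (a - 1) * 1) (x : ℂ) :=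
    ((hasDerivAt_id (x : ℂ)).add_const t).cpow_const (ofReal_add_mem_slitPlane ht hx)
  rw [mul_one] at h1
  exact h1.comp_ofReal

theorem hasDerivAt_exp_neg_ofReal (x : ℝ) :
    HasDerivAt (fun y : ℝ => Complex.exp (-(y : ℂ))) (-Complex.exp (-(x : ℂ))) x := by
  have h1 := ((hasDerivAt_id (x : ℂ)).neg.cexp).comp_ofReal
  simpa using h1

theorem hasDerivAt_eval_ofReal (Q : ℂ[X]) (x : ℝ) :
    HasDerivAt (fun y : ℝ => Q.eval (y : ℂ)) ((derivative Q).eval (x : ℂ)) x :=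
  (Q.hasDerivAt (x : ℂ)).comp_ofReal

theorem continuousOn_baseWeight_mul (a : ℂ) (ht : t ∈ Complex.slitPlane) (Q : ℂ[X]) :
    ContinuousOn (fun x : ℝ => baseWeight a t x * Q.eval (x : ℂ)) (Set.Ici 0) := fun x hx =>
  (((hasDerivAt_add_cpow a ht hx).mul (hasDerivAt_exp_neg_ofReal x)).mul
    (hasDerivAt_eval_ofReal Q x)).continuousAt.continuousWithinAt

theorem integrableOn_baseWeight_mul (a : ℂ) (ht : t ∈ Complex.slitPlane) (Q : ℂ[X]) :
    IntegrableOn (fun x : ℝ => baseWeight a t x * Q.eval (x : ℂ)) (Set.Ioi 0) := by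
  have hc := continuousOn_baseWeight_mul a ht Q
  have h := integrable_of_isBigO_exp_neg (b := 1 / 2) (by norm_num) hc.norm
    (isBigO_baseWeight_mul a t Q).norm_left
  exact (integrable_norm_iff ((hc.mono Set.Ioi_subset_Ici_self).aestronglyMeasurable
    measurableSet_Ioi)).1 h

theorem tendsto_baseWeight_mul (a t : ℂ) (Q : ℂ[X]) :
    Tendsto (fun x : ℝ => baseWeight a t x * Q.eval (x : ℂ)) atTop (𝓝 0) := by
  refine (isBigO_baseWeight_mul a t Q).trans_tendsto ?_
  refine Real.tendsto_exp_atBot.comp ?_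
  exact tendsto_id.const_mul_atTop_of_neg (by norm_num)

/-- The moments `Γ(a + 1 + j, z)`. -/
def incGammaMoments (a z : ℂ) (j : ℕ) : ℂ := incGamma (a + 1 + j) z

theorem re_add_one_add_pos (ha : -1 < a.re) (j : ℕ) : 0 < (a + 1 + j).re := by
  have h : (0 : ℝ) ≤ j := Nat.cast_nonneg j
  simp
  linarith

theorem hasDerivAt_incGammaMoments (ha : -1 < a.re) {z : ℂ} (hz : z ∈ Complex.slitPlane) (j : ℕ) :
    HasDerivAt (fun y => incGammaMoments a y j) (-(z ^ a * Complex.exp (-z)) * z ^ j) z := by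
  refine (hasDerivAt_incGamma (re_add_one_add_pos ha j) hz).congr_deriv ?_
  rw [show a + 1 + j - 1 = a + j by ring, Complex.cpow_add _ _ (Complex.slitPlane_ne_zero hz),
    Complex.cpow_natCast]
  ring

theorem incGammaMoments_succ (ha : -1 < a.re) {z : ℂ} (hz : z ≠ 0) (j : ℕ) :
    incGammaMoments a z (j + 1) = (a + 1 + j) * incGammaMoments a z j
      + z ^ (j + 1) * (z ^ a * Complex.exp (-z)) := by
  have h := incGamma_add_one (re_add_one_add_pos ha j) hz
  rw [incGammaMoments, incGammaMoments]
  push_cast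
  rw [← add_assoc, h, show a + 1 + (j : ℂ) = a + ((j + 1 : ℕ) : ℂ) by push_cast; ring,
    Complex.cpow_add _ _ hz, Complex.cpow_natCast]
  ring

/-- Integration against `(x + t) ^ a e ^ (-x)`, by incomplete gamma functions. -/
theorem integral_baseWeight_mul (ha : -1 < a.re) (ht : t ∈ Complex.slitPlane) (Q : ℂ[X]) :
    ∫ x in Set.Ioi (0 : ℝ), baseWeight a t x * Q.eval (x : ℂ) =
      Complex.exp t * momentFunctional (incGammaMoments a t) (Q.comp (X - C t)) := by
  set G := Q.comp (X - C t) with hG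
  -- An antiderivative vanishing at infinity: the moments Γ(a+1+j, z) have derivative -z^a e^{-z}
  -- z^j, so differentiating the functional evaluates `G` at x + t.
  set F : ℝ → ℂ := fun x => -Complex.exp t *
    momentFunctional (incGammaMoments a ((x : ℂ) + t)) G with hF
  have hsum : ∀ m : ℕ → ℂ, momentFunctional m G =
      ∑ i ∈ Finset.range (G.natDegree + 1), G.coeff i * m i := fun m => by
    rw [functional_eq_sum _ (Nat.lt_succ_self G.natDegree)]
    simp only [momentFunctional_X_pow]
  have hderiv : ∀ x ∈ Set.Ici (0 : ℝ), HasDerivAt F (baseWeight a t x * Q.eval (x : ℂ)) x := by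
    intro x hx
    have hz := ofReal_add_mem_slitPlane ht hx
    have h1 : ∀ i : ℕ, HasDerivAt (fun y : ℝ => incGammaMoments a ((y : ℂ) + t) i)
        (-(((x : ℂ) + t) ^ a * Complex.exp (-((x : ℂ) + t))) * ((x : ℂ) + t) ^ i) x := by
      intro i
      have h2 := (hasDerivAt_incGammaMoments ha hz i).comp (x : ℂ)
        ((hasDerivAt_id (x : ℂ)).add_const t)
      rw [mul_one] at h2
      exact h2.comp_ofReal
    have h3 := (HasDerivAt.fun_sum fun i (_ : i ∈ Finset.range (G.natDegree + 1)) =>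
      (h1 i).const_mul (G.coeff i)).const_mul (-Complex.exp t)
    simp only [hF, hsum]
    refine h3.congr_deriv ?_
    have h4 : G.eval ((x : ℂ) + t) = Q.eval (x : ℂ) := by simp [hG]
    have h5 : Complex.exp (-((x : ℂ) + t)) = Complex.exp (-(x : ℂ)) * Complex.exp (-t) := by
      rw [← Complex.exp_add]; ring_nf
    have h6 : Complex.exp t * Complex.exp (-t) = 1 := by rw [← Complex.exp_add]; simp
    rw [← h4, eval_eq_sum_range, baseWeight, h5, Finset.mul_sum, Finset.mul_sum]
    refine Finset.sum_congr rfl fun i _ => ?_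
    linear_combination ((x : ℂ) + t) ^ a * Complex.exp (-(x : ℂ)) * (G.coeff i)
      * ((x : ℂ) + t) ^ i * h6
  have hlim : Tendsto F atTop (𝓝 0) := by
    have h1 : Tendsto F atTop (𝓝 (-Complex.exp t *
        ∑ i ∈ Finset.range (G.natDegree + 1), G.coeff i * 0)) := by
      simp only [hF, hsum]
      exact (tendsto_finsetSum _ fun i _ =>
        (tendsto_incGamma (re_add_one_add_pos ha i) t).const_mul (G.coeff i)).const_mul _
    simpa using h1
  rw [integral_Ioi_of_hasDerivAt_of_tendsto' hderiv (integrableOn_baseWeight_mul a ht Q) hlim]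
  simp [hF]

/-- The functional `P ↦ ∫ x (x + t) ^ a e ^ (-x) P`, for `t` in the slit plane. -/
def laguerreFunctional (a t : ℂ) : ℂ[X] →ₗ[ℂ] ℂ := translated (incGammaMoments a t) t

theorem laguerreFunctional_eq_integral (ha : -1 < a.re) (ht : t ∈ Complex.slitPlane) (Q : ℂ[X]) :
    laguerreFunctional a t Q =
      ∫ x in Set.Ioi (0 : ℝ), baseWeight a t x * (X * Q).eval (x : ℂ) := by
  rw [integral_baseWeight_mul ha ht, laguerreFunctional, translated_apply, mul_comp, X_comp]

theorem pairing_eq (ha : -1 < a.re) (ht : t ∈ Complex.slitPlane) (P : ℂ[X]) (m : ℕ) :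
    pairing a t P m = shiftFunctional (laguerreFunctional a t) (P * X ^ m) := by
  rw [shiftFunctional_apply, laguerreFunctional_eq_integral ha ht, pairing]
  refine setIntegral_congr_fun measurableSet_Ioi fun x _ => ?_
  simp only [weight, baseWeight, eval_mul, eval_X, eval_pow]
  ring

theorem isPearsonFamilyAt_laguerreFunctional (ha : -1 < a.re) (ht : t ∈ Complex.slitPlane) :
    IsPearsonFamilyAt a (laguerreFunctional a) t := by
  have hev := Complex.isOpen_slitPlane.mem_nhds ht
  refine isPearsonFamilyAt_translated (l := incGammaMoments a)
    (ρ := fun x => x ^ a * Complex.exp (-x)) ?_ ?_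
  · filter_upwards [hev] with x hx j
    exact incGammaMoments_succ ha (Complex.slitPlane_ne_zero hx) j
  · filter_upwards [hev] with x hx j
    exact hasDerivAt_incGammaMoments ha hx j

theorem isOrthonormalSystem_iff (ha : -1 < a.re) (ht : t ∈ Complex.slitPlane) (N : ℕ)
    (p : ℕ → ℂ[X]) : IsOrthonormalSystem a t N p ↔
      ∀ k ≤ N, (p k).natDegree = k ∧
        (∀ m < k, shiftFunctional (laguerreFunctional a t) (p k * X ^ m) = 0) ∧
        (p k).coeff k * shiftFunctional (laguerreFunctional a t) (p k * X ^ k) = 1 := by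
  simp only [IsOrthonormalSystem, pairing_eq ha ht]

/-- Existence of the polynomials becomes nonvanishing of analytic functions of t, which gives
openness. -/
theorem mem_opsDomain_iff (ha : -1 < a.re) (N : ℕ) : t ∈ opsDomain a N ↔
    t ∈ Complex.slitPlane ∧ ∀ j ≤ N, norm2 (laguerreFunctional a t) j ≠ 0 := by
  refine and_congr_right fun ht => ?_
  simp only [isOrthonormalSystem_iff ha ht]
  constructor
  · rintro ⟨p, hp⟩ j hj h0
    have := (orthonormal_eq hp j hj).2
    rw [show sqNorm (shiftFunctional (laguerreFunctional a t)) j = 0 from h0] at this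
    simp at this
  · exact exists_orthonormal

theorem isOpen_opsDomain (ha : -1 < a.re) (N : ℕ) : IsOpen (opsDomain a N) := by
  rw [isOpen_iff_mem_nhds]
  intro t ht
  obtain ⟨hs, hn⟩ := (mem_opsDomain_iff ha N).1 ht
  filter_upwards [Complex.isOpen_slitPlane.mem_nhds hs,
    (isPearsonFamilyAt_laguerreFunctional ha hs).eventually_norm2 (n := N + 1)
      fun j hj => hn j (by omega)] with x hx hxn
  exact (mem_opsDomain_iff ha N).2 ⟨hx, fun j hj => hxn j (by omega)⟩

section System

variable {N : ℕ} {p : ℕ → ℂ[X]} {n : ℕ}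

theorem subLead_div_lead (ha : -1 < a.re) (ht : t ∈ Complex.slitPlane)
    (hp : IsOrthonormalSystem a t N p) (hn : n ≤ N) :
    subLead p n / lead p n = subCoeff (laguerreFunctional a t) n := by
  rw [isOrthonormalSystem_iff ha ht] at hp
  rcases n with _ | n
  · simp [subLead, subCoeff]
  obtain ⟨h1, h2⟩ := orthonormal_eq hp (n + 1) hn
  have h0 : (p (n + 1)).coeff (n + 1) ≠ 0 := fun h0 => by rw [h0] at h2; simp at h2
  rw [subLead, lead, subCoeff, div_eq_iff h0]
  conv_lhs => rw [h1, coeff_C_mul]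
  rw [mul_comm]

theorem recA_sq (ha : -1 < a.re) (ht : t ∈ Complex.slitPlane)
    (hp : IsOrthonormalSystem a t N p) (hn : n ≤ N) :
    recA p n ^ 2 = normRatio (laguerreFunctional a t) n := by
  rw [isOrthonormalSystem_iff ha ht] at hp
  rcases n with _ | n
  · simp [recA, normRatio]
  obtain ⟨-, h2⟩ := orthonormal_eq hp (n + 1) hn
  obtain ⟨-, h3⟩ := orthonormal_eq hp n (by omega)
  have h0 : (p (n + 1)).coeff (n + 1) ≠ 0 := fun h0 => by rw [h0] at h2; simp at h2
  have h4 : norm2 (laguerreFunctional a t) n ≠ 0 := fun h0 => by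
    rw [show sqNorm (shiftFunctional (laguerreFunctional a t)) n = 0 from h0] at h3
    simp at h3
  rw [recA, lead, lead, normRatio, div_pow, div_eq_div_iff (pow_ne_zero 2 h0) h4]
  change (p n).coeff n ^ 2 * sqNorm _ n = sqNorm _ (n + 1) * _
  rw [h3, mul_comm, h2]

theorem theta_eq_thetaOf (ha : -1 < a.re) (ht : t ∈ Complex.slitPlane)
    (hp : IsOrthonormalSystem a t (n + 1) p) :
    theta a t p n = thetaOf a t (laguerreFunctional a t) n := by
  rw [theta, recB, thetaOf, subLead_div_lead ha ht hp (by omega),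
    subLead_div_lead ha ht hp le_rfl]

theorem kappa_eq_kappaOf (ha : -1 < a.re) (ht : t ∈ Complex.slitPlane)
    (hp : IsOrthonormalSystem a t (n + 1) p) :
    kappa t p n = kappaOf t (laguerreFunctional a t) n := by
  rw [kappa, kappaOf, subLead_div_lead ha ht hp (by omega), recA_sq ha ht hp (by omega)]

end System

end

/-! ### Positivity for real parameters. -/

noncomputable section

variable {a t : ℂ}

theorem hasDerivAt_baseWeight_mul (a : ℂ) (ht : t ∈ Complex.slitPlane) (P : ℂ[X]) {x : ℝ}
    (hx : 0 ≤ x) : HasDerivAt (fun x : ℝ => baseWeight a t x * P.eval (x : ℂ))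
      (a * (baseWeight (a - 1) t x * P.eval (x : ℂ)) +
        baseWeight a t x * (derivative P - P).eval (x : ℂ)) x := by
  have h1 := ((hasDerivAt_add_cpow a ht hx).mul (hasDerivAt_exp_neg_ofReal x)).mul
    (hasDerivAt_eval_ofReal P x)
  refine h1.congr_deriv ?_
  simp only [baseWeight, eval_sub, Pi.mul_apply]
  ring

/-- The zero of P at the origin removes the boundary term; decay removes the one at infinity. -/
theorem integral_baseWeight_by_parts (a : ℂ) (ht : t ∈ Complex.slitPlane) {P : ℂ[X]}
    (hP : P.eval 0 = 0) :
    a * ∫ x in Set.Ioi (0 : ℝ), baseWeight (a - 1) t x * P.eval (x : ℂ) =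
      ∫ x in Set.Ioi (0 : ℝ), baseWeight a t x * (P - derivative P).eval (x : ℂ) := by
  have i1 := (integrableOn_baseWeight_mul (a - 1) ht P).const_mul a
  have i2 := integrableOn_baseWeight_mul a ht (derivative P - P)
  have h := integral_Ioi_of_hasDerivAt_of_tendsto'
    (fun x hx => hasDerivAt_baseWeight_mul a ht P (x := x) hx)
    (i1.add i2) (tendsto_baseWeight_mul a t P)
  rw [integral_add i1 i2, integral_const_mul, Complex.ofReal_zero, hP, mul_zero, sub_zero] at h
  rw [eq_neg_of_add_eq_zero_left h, ← integral_neg]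
  refine setIntegral_congr_fun measurableSet_Ioi fun x _ => ?_
  simp only [eval_sub]
  ring

/-- The functional `rateFunctional` of the deformed Laguerre weight as an integral. -/
theorem rateFunctional_laguerreFunctional (ha : -1 < a.re) (ht : t ∈ Complex.slitPlane)
    (P : ℂ[X]) : rateFunctional (laguerreFunctional a t) P =
      a * ∫ x in Set.Ioi (0 : ℝ), baseWeight (a - 1) t x * (X ^ 2 * P).eval (x : ℂ) := by
  have h : X ^ 2 * P - derivative (X ^ 2 * P) =
      X * (X * P - X * derivative P - C 2 * P) := by
    rw [derivative_mul, derivative_X_pow]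
    simp
    ring
  rw [integral_baseWeight_by_parts a ht (by simp), h, ← laguerreFunctional_eq_integral ha ht,
    map_sub, map_sub, functional_C_mul, rateFunctional_apply]

theorem baseWeight_ofReal (α : ℝ) {t x : ℝ} (ht : 0 < t) (hx : 0 < x) :
    baseWeight α t x = ((x + t) ^ α * Real.exp (-x) : ℝ) := by
  rw [baseWeight, Complex.ofReal_mul, Complex.ofReal_cpow (by linarith)]
  push_cast
  rfl

theorem eval_map_ofReal (q : ℝ[X]) (x : ℝ) :
    (q.map Complex.ofRealHom).eval (x : ℂ) = (q.eval x : ℝ) := by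
  rw [eval_map]
  exact eval₂_at_apply Complex.ofRealHom x

theorem integral_baseWeight_real (α : ℝ) {t : ℝ} (ht : 0 < t) (q : ℝ[X]) :
    ∫ x in Set.Ioi (0 : ℝ), baseWeight α t x * (q.map Complex.ofRealHom).eval (x : ℂ) =
      ((∫ x in Set.Ioi (0 : ℝ), (x + t) ^ α * Real.exp (-x) * q.eval x : ℝ) : ℂ) := by
  rw [← integral_complex_ofReal]
  refine setIntegral_congr_fun measurableSet_Ioi fun x hx => ?_
  simp only [baseWeight_ofReal α ht hx, eval_map_ofReal]
  push_cast
  rfl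

theorem integral_baseWeight_sq_pos (α : ℝ) {t : ℝ} (ht : 0 < t) (k : ℕ) {q : ℝ[X]} (hq : q ≠ 0) :
    ∃ r : ℝ, 0 < r ∧ ∫ x in Set.Ioi (0 : ℝ),
      baseWeight α t x * (X ^ k * q.map Complex.ofRealHom ^ 2).eval (x : ℂ) = r := by
  have hts : (t : ℂ) ∈ Complex.slitPlane := Complex.ofReal_mem_slitPlane.2 ht
  have h1 := integral_baseWeight_real α ht (X ^ k * q ^ 2)
  have h2 := (integrableOn_baseWeight_mul α hts ((X ^ k * q ^ 2).map Complex.ofRealHom)).norm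
  simp only [Polynomial.map_mul, Polynomial.map_pow, map_X] at h1
  refine ⟨_, ?_, h1⟩
  have hnn : ∀ x ∈ Set.Ioi (0 : ℝ), 0 ≤ (x + t) ^ α * Real.exp (-x) * (X ^ k * q ^ 2).eval x := by
    intro x hx
    have hx : 0 < x := hx
    simp only [eval_mul, eval_pow, eval_X]
    have : 0 ≤ q.eval x ^ 2 := sq_nonneg _
    positivity
  have hint : IntegrableOn (fun x : ℝ => (x + t) ^ α * Real.exp (-x) * (X ^ k * q ^ 2).eval x)
      (Set.Ioi 0) := by
    refine IntegrableOn.congr_fun h2 (fun x hx => ?_) measurableSet_Ioi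
    simp only [baseWeight_ofReal α ht hx, eval_map_ofReal]
    rw [← Complex.ofReal_mul, Complex.norm_real, Real.norm_of_nonneg (hnn x hx)]
  rw [setIntegral_pos_iff_support_of_nonneg_ae
    ((ae_restrict_mem measurableSet_Ioi).mono hnn) hint]
  -- The nonnegative integrand can vanish only at the finitely many roots of q, so its support has
  -- positive measure.
  have hsub : Set.Ioi (0 : ℝ) \ q.rootSet ℝ ⊆ Function.support
      (fun x : ℝ => (x + t) ^ α * Real.exp (-x) * (X ^ k * q ^ 2).eval x) ∩ Set.Ioi 0 := by
    rintro x ⟨hx, hxq⟩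
    have hx0 : 0 < x := hx
    refine ⟨?_, hx⟩
    have hqx : q.eval x ≠ 0 := fun h0 => hxq ((mem_rootSet_of_ne hq).2 (by simpa using h0))
    rw [Function.mem_support]
    simp only [eval_mul, eval_pow, eval_X]
    positivity
  refine lt_of_lt_of_le ?_ (measure_mono hsub)
  rw [measure_sdiff_null ((q.rootSet_finite ℝ).measure_zero _)]
  simp

theorem functional_map_mem_real {W : ℂ[X] →ₗ[ℂ] ℂ}
    (hW : ∀ k, W (X ^ k) ∈ Complex.ofRealHom.fieldRange) (q : ℝ[X]) :
    W (q.map Complex.ofRealHom) ∈ Complex.ofRealHom.fieldRange := by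
  rw [functional_eq_sum W (Nat.lt_succ_self _)]
  refine sum_mem fun i _ => mul_mem ?_ (hW i)
  rw [coeff_map]
  exact ⟨_, rfl⟩

/-- Gram-Schmidt uses only field operations on the moments, so it stays in the subfield of reals. -/
theorem monicOrtho_mem_real {W : ℂ[X] →ₗ[ℂ] ℂ}
    (hW : ∀ k, W (X ^ k) ∈ Complex.ofRealHom.fieldRange) (n : ℕ) :
    monicOrtho W n ∈ (mapRingHom Complex.ofRealHom).range := by
  have hW' : ∀ P ∈ (mapRingHom Complex.ofRealHom).range,
      W P ∈ Complex.ofRealHom.fieldRange := by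
    rintro _ ⟨q, rfl⟩
    exact functional_map_mem_real hW q
  have hX : ∀ n : ℕ, (X : ℂ[X]) ^ n ∈ (mapRingHom Complex.ofRealHom).range := fun n =>
    ⟨X ^ n, by simp⟩
  induction n using Nat.strong_induction_on with
  | _ n ih =>
    rw [monicOrtho_eq]
    refine sub_mem (hX n) (sum_mem fun j hj => mul_mem ?_ (ih j (Finset.mem_range.1 hj)))
    have hj := ih j (Finset.mem_range.1 hj)
    obtain ⟨r, hr⟩ := div_mem (hW' _ (mul_mem (hX n) hj)) (hW' _ (pow_mem hj 2))
    refine ⟨C r, ?_⟩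
    simp only [coe_mapRingHom, map_C, hr]
    rfl

/-- For real parameters the polynomials are real, and the integrals of their squares positive. -/
theorem positivity_laguerreFunctional {α : ℝ} (hα : -1 < α) {t : ℝ} (ht : 0 < t) (n : ℕ) :
    norm2 (laguerreFunctional α t) n ≠ 0 ∧
      laguerreFunctional α t (ortho (laguerreFunctional α t) n ^ 2) ≠ 0 ∧
      (α ≠ 0 → rateFunctional (laguerreFunctional α t)
        (ortho (laguerreFunctional α t) n ^ 2) ≠ 0) := by
  have hts : (t : ℂ) ∈ Complex.slitPlane := Complex.ofReal_mem_slitPlane.2 ht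
  have hα' : -1 < (α : ℂ).re := by simpa using hα
  obtain ⟨q, hq⟩ := monicOrtho_mem_real (W := shiftFunctional (laguerreFunctional α t))
    (fun k => by
      rw [shiftFunctional_apply, laguerreFunctional_eq_integral hα' hts]
      have h := integral_baseWeight_real α ht (X * (X * X ^ k))
      simp only [Polynomial.map_mul, Polynomial.map_pow, map_X] at h
      exact ⟨_, h.symm⟩) n
  rw [coe_mapRingHom] at hq
  have hq0 : q ≠ 0 := by
    rintro rfl
    exact (monicOrtho_monic (shiftFunctional (laguerreFunctional α t)) n).ne_zero (by simp [← hq])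
  -- The three claims use (β, k) = (α, 2) for the norm, (α, 1) for the pole at 0 and (α - 1, 2) for
  -- the pole at -t.
  have key : ∀ (β : ℝ) (k : ℕ), ∫ x in Set.Ioi (0 : ℝ), baseWeight β t x *
      (X ^ k * ortho (laguerreFunctional α t) n ^ 2).eval (x : ℂ) ≠ 0 := by
    intro β k
    obtain ⟨r, hr, h⟩ := integral_baseWeight_sq_pos β ht k hq0
    rw [hq] at h
    rw [ortho, h]
    exact_mod_cast hr.ne'
  refine ⟨?_, ?_, fun hα0 => ?_⟩
  · rw [norm2, sqNorm, shiftFunctional_apply, laguerreFunctional_eq_integral hα' hts,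
      ← mul_assoc, ← pow_two]
    exact key α 2
  · rw [laguerreFunctional_eq_integral hα' hts]
    simpa using key α 1
  · rw [rateFunctional_laguerreFunctional hα' hts]
    have h := key (α - 1) 2
    push_cast at h
    exact mul_ne_zero (by exact_mod_cast hα0) h

theorem real_parameters {a : ℂ} (ha : -1 < a.re) (him : a.im = 0) {t : ℝ} (ht : 0 < t) (n : ℕ) :
    (t : ℂ) ∈ opsDomain a (n + 1) ∧ thetaOf a t (laguerreFunctional a t) n ≠ 0 ∧
      (a ≠ 0 → thetaOf a t (laguerreFunctional a t) n + t ≠ 0) := by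
  have hts : (t : ℂ) ∈ Complex.slitPlane := Complex.ofReal_mem_slitPlane.2 ht
  have ht0 : (t : ℂ) ≠ 0 := by exact_mod_cast ht.ne'
  obtain ⟨α, rfl⟩ : ∃ α : ℝ, (α : ℂ) = a := ⟨a.re, Complex.ext rfl (by simp [him])⟩
  have hpos := positivity_laguerreFunctional (α := α) (by simpa using ha) ht
  have hn : ∀ j ≤ n, norm2 (laguerreFunctional α t) j ≠ 0 := fun j _ => (hpos j).1
  have hθ := thetaOf_eq (isPearsonFamilyAt_laguerreFunctional ha hts).pearson.self_of_nhds hn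
  refine ⟨(mem_opsDomain_iff ha _).2 ⟨hts, fun j _ => (hpos j).1⟩, ?_, fun hα => ?_⟩
  · rw [hθ, poleDiag]
    exact mul_ne_zero (by simpa using ht0) (div_ne_zero (hpos n).2.1 (hn n le_rfl))
  · have h1 := (hpos n).2.2 (by exact_mod_cast hα)
    -- θ + t = t(1 - 2R_n), and (1 - 2R_n) h_n is the integral with pole at -t.
    rw [rate_sq hn] at h1
    rw [hθ]
    intro h0
    refine h1 (mul_eq_zero_of_left (mul_left_cancel₀ ht0 ?_) _)
    linear_combination h0

end

/-! ### The classical Laguerre weight at t = 0 and the Taylor coefficients. -/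

noncomputable section

variable {a : ℂ}

/-- The part of `laguerreFunctional` whose moments are entire in `t`. -/
def regularFunctional (a t : ℂ) : ℂ[X] →ₗ[ℂ] ℂ :=
  translated (fun j => Complex.Gamma (a + 1 + j)) t

theorem re_pos_ne_zero {z : ℂ} (hz : 0 < z.re) : z ≠ 0 := by
  rintro rfl
  simp at hz

theorem isPearsonFamilyAt_regularFunctional (ha : -1 < a.re) (t : ℂ) :
    IsPearsonFamilyAt a (regularFunctional a) t := by
  refine isPearsonFamilyAt_translated (l := fun _ j => Complex.Gamma (a + 1 + j)) (ρ := fun _ => 0)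
    (Eventually.of_forall fun x j => ?_) (Eventually.of_forall fun x j => ?_)
  · rw [← Complex.Gamma_add_one _ (re_pos_ne_zero (re_add_one_add_pos ha j))]
    push_cast
    rw [← add_assoc]
    ring
  · simpa using hasDerivAt_const x (Complex.Gamma (a + 1 + j))

/-- The functional with moments `Γ(a + 2 + k)`. -/
def classicalFunctional (a : ℂ) : ℂ[X] →ₗ[ℂ] ℂ := regularFunctional a 0

theorem classicalFunctional_X_pow (a : ℂ) (k : ℕ) :
    classicalFunctional a (X ^ k) = Complex.Gamma (a + 2 + k) := by
  rw [classicalFunctional, regularFunctional, translated_X_pow, C_0, sub_zero,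
    momentFunctional_X_pow, Complex.exp_zero, one_mul]
  congr 1
  push_cast
  ring

theorem isPearson_classicalFunctional (ha : -1 < a.re) : IsPearson a 0 (classicalFunctional a) :=
  (isPearsonFamilyAt_regularFunctional ha 0).pearson.self_of_nhds

/-- At t = 0 the two singular points merge: w/(x+t) and w/x coincide. Comparison with `rate_sq` and
`rate_mul_prev` then determines R_n and r_n. -/
theorem rate_classicalFunctional (ha : -1 < a.re) (P : ℂ[X]) :
    rateFunctional (classicalFunctional a) P = a * classicalFunctional a P := by
  have h2 : a + 2 ≠ 0 := re_pos_ne_zero (by simp; linarith)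
  have h1 : rateFunctional (classicalFunctional a) 1 = a * classicalFunctional a 1 := by
    have e0 := classicalFunctional_X_pow a 0
    have e1 := classicalFunctional_X_pow a 1
    rw [pow_zero] at e0
    rw [pow_one] at e1
    rw [rateFunctional_apply, derivative_one, mul_zero, mul_one, map_zero, e0, e1]
    push_cast
    rw [add_zero, Complex.Gamma_add_one _ h2]
    ring
  -- The Pearson equation at t = 0 covers multiples of x; the constant term is the recurrence of the
  -- gamma function.
  have hX := isPearson_classicalFunctional ha (divX P)
  rw [C_0, add_zero, shiftFunctional_apply] at hX
  rw [← divX_mul_X_add P, map_add, map_add, mul_comm, hX,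
    ← mul_one (C _), functional_C_mul, functional_C_mul, h1]
  ring

/-- At t = 0 the Pearson identities are closed recursions: b_n = 2n + a + 3 and ρ_n = -`subCoeff`.
The latter is nonzero, so nonvanishing of the norms propagates along the induction. -/
theorem classical_subCoeff_norm2 (ha : -1 < a.re) (n : ℕ) :
    (∀ j ≤ n, norm2 (classicalFunctional a) j ≠ 0) ∧
      subCoeff (classicalFunctional a) n = -(n * (n + a + 2)) := by
  induction n with
  | zero =>
    refine ⟨fun j hj => ?_, by simp [subCoeff]⟩
    obtain rfl : j = 0 := by omega
    have e1 := classicalFunctional_X_pow a 1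
    rw [pow_one] at e1
    rw [norm2, sqNorm, monicOrtho_zero, one_pow, shiftFunctional_apply, mul_one, e1]
    refine Complex.Gamma_ne_zero_of_re_pos ?_
    simp
    linarith
  | succ n ih =>
    obtain ⟨h, hs⟩ := ih
    have hp := isPearson_classicalFunctional ha
    have h1 := subCoeff_sub_succ hp h
    have h2 := normRatio_eq hp (n := n + 1) fun j hj => h j (by omega)
    have hs' : subCoeff (classicalFunctional a) (n + 1) = -((n + 1) * (n + 1 + a + 2)) := by
      rw [hs] at h1
      linear_combination -h1
    refine ⟨fun j hj => ?_, by push_cast; exact hs'⟩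
    rcases hj.eq_or_lt with rfl | hj
    · intro h0
      rw [normRatio, h0, zero_div, hs'] at h2
      have h3 : ((n : ℂ) + 1) * (n + 1 + a + 2) = 0 := by linear_combination -h2
      have h4 : (n : ℂ) + 1 ≠ 0 := by exact_mod_cast Nat.succ_ne_zero n
      refine (mul_ne_zero h4 (re_pos_ne_zero ?_)) h3
      have : (0 : ℝ) ≤ n := Nat.cast_nonneg n
      simp
      linarith
    · exact h j (by omega)

theorem classical_norm2_ne_zero (ha : -1 < a.re) (n : ℕ) : norm2 (classicalFunctional a) n ≠ 0 :=
  (classical_subCoeff_norm2 ha n).1 n le_rfl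

theorem classical_normRatio (ha : -1 < a.re) (n : ℕ) :
    normRatio (classicalFunctional a) n = n * (n + a + 2) := by
  have h := normRatio_eq (isPearson_classicalFunctional ha) (n := n)
    fun j _ => classical_norm2_ne_zero ha j
  rw [h, (classical_subCoeff_norm2 ha n).2]
  ring

theorem classical_poleDiag (ha : -1 < a.re) (n : ℕ) :
    poleDiag (classicalFunctional a) n = 1 / (a + 2) := by
  have h2 : a + 2 ≠ 0 := re_pos_ne_zero (by simp; linarith)
  have hn := classical_norm2_ne_zero ha n
  have h := rate_sq (L := classicalFunctional a) (n := n) fun j _ => classical_norm2_ne_zero ha j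
  rw [rate_classicalFunctional ha] at h
  have h3 : classicalFunctional a (ortho (classicalFunctional a) n ^ 2) =
      poleDiag (classicalFunctional a) n * norm2 (classicalFunctional a) n := by
    rw [poleDiag, div_mul_cancel₀ _ hn]
  rw [h3, ← mul_assoc] at h
  rw [eq_div_iff h2]
  linear_combination mul_right_cancel₀ hn h

theorem classical_poleOff (ha : -1 < a.re) (n : ℕ) :
    poleOff (classicalFunctional a) n = -n / (a + 2) := by
  rcases n with _ | n
  · simp [poleOff]
  have h2 : a + 2 ≠ 0 := re_pos_ne_zero (by simp; linarith)
  have hn := classical_norm2_ne_zero ha n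
  have h := rate_mul_prev (L := classicalFunctional a) (n := n)
    fun j _ => classical_norm2_ne_zero ha j
  rw [rate_classicalFunctional ha] at h
  have h3 : classicalFunctional a (ortho (classicalFunctional a) (n + 1) *
      ortho (classicalFunctional a) n) =
      poleOff (classicalFunctional a) (n + 1) * norm2 (classicalFunctional a) n := by
    rw [poleOff, div_mul_cancel₀ _ hn]
  rw [h3, ← mul_assoc] at h
  rw [eq_div_iff h2]
  push_cast
  linear_combination mul_right_cancel₀ hn h

/-- L(π_{n+1}²) and L(π_{n+1} π_n) are π_{n+1}(0) and π_n(0) times the same number L(π_{n+1}), and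
both are already known. -/
theorem classical_eval_zero_succ (ha : -1 < a.re) (n : ℕ) :
    (ortho (classicalFunctional a) (n + 1)).eval 0 =
      -(n + a + 3) * (ortho (classicalFunctional a) n).eval 0 := by
  set L := classicalFunctional a with hL
  have h2 : a + 2 ≠ 0 := re_pos_ne_zero (by simp; linarith)
  have hn : ∀ j, norm2 L j ≠ 0 := classical_norm2_ne_zero ha
  have e1 := L_mul_prev (L := L) (n := n) fun j _ => hn j
  have e2 := L_sq (L := L) (n := n + 1) fun j _ => hn j
  have e3 : L (ortho L (n + 1) * ortho L n) = -(n + 1) / (a + 2) * norm2 L n := by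
    have h := classical_poleOff ha (n + 1)
    rw [poleOff, div_eq_iff (hn n)] at h
    push_cast at h
    exact h
  have e4 : L (ortho L (n + 1) ^ 2) = 1 / (a + 2) * norm2 L (n + 1) := by
    have h := classical_poleDiag ha (n + 1)
    rwa [poleDiag, div_eq_iff (hn _)] at h
  have e5 : norm2 L (n + 1) = (n + 1) * (n + 1 + a + 2) * norm2 L n := by
    have h := classical_normRatio ha (n + 1)
    rw [normRatio, div_eq_iff (hn n)] at h
    push_cast at h
    exact h
  have h4 : (n : ℂ) + 1 ≠ 0 := by exact_mod_cast Nat.succ_ne_zero n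
  have hne : L (ortho L (n + 1)) ≠ 0 := by
    intro h0
    rw [h0, mul_zero, e4] at e2
    exact mul_ne_zero (one_div_ne_zero h2) (hn _) e2
  refine mul_left_cancel₀ (mul_ne_zero hne (mul_ne_zero h4 (hn n))) ?_
  have e6 : L (ortho L (n + 1)) * (ortho L (n + 1)).eval 0 =
      1 / (a + 2) * ((n + 1) * (n + 1 + a + 2) * norm2 L n) := by rw [← e5, ← e4, e2]; ring
  have e7 : L (ortho L (n + 1)) * (ortho L n).eval 0 = -(n + 1) / (a + 2) * norm2 L n := by
    rw [← e3, e1]; ring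
  linear_combination (n + 1) * norm2 L n * e6
    + (n + 1) * norm2 L n * (n + a + 3) * e7

theorem classical_eval_zero (ha : -1 < a.re) (n : ℕ) :
    (ortho (classicalFunctional a) n).eval 0 * Complex.Gamma (a + 3) =
      (-1) ^ n * Complex.Gamma (a + n + 3) := by
  induction n with
  | zero => simp [ortho, monicOrtho_zero]
  | succ n ih =>
    have h : (a + n + 3 : ℂ) ≠ 0 := re_pos_ne_zero (by
      have : (0 : ℝ) ≤ n := Nat.cast_nonneg n
      simp
      linarith)
    have e : (a + ((n + 1 : ℕ) : ℂ) + 3) = a + n + 3 + 1 := by push_cast; ring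
    rw [classical_eval_zero_succ ha, e, Complex.Gamma_add_one _ h, pow_succ]
    linear_combination (-(n + a + 3)) * ih

theorem classical_norm2 (ha : -1 < a.re) (n : ℕ) :
    norm2 (classicalFunctional a) n = Complex.Gamma (n + 1) * Complex.Gamma (a + n + 3) := by
  induction n with
  | zero =>
    have e1 := classicalFunctional_X_pow a 1
    rw [pow_one] at e1
    rw [norm2, sqNorm, monicOrtho_zero, one_pow, shiftFunctional_apply, mul_one, e1]
    have : a + 2 + ((1 : ℕ) : ℂ) = a + ((0 : ℕ) : ℂ) + 3 := by push_cast; ring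
    rw [this]
    simp
  | succ n ih =>
    have h : (a + n + 3 : ℂ) ≠ 0 := re_pos_ne_zero (by
      have : (0 : ℝ) ≤ n := Nat.cast_nonneg n
      simp
      linarith)
    have h4 : (n : ℂ) + 1 ≠ 0 := by exact_mod_cast Nat.succ_ne_zero n
    have e : (a + ((n + 1 : ℕ) : ℂ) + 3) = a + n + 3 + 1 := by push_cast; ring
    have h5 := classical_normRatio ha (n + 1)
    rw [normRatio, div_eq_iff (classical_norm2_ne_zero ha n), ih] at h5
    rw [h5, e, Complex.Gamma_add_one _ h]
    push_cast
    rw [Complex.Gamma_add_one _ h4]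
    ring

section Expansion

variable {n : ℕ}

theorem hasDerivAt_id_mul {g : ℂ → ℂ} (hg : AnalyticAt ℂ g 0) :
    HasDerivAt (fun x => x * g x) (g 0) 0 := by
  refine ((hasDerivAt_id (0 : ℂ)).mul hg.differentiableAt.hasDerivAt).congr_deriv ?_
  simp

/-- The second Taylor coefficients forced by the differential equations. -/
theorem deriv_zero_of_system {R r : ℂ → ℂ} (hR : AnalyticAt ℂ R 0) (hr : AnalyticAt ℂ r 0)
    (h1 : ∀ᶠ x in 𝓝 0, x * deriv R x =
      -R x - 1 + (2 * n + 3 + a - x * (1 - 2 * R x)) * R x + 2 * r x)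
    (h2 : ∀ᶠ x in 𝓝 0, x * (deriv r x * (R x * (1 - 2 * R x))) =
      (r x ^ 2 - r x) * (1 - 2 * R x) ^ 2 - R x ^ 2 * ((n + 2 * r x) * (n + 2 * r x + a)))
    (R0 : R 0 = 1 / (a + 2)) (r0 : r 0 = -n / (a + 2)) (ha : -1 < a.re) (ha0 : a ≠ 0) :
    deriv R 0 = a * (2 * n + a + 3) / ((a + 3) * (a + 2) ^ 2 * (a + 1)) ∧
      deriv r 0 = -(2 * n * (n + a + 2) * a / ((a + 3) * (a + 2) ^ 2 * (a + 1))) := by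
  have ne1 : a + 1 ≠ 0 := re_pos_ne_zero (by simp; linarith)
  have ne2 : a + 2 ≠ 0 := re_pos_ne_zero (by simp; linarith)
  have ne3 : a + 3 ≠ 0 := re_pos_ne_zero (by simp; linarith)
  have ne4 : 2 * n + a + 3 ≠ 0 := re_pos_ne_zero (by
    have : (0 : ℝ) ≤ n := Nat.cast_nonneg n
    simp
    linarith)
  have dR := hR.differentiableAt.hasDerivAt
  have dr := hr.differentiableAt.hasDerivAt
  have d12 := (dR.const_mul 2).const_sub 1
  have dn := (dr.const_mul 2).const_add (n : ℂ)
  -- Both equations are differentiated once at 0; the factor x on the left leaves only the value of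
  -- the other factor there.
  have e1 := (hasDerivAt_id_mul hR.deriv).unique
    (((((dR.neg.sub_const 1).add ((((hasDerivAt_id (0 : ℂ)).mul d12).const_sub
      (2 * (n : ℂ) + 3 + a)).mul dR)).add (dr.const_mul 2)).congr_of_eventuallyEq h1))
  have e2 := (hasDerivAt_id_mul (hr.deriv.mul (hR.mul
    (analyticAt_const.sub (analyticAt_const.mul hR))))).unique
    ((((((dr.pow 2).sub dr).mul (d12.pow 2)).sub
      ((dR.pow 2).mul (dn.mul (dn.add_const a))))).congr_of_eventuallyEq h2)
  simp only [Pi.sub_apply, Pi.mul_apply, Pi.pow_apply, id, R0, r0] at e1 e2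
  push_cast at e1 e2
  generalize deriv R 0 = R1 at *
  generalize deriv r 0 = r1 at *
  have f1 : (2 * n + a + 1) * R1 + 2 * r1 = a / (a + 2) ^ 2 := by
    field_simp at e1 ⊢
    linear_combination -e1
  -- Here a ≠ 0 is needed: R(0) = 1/(a+2) gives 1 - 2R(0) = a/(a+2), and a common factor a is
  -- cancelled.
  have f2 : r1 * (2 * n + a + 3) = -(2 * n * (n + a + 2)) * R1 := by
    field_simp at e2
    refine mul_left_cancel₀ (mul_ne_zero ha0 ne2) ?_
    linear_combination e2
  -- The determinant (2n+a+1)(2n+a+3) - 4n(n+a+2) equals (a+1)(a+3).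
  have f3 : R1 = a * (2 * n + a + 3) / ((a + 3) * (a + 2) ^ 2 * (a + 1)) := by
    field_simp at f1 ⊢
    linear_combination (2 * n + a + 3) * f1 - 2 * (a + 2) ^ 2 * f2
  refine ⟨f3, mul_right_cancel₀ ne4 ?_⟩
  rw [f2, f3]
  field_simp

end Expansion

end

/-! ### Separating the power t^{a+3} as an independent variable. -/

noncomputable section

variable {a : ℂ} {n : ℕ}

/-- The coefficient of `-e ^ t t ^ (a + 3 + k)` in the moments of the weight. -/
def singularMoment (a : ℂ) (k : ℕ) (t : ℂ) : ℂ :=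
  ∑ j ∈ Finset.range (k + 3),
    (-1) ^ (k + 2 - j) * ((k + 2).choose j : ℂ) * lowerGammaSeries (a + 1 + j) t

/-- The functional with the power `t ^ (a + 3)` replaced by an independent variable `x.2`, for
`t = x.1`. -/
def splitFunctional (a : ℂ) (x : ℂ × ℂ) : ℂ[X] →ₗ[ℂ] ℂ :=
  momentFunctional fun m => regularFunctional a x.1 (X ^ m) -
    x.2 * (if m = 0 then 0 else Complex.exp x.1 * x.1 ^ (m - 1) * singularMoment a (m - 1) x.1)

theorem splitFunctional_X_pow (a : ℂ) (x : ℂ × ℂ) (m : ℕ) : splitFunctional a x (X ^ m) =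
    regularFunctional a x.1 (X ^ m) -
      x.2 * (if m = 0 then 0 else Complex.exp x.1 * x.1 ^ (m - 1) * singularMoment a (m - 1) x.1) :=
  momentFunctional_X_pow _ _

theorem splitFunctional_zero_right (a t : ℂ) : splitFunctional a (t, 0) = regularFunctional a t :=
  functional_ext fun k => by simp [splitFunctional_X_pow]

/-- Expanding (y - t)^{k+2} against t^{a+1+j} always gives total power t^{a+3+k}. The shift is
essential: the zeroth moment of L carries only t^{a+2}, and its singular part is simply dropped in
`splitFunctional`. -/
theorem shift_splitFunctional (t : ℂ) (ht : t ≠ 0) :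
    shiftFunctional (splitFunctional a (t, t ^ (a + 3))) =
      shiftFunctional (laguerreFunctional a t) := by
  refine functional_ext fun k => ?_
  rw [shiftFunctional_apply, shiftFunctional_apply, ← pow_succ', splitFunctional_X_pow,
    if_neg (Nat.succ_ne_zero k), Nat.add_sub_cancel, regularFunctional, laguerreFunctional,
    translated_X_pow, translated_X_pow]
  have hsum : ∀ m : ℕ → ℂ, momentFunctional m ((X - C t) ^ (k + 1 + 1)) =
      ∑ j ∈ Finset.range (k + 3), (-t) ^ (k + 2 - j) * ((k + 2).choose j : ℂ) * m j := fun m => by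
    rw [functional_eq_sum _ (N := k + 3) (by rw [natDegree_pow, natDegree_X_sub_C]; omega)]
    simp only [momentFunctional_X_pow, sub_eq_add_neg, ← C_neg, coeff_X_add_C_pow]
  rw [hsum, hsum, singularMoment]
  simp only [incGammaMoments, incGamma, mul_sub, Finset.sum_sub_distrib]
  congr 1
  rw [Finset.mul_sum, Finset.mul_sum, Finset.mul_sum]
  refine Finset.sum_congr rfl fun j hj => ?_
  have hj := Finset.mem_range.1 hj
  have e1 : t ^ (a + 1 + j) * t ^ (k + 2 - j) = t ^ (a + 3) * t ^ k := by
    rw [← Complex.cpow_natCast, ← Complex.cpow_natCast, ← Complex.cpow_add _ _ ht,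
      ← Complex.cpow_add _ _ ht, Nat.cast_sub (by omega)]
    congr 1
    push_cast
    ring
  rw [neg_pow t]
  linear_combination (-Complex.exp t * (-1) ^ (k + 2 - j) * ((k + 2).choose j : ℂ) *
    lowerGammaSeries (a + 1 + j) t) * e1

theorem analyticAt_regularFunctional (a t : ℂ) (k : ℕ) :
    AnalyticAt ℂ (fun x => regularFunctional a x (X ^ k)) t :=
  analyticAt_translated (l := fun _ j => Complex.Gamma (a + 1 + j)) (fun _ => analyticAt_const) k

theorem analyticAt_splitFunctional (ha : -1 < a.re) (x : ℂ × ℂ) (m : ℕ) :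
    AnalyticAt ℂ (fun x => splitFunctional a x (X ^ m)) x := by
  simp only [splitFunctional_X_pow]
  have h1 : AnalyticAt ℂ (fun x : ℂ × ℂ => regularFunctional a x.1 (X ^ m)) x :=
    (analyticAt_regularFunctional a x.1 m).comp_of_eq analyticAt_fst rfl
  refine h1.sub (analyticAt_snd.mul ?_)
  split_ifs
  · exact analyticAt_const
  · refine ((analyticAt_fst.cexp).mul (analyticAt_fst.pow _)).mul ?_
    simp only [singularMoment]
    refine Finset.analyticAt_fun_sum _ fun j _ => analyticAt_const.mul ?_
    exact AnalyticAt.comp_of_eq (g := lowerGammaSeries (a + 1 + j))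
      ((differentiable_lowerGammaSeries (re_add_one_add_pos ha j)).analyticAt x.1)
      analyticAt_fst rfl

/-- The value is the beta integral B(3, a+1), the alternating sum of the 1/(a+1+j). -/
theorem singularMoment_zero (ha : -1 < a.re) :
    singularMoment a 0 0 = 2 / ((a + 1) * (a + 2) * (a + 3)) := by
  have ne1 : a + 1 ≠ 0 := re_pos_ne_zero (by simp; linarith)
  have ne2 : a + 2 ≠ 0 := re_pos_ne_zero (by simp; linarith)
  have ne3 : a + 3 ≠ 0 := re_pos_ne_zero (by simp; linarith)
  have h : ∀ s : ℂ, lowerGammaSeries s 0 = 1 / s := fun s => by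
    rw [lowerGammaSeries, tsum_eq_single 0]
    · simp
    · intro i hi
      simp [hi]
  have e2 : a + 1 + 1 = a + 2 := by ring
  have e3 : a + 1 + 2 = a + 3 := by ring
  simp only [singularMoment, h, Finset.sum_range_succ, Finset.sum_range_zero]
  norm_num [Nat.choose]
  rw [e2, e3]
  field_simp
  ring

/-- At t = 0 the singular parts of the higher moments carry a factor t^k, so only the mass of a
point at 0 remains. -/
theorem splitFunctional_zero_left (a ε : ℂ) (k : ℕ) :
    shiftFunctional (splitFunctional a (0, ε)) (X ^ k) =
      shiftFunctional (classicalFunctional a) (X ^ k) + ε * (-singularMoment a 0 0 * 0 ^ k) := by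
  rw [shiftFunctional_apply, shiftFunctional_apply, ← pow_succ', splitFunctional_X_pow,
    if_neg (Nat.succ_ne_zero k), Nat.add_sub_cancel, Complex.exp_zero, classicalFunctional]
  rcases k with _ | k
  · simp; ring
  · simp

/-- Addition of a point mass at `0` to the classical weight. -/
theorem hasDerivAt_splitFunctional (a : ℂ) (k : ℕ) :
    HasDerivAt (fun ε => shiftFunctional (splitFunctional a (0, ε)) (X ^ k))
      (momentFunctional (fun j => -singularMoment a 0 0 * 0 ^ j) (X ^ k)) 0 := by
  simp only [splitFunctional_zero_left, momentFunctional_X_pow]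
  simpa using ((hasDerivAt_id (0 : ℂ)).mul_const (-singularMoment a 0 0 * 0 ^ k)).const_add
    (shiftFunctional (classicalFunctional a) (X ^ k))

section Analytic

variable {E : Type*} [NormedAddCommGroup E] [NormedSpace ℂ E] {L : E → ℂ[X] →ₗ[ℂ] ℂ} {x₀ : E}

theorem analyticAt_shift (hL : ∀ k, AnalyticAt ℂ (fun x => L x (X ^ k)) x₀) (k : ℕ) :
    AnalyticAt ℂ (fun x => shiftFunctional (L x) (X ^ k)) x₀ := by
  simp only [shiftFunctional_apply, ← pow_succ']
  exact hL (k + 1)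

theorem polyAnalyticAt_ortho (hL : ∀ k, AnalyticAt ℂ (fun x => L x (X ^ k)) x₀)
    (hn : ∀ j, norm2 (L x₀) j ≠ 0) (n : ℕ) : PolyAnalyticAt (fun x => ortho (L x) n) x₀ :=
  polyAnalyticAt_monicOrtho (W := fun x => shiftFunctional (L x)) (analyticAt_shift hL)
    fun j _ => hn j

theorem analyticAt_norm2 (hL : ∀ k, AnalyticAt ℂ (fun x => L x (X ^ k)) x₀)
    (hn : ∀ j, norm2 (L x₀) j ≠ 0) (n : ℕ) : AnalyticAt ℂ (fun x => norm2 (L x) n) x₀ :=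
  analyticAt_sqNorm (W := fun x => shiftFunctional (L x)) (analyticAt_shift hL) fun j _ => hn j

theorem analyticAt_subCoeff (hL : ∀ k, AnalyticAt ℂ (fun x => L x (X ^ k)) x₀)
    (hn : ∀ j, norm2 (L x₀) j ≠ 0) (n : ℕ) : AnalyticAt ℂ (fun x => subCoeff (L x) n) x₀ := by
  rcases n with _ | n
  · exact analyticAt_const
  · exact (polyAnalyticAt_ortho hL hn (n + 1)).2 n

theorem analyticAt_normRatio (hL : ∀ k, AnalyticAt ℂ (fun x => L x (X ^ k)) x₀)
    (hn : ∀ j, norm2 (L x₀) j ≠ 0) (n : ℕ) : AnalyticAt ℂ (fun x => normRatio (L x) n) x₀ := by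
  rcases n with _ | n
  · exact analyticAt_const
  · exact (analyticAt_norm2 hL hn (n + 1)).div (analyticAt_norm2 hL hn n) (hn n)

theorem analyticAt_poleDiag (hL : ∀ k, AnalyticAt ℂ (fun x => L x (X ^ k)) x₀)
    (hn : ∀ j, norm2 (L x₀) j ≠ 0) (n : ℕ) : AnalyticAt ℂ (fun x => poleDiag (L x) n) x₀ :=
  (((polyAnalyticAt_ortho hL hn n).pow 2).functional hL).div (analyticAt_norm2 hL hn n) (hn n)

theorem analyticAt_poleOff (hL : ∀ k, AnalyticAt ℂ (fun x => L x (X ^ k)) x₀)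
    (hn : ∀ j, norm2 (L x₀) j ≠ 0) (n : ℕ) : AnalyticAt ℂ (fun x => poleOff (L x) n) x₀ := by
  rcases n with _ | n
  · exact analyticAt_const
  · exact (((polyAnalyticAt_ortho hL hn (n + 1)).mul (polyAnalyticAt_ortho hL hn n)).functional
      hL).div (analyticAt_norm2 hL hn n) (hn n)

end Analytic

/-- θ and κ see L only through the shifted functional, so the altered zeroth moment of
`splitFunctional` is harmless. -/
theorem subCoeff_congr {L L' : ℂ[X] →ₗ[ℂ] ℂ} (h : shiftFunctional L = shiftFunctional L') (n : ℕ) :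
    subCoeff L n = subCoeff L' n := by
  rcases n with _ | n
  · rfl
  · rw [subCoeff, subCoeff, ortho, ortho, h]

theorem normRatio_congr {L L' : ℂ[X] →ₗ[ℂ] ℂ} (h : shiftFunctional L = shiftFunctional L')
    (n : ℕ) : normRatio L n = normRatio L' n := by
  rcases n with _ | n
  · rfl
  · rw [normRatio, normRatio, norm2, norm2, norm2, norm2, h]

theorem thetaOf_congr {L L' : ℂ[X] →ₗ[ℂ] ℂ} (h : shiftFunctional L = shiftFunctional L')
    (a t : ℂ) (n : ℕ) : thetaOf a t L n = thetaOf a t L' n := by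
  rw [thetaOf, thetaOf, subCoeff_congr h, subCoeff_congr h]

theorem kappaOf_congr {L L' : ℂ[X] →ₗ[ℂ] ℂ} (h : shiftFunctional L = shiftFunctional L')
    (t : ℂ) (n : ℕ) : kappaOf t L n = kappaOf t L' n := by
  rw [kappaOf, kappaOf, subCoeff_congr h, normRatio_congr h]

theorem splitFunctional_origin (a : ℂ) : splitFunctional a (0, 0) = classicalFunctional a :=
  splitFunctional_zero_right a 0

theorem norm2_splitFunctional_origin (ha : -1 < a.re) (j : ℕ) :
    norm2 (splitFunctional a (0, 0)) j ≠ 0 := by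
  rw [splitFunctional_origin]
  exact classical_norm2_ne_zero ha j

theorem tendsto_cpow_add_three (ha : -1 < a.re) :
    Tendsto (fun t : ℂ => t ^ (a + 3)) (𝓝 0) (𝓝 0) := by
  have h : 0 < (a + 3).re := by simp; linarith
  have h1 := (Complex.continuousAt_cpow_const_of_re_pos (z := 0) (w := a + 3) (by simp) h).tendsto
  rwa [Complex.zero_cpow (re_pos_ne_zero h)] at h1

/-- The polynomials exist for all sufficiently small `t`. -/
theorem eventually_mem_opsDomain (ha : -1 < a.re) (N : ℕ) :
    ∀ᶠ t in 𝓝[Complex.slitPlane] (0 : ℂ), t ∈ opsDomain a N := by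
  have h1 : ∀ᶠ x in 𝓝 ((0, 0) : ℂ × ℂ), ∀ j < N + 1, norm2 (splitFunctional a x) j ≠ 0 :=
    eventually_sqNorm_ne_zero (W := fun x => shiftFunctional (splitFunctional a x))
      (analyticAt_shift (analyticAt_splitFunctional ha _))
      fun j _ => norm2_splitFunctional_origin ha j
  -- Re(a+3) > 0 brings the curve to the origin, where the functional is classical and its norms do
  -- not vanish.
  have h2 : Tendsto (fun t : ℂ => (t, t ^ (a + 3))) (𝓝[Complex.slitPlane] 0) (𝓝 (0, 0)) := by
    rw [nhds_prod_eq]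
    exact (tendsto_id.prodMk (tendsto_cpow_add_three ha)).mono_left nhdsWithin_le_nhds
  filter_upwards [h2.eventually h1, self_mem_nhdsWithin] with t ht hts
  refine (mem_opsDomain_iff ha N).2 ⟨hts, fun j hj => ?_⟩
  have h := ht j (by omega)
  rwa [norm2, shift_splitFunctional t (Complex.slitPlane_ne_zero hts)] at h

end

/-! ### The boundary expansions. -/

noncomputable section

variable {a : ℂ} {n : ℕ}

/-- First order Taylor expansion, uniform in a parameter. -/
theorem isBigO_taylor_snd {F : ℂ × ℂ → ℂ} (hF : AnalyticAt ℂ F (0, 0)) :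
    (fun x : ℂ × ℂ => F x - (F (x.1, 0) + x.2 * fderiv ℂ F (x.1, 0) (0, 1)))
      =O[𝓝 (0, 0)] fun x => x.2 ^ 2 := by
  have hG : AnalyticAt ℂ (fun x => fderiv ℂ F x (0, 1)) (0, 0) :=
    (ContinuousLinearMap.apply ℂ ℂ ((0, 1) : ℂ × ℂ)).analyticAt _ |>.comp hF.fderiv
  -- A Lipschitz bound for ∂F/∂ε near the origin, combined with the mean value inequality in ε,
  -- gives the error K|ε|² uniformly in t.
  obtain ⟨K, s, hs, hK⟩ := hG.contDiffAt (n := 1) |>.exists_lipschitzOnWith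
  obtain ⟨δ, hδ, hball⟩ := Metric.mem_nhds_iff.1 (inter_mem hs hF.eventually_analyticAt)
  refine IsBigO.of_bound K ?_
  filter_upwards [Metric.ball_mem_nhds _ hδ] with ⟨t, ε⟩ hx
  rw [mem_ball_iff_norm, Prod.norm_def, max_lt_iff] at hx
  simp only [Prod.fst_sub, Prod.snd_sub, sub_zero] at hx
  have hmem : ∀ y : ℂ, ‖y‖ ≤ ‖ε‖ → ((t, y) : ℂ × ℂ) ∈ Metric.ball ((0, 0) : ℂ × ℂ) δ := by
    intro y hy
    rw [mem_ball_iff_norm, Prod.norm_def, max_lt_iff]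
    simp only [Prod.fst_sub, Prod.snd_sub, sub_zero]
    exact ⟨hx.1, hy.trans_lt hx.2⟩
  have hderiv : ∀ y : ℂ, ‖y‖ ≤ ‖ε‖ → HasDerivAt (fun y => F (t, y) - y * fderiv ℂ F (t, 0) (0, 1))
      (fderiv ℂ F (t, y) (0, 1) - fderiv ℂ F (t, 0) (0, 1)) y := by
    intro y hy
    have h1 : AnalyticAt ℂ F (t, y) := (hball (hmem y hy)).2
    have h2 := h1.differentiableAt.hasFDerivAt.comp_hasDerivAt y
      ((hasDerivAt_const y t).prodMk (hasDerivAt_id y))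
    refine (h2.sub ((hasDerivAt_id y).mul_const (fderiv ℂ F (t, 0) (0, 1)))).congr_deriv ?_
    rw [one_mul]
  have hb := Convex.norm_image_sub_le_of_norm_hasDerivWithin_le (𝕜 := ℂ)
    (s := Metric.closedBall (0 : ℂ) ‖ε‖) (C := K * ‖ε‖) (x := 0) (y := ε)
    (fun y hy => (hderiv y (by simpa using hy)).hasDerivWithinAt) (fun y hy => ?_)
    (convex_closedBall _ _) (by simp) (by simp)
  · rw [norm_pow]
    convert hb using 1
    · congr 1
      ring
    · rw [sub_zero]; ring
  · have hy' : ‖y‖ ≤ ‖ε‖ := by simpa using hy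
    have h1 := hK.dist_le_mul _ (hball (hmem y hy')).1 _ (hball (hmem 0 (by simp))).1
    rw [dist_eq_norm, dist_eq_norm, Prod.norm_def] at h1
    simp only [Prod.fst_sub, Prod.snd_sub, sub_self, sub_zero, norm_zero] at h1
    rw [max_eq_right (norm_nonneg y)] at h1
    exact h1.trans (by gcongr)

theorem isBigO_id_mul_taylor {g : ℂ → ℂ} (hg : AnalyticAt ℂ g 0) :
    (fun t => t * g t - (g 0 * t + deriv g 0 * t ^ 2)) =O[𝓝 0] fun t => t ^ 3 := by
  obtain ⟨p, hp⟩ := hg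
  have h1 := hp.isBigO_sub_partialSum_pow 2
  have c0 : p.coeff 0 = g 0 := hp.coeff_zero _
  have c1 : p.coeff 1 = deriv g 0 := hp.deriv.symm
  have h2 : ∀ y, p.partialSum 2 y = g 0 + deriv g 0 * y := by
    intro y
    simp only [FormalMultilinearSeries.partialSum, Finset.sum_range_succ, Finset.sum_range_zero,
      zero_add, FormalMultilinearSeries.apply_eq_pow_smul_coeff, c0, c1, smul_eq_mul]
    ring
  simp only [h2, zero_add] at h1
  have h3 : (fun y => g y - (g 0 + deriv g 0 * y)) =O[𝓝 0] fun y : ℂ => y ^ 2 :=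
    h1.trans (IsBigO.of_bound 1 (Eventually.of_forall fun y => by simp))
  refine ((isBigO_refl (fun t : ℂ => t) (𝓝 0)).mul h3).congr (fun t => ?_) (fun t => ?_) <;> ring

/-- The analytic part is F(t, 0), the factor 1 + O(t) is ∂F/∂ε(t, 0)/d, and the remainder ε² is
t^{2a+6}. Dividing by d is why d ≠ 0 is required. -/
theorem hasBoundaryExpansion_of_split {F : ℂ × ℂ → ℂ} {f g : ℂ → ℂ} {d : ℂ} (ha : -1 < a.re)
    (hF : AnalyticAt ℂ F (0, 0)) (hg : AnalyticAt ℂ g 0)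
    (hFg : ∀ᶠ t in 𝓝 0, F (t, 0) = t * g t)
    (hf : ∀ᶠ t in 𝓝[Complex.slitPlane] 0, f t = F (t, t ^ (a + 3)))
    (hd : HasDerivAt (fun ε => F (0, ε)) d 0) (hd0 : d ≠ 0) :
    HasBoundaryExpansion a (g 0) (deriv g 0) d f := by
  have hpair : AnalyticAt ℂ (fun t : ℂ => ((t, 0) : ℂ × ℂ)) 0 := analyticAt_id.prod analyticAt_const
  have hG : AnalyticAt ℂ (fun x => fderiv ℂ F x (0, 1)) (0, 0) :=
    (ContinuousLinearMap.apply ℂ ℂ ((0, 1) : ℂ × ℂ)).analyticAt _ |>.comp hF.fderiv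
  have hB : AnalyticAt ℂ (fun t : ℂ => fderiv ℂ F (t, 0) (0, 1)) 0 :=
    AnalyticAt.comp_of_eq (g := fun x => fderiv ℂ F x (0, 1)) hG hpair rfl
  have hA : AnalyticAt ℂ (fun t : ℂ => F (t, 0)) 0 :=
    AnalyticAt.comp_of_eq (g := F) hF hpair rfl
  have hB0 : fderiv ℂ F (0, 0) (0, 1) = d := by
    have h2 := hF.differentiableAt.hasFDerivAt.comp_hasDerivAt (0 : ℂ)
      ((hasDerivAt_const (0 : ℂ) (0 : ℂ)).prodMk (hasDerivAt_id (0 : ℂ)))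
    exact h2.unique hd
  refine ⟨fun t => F (t, 0), fun t => fderiv ℂ F (t, 0) (0, 1) / d, hA, hB.div_const, ?_, ?_, ?_⟩
  · simp only [hB0, div_self hd0]
  · refine (isBigO_id_mul_taylor hg).congr' ?_ (EventuallyEq.refl _ _)
    filter_upwards [hFg] with t ht
    rw [ht]
  · have h2 : Tendsto (fun t : ℂ => (t, t ^ (a + 3))) (𝓝[Complex.slitPlane] 0) (𝓝 (0, 0)) := by
      rw [nhds_prod_eq]
      exact (tendsto_id.prodMk (tendsto_cpow_add_three ha)).mono_left nhdsWithin_le_nhds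
    refine ((isBigO_taylor_snd hF).comp_tendsto h2).congr' ?_ ?_
    · filter_upwards [hf] with t ht
      rw [ht]
      simp only [Function.comp_apply]
      field_simp
    · filter_upwards [self_mem_nhdsWithin] with t ht
      simp only [Function.comp_apply]
      rw [pow_two, ← Complex.cpow_add _ _ (Complex.slitPlane_ne_zero ht)]
      congr 1
      ring

section Regular

theorem regular_norm2_zero (ha : -1 < a.re) (j : ℕ) : norm2 (regularFunctional a 0) j ≠ 0 :=
  classical_norm2_ne_zero ha j

/-- The Taylor coefficients of the regular parts. -/
theorem regular_deriv_zero (ha : -1 < a.re) (ha0 : a ≠ 0) (n : ℕ) :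
    deriv (fun x => poleDiag (regularFunctional a x) n) 0 =
        a * (2 * n + a + 3) / ((a + 3) * (a + 2) ^ 2 * (a + 1)) ∧
      deriv (fun x => poleOff (regularFunctional a x) n) 0 =
        -(2 * n * (n + a + 2) * a / ((a + 3) * (a + 2) ^ 2 * (a + 1))) := by
  have hL := analyticAt_regularFunctional a 0
  have hn := regular_norm2_zero ha
  have hR := analyticAt_poleDiag hL hn n
  have hr := analyticAt_poleOff hL hn n
  have hev : ∀ᶠ x in 𝓝 (0 : ℂ), ∀ j < n + 1, norm2 (regularFunctional a x) j ≠ 0 :=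
    (isPearsonFamilyAt_regularFunctional ha 0).eventually_norm2 fun j _ => hn j
  have hp : ∀ x, IsPearson a x (regularFunctional a x) := fun x =>
    (isPearsonFamilyAt_regularFunctional ha x).pearson.self_of_nhds
  refine deriv_zero_of_system hR hr ?_ ?_ (classical_poleDiag ha n) (classical_poleOff ha n) ha ha0
  · filter_upwards [hev.eventually_nhds, hR.eventually_analyticAt] with x hx hRx
    have hx' : ∀ j ≤ n, norm2 (regularFunctional a x) j ≠ 0 := fun j hj =>
      hx.self_of_nhds j (by omega)
    have d1 := (isPearsonFamilyAt_regularFunctional ha x).hasDerivAt_thetaOf hx'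
    have d2 : HasDerivAt (fun y => thetaOf a y (regularFunctional a y) n)
        (-2 * 1 * poleDiag (regularFunctional a x) n +
          -2 * x * deriv (fun y => poleDiag (regularFunctional a y) n) x) x := by
      refine (((hasDerivAt_id x).const_mul (-2)).mul
        hRx.differentiableAt.hasDerivAt).congr_of_eventuallyEq ?_
      filter_upwards [hx] with y hy
      exact thetaOf_eq (hp y) fun j hj => hy j (by omega)
    -- Differentiating θ = -2tR directly and through the deformation formula gives a first order
    -- equation for R; the next case does the same for r.
    have e := d1.unique d2
    rw [poleOff_succ hx', subCoeff_sub_succ (hp x) hx'] at e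
    linear_combination (1 / 2) * e
  · filter_upwards [hev.eventually_nhds, hr.eventually_analyticAt] with x hx hrx
    have hx' : ∀ j ≤ n, norm2 (regularFunctional a x) j ≠ 0 := fun j hj =>
      hx.self_of_nhds j (by omega)
    have d1 := (isPearsonFamilyAt_regularFunctional ha x).hasDerivAt_kappaOf hx'
    have d2 : HasDerivAt (fun y => kappaOf y (regularFunctional a y) n)
        (1 * (1 - 2 * poleOff (regularFunctional a x) n) +
          x * -(2 * deriv (fun y => poleOff (regularFunctional a y) n) x)) x := by
      refine ((hasDerivAt_id x).mul
        ((hrx.differentiableAt.hasDerivAt.const_mul 2).const_sub 1)).congr_of_eventuallyEq ?_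
      filter_upwards [hx] with y hy
      exact kappaOf_eq (hp y) fun j hj => hy j (by omega)
    have e := d1.unique d2
    have e1 := normRatio_mul_poleDiag hx'
    have e2 := normRatio_mul_one_sub_poleDiag (hp x) hx'
    -- Multiplying by R(1 - 2R) lets both quadratic relations be used without division.
    linear_combination ((1 / 2) * poleDiag (regularFunctional a x) n *
      (1 - 2 * poleDiag (regularFunctional a x) n)) * e
      + (1 - 2 * poleDiag (regularFunctional a x) n) ^ 2 * e1
      - poleDiag (regularFunctional a x) n ^ 2 * e2

end Regular

theorem analyticAt_shift_split_left (ha : -1 < a.re) (k : ℕ) :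
    AnalyticAt ℂ (fun ε => shiftFunctional (splitFunctional a (0, ε)) (X ^ k)) 0 :=
  AnalyticAt.comp_of_eq (g := fun x => shiftFunctional (splitFunctional a x) (X ^ k))
    (analyticAt_shift (analyticAt_splitFunctional ha _) k)
    (analyticAt_const.prod analyticAt_id) rfl

theorem Gamma_add_natCast_ne_zero (ha : -1 < a.re) (n : ℕ) : Complex.Gamma (a + n + 3) ≠ 0 := by
  have : (0 : ℝ) ≤ n := Nat.cast_nonneg n
  refine Complex.Gamma_ne_zero_of_re_pos ?_
  simp
  linarith

theorem Gamma_natCast_add_one_ne_zero (n : ℕ) : Complex.Gamma ((n : ℂ) + 1) ≠ 0 := by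
  rw [Complex.Gamma_nat_eq_factorial]
  exact_mod_cast n.factorial_ne_zero

theorem Gamma_add_three_ne_zero (ha : -1 < a.re) : Complex.Gamma (a + 3) ≠ 0 := by
  simpa using Gamma_add_natCast_ne_zero ha 0

theorem Gamma_add_succ (ha : -1 < a.re) (n : ℕ) :
    Complex.Gamma (a + ((n + 1 : ℕ) : ℂ) + 3) = (a + n + 3) * Complex.Gamma (a + n + 3) := by
  rw [← Complex.Gamma_add_one]
  · congr 1
    push_cast
    ring
  · have : (0 : ℝ) ≤ n := Nat.cast_nonneg n
    refine re_pos_ne_zero ?_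
    simp
    linarith

theorem classical_eval_zero_eq_div (ha : -1 < a.re) (n : ℕ) :
    (ortho (classicalFunctional a) n).eval 0 =
      (-1) ^ n * Complex.Gamma (a + n + 3) / Complex.Gamma (a + 3) := by
  rw [eq_div_iff (Gamma_add_three_ne_zero ha), classical_eval_zero ha]

/-- The derivative of the subleading coefficient with respect to a point mass at `0`. -/
theorem hasDerivAt_subCoeff_split (ha : -1 < a.re) (n : ℕ) :
    HasDerivAt (fun ε => subCoeff (splitFunctional a (0, ε)) n)
      (-(2 / ((a + 1) * (a + 2) * (a + 3))) * (Complex.Gamma (a + n + 3) /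
        (Complex.Gamma n * Complex.Gamma (a + 3) ^ 2))) 0 := by
  rcases n with _ | n
  · simpa [subCoeff] using hasDerivAt_const (0 : ℂ) (0 : ℂ)
  have h := hasDerivAt_coeff_monicOrtho (analyticAt_shift_split_left ha)
    (hasDerivAt_splitFunctional a) (n := n) fun j _ => norm2_splitFunctional_origin ha j
  refine h.congr_deriv ?_
  have g1 := Gamma_add_natCast_ne_zero ha n
  have g2 := Gamma_natCast_add_one_ne_zero n
  have g3 := Gamma_add_three_ne_zero ha
  have hs : ((-1 : ℂ) ^ n) * (-1) ^ n = 1 := by rw [← mul_pow]; simp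
  have e1 := classical_eval_zero_eq_div ha n
  have e2 := classical_eval_zero_eq_div ha (n + 1)
  have e3 := classical_norm2 ha n
  rw [momentFunctional_evaluation, splitFunctional_origin, eval_mul, singularMoment_zero ha]
  rw [ortho] at e1 e2
  rw [norm2] at e3
  rw [e1, e2, e3]
  push_cast
  rw [pow_succ]
  generalize Complex.Gamma (a + ((n : ℂ) + 1) + 3) = G
  generalize (2 : ℂ) / ((a + 1) * (a + 2) * (a + 3)) = S
  field_simp
  linear_combination (-S * G) * hs

/-- The derivative of the squared norm with respect to a point mass at `0`. -/
theorem hasDerivAt_norm2_split (ha : -1 < a.re) (n : ℕ) :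
    HasDerivAt (fun ε => norm2 (splitFunctional a (0, ε)) n)
      (-(2 / ((a + 1) * (a + 2) * (a + 3))) * (Complex.Gamma (a + n + 3) ^ 2 /
        Complex.Gamma (a + 3) ^ 2)) 0 := by
  have h := hasDerivAt_sqNorm (analyticAt_shift_split_left ha)
    (hasDerivAt_splitFunctional a) (n := n) fun j _ => norm2_splitFunctional_origin ha j
  refine h.congr_deriv ?_
  have hs : (((-1 : ℂ) ^ n)) ^ 2 = 1 := by rw [← pow_mul, mul_comm, pow_mul]; simp
  have e1 := classical_eval_zero_eq_div ha n
  rw [momentFunctional_evaluation, splitFunctional_origin, eval_pow, singularMoment_zero ha]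
  rw [ortho] at e1
  rw [e1, div_pow, mul_pow, hs, one_mul]

/-- The derivative of the ratio of squared norms with respect to a point mass at `0`. -/
theorem hasDerivAt_normRatio_split (ha : -1 < a.re) (n : ℕ) :
    HasDerivAt (fun ε => normRatio (splitFunctional a (0, ε)) n)
      (-(2 / ((a + 1) * (a + 2) * (a + 3))) * (a + 2) * (Complex.Gamma (a + n + 3) /
        (Complex.Gamma n * Complex.Gamma (a + 3) ^ 2))) 0 := by
  rcases n with _ | n
  · simpa [normRatio] using hasDerivAt_const (0 : ℂ) (0 : ℂ)
  have h := (hasDerivAt_norm2_split ha (n + 1)).div (hasDerivAt_norm2_split ha n)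
    (norm2_splitFunctional_origin ha n)
  refine h.congr_deriv ?_
  have g1 := Gamma_add_natCast_ne_zero ha n
  have g2 := Gamma_natCast_add_one_ne_zero n
  have g3 := Gamma_add_three_ne_zero ha
  have h4 : (n : ℂ) + 1 ≠ 0 := by exact_mod_cast Nat.succ_ne_zero n
  rw [splitFunctional_origin, classical_norm2 ha, classical_norm2 ha, Gamma_add_succ ha]
  push_cast
  rw [Complex.Gamma_add_one _ h4]
  generalize (2 : ℂ) / ((a + 1) * (a + 2) * (a + 3)) = S
  field_simp
  ring

theorem analyticAt_thetaOf_split (ha : -1 < a.re) (n : ℕ) :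
    AnalyticAt ℂ (fun x : ℂ × ℂ => thetaOf a x.1 (splitFunctional a x) n) (0, 0) := by
  have h := analyticAt_subCoeff (analyticAt_splitFunctional ha (0, 0))
    (norm2_splitFunctional_origin ha)
  exact (analyticAt_const.sub analyticAt_fst).sub ((h n).sub (h (n + 1)))

theorem analyticAt_kappaOf_split (ha : -1 < a.re) (n : ℕ) :
    AnalyticAt ℂ (fun x : ℂ × ℂ => kappaOf x.1 (splitFunctional a x) n) (0, 0) := by
  have hA := analyticAt_splitFunctional ha (0, 0)
  have hn := norm2_splitFunctional_origin ha
  exact ((analyticAt_const.mul analyticAt_fst).sub (analyticAt_normRatio hA hn n)).sub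
    (analyticAt_subCoeff hA hn n)

theorem hasBoundaryExpansion_thetaOf (ha : -1 < a.re) (ha0 : a ≠ 0) (n : ℕ) {f : ℂ → ℂ}
    (hf : ∀ᶠ t in 𝓝[Complex.slitPlane] 0, f t = thetaOf a t (laguerreFunctional a t) n) :
    HasBoundaryExpansion a (-(2 / (a + 2)))
      (-(2 * a * (2 * n + a + 3) / ((a + 3) * (a + 2) ^ 2 * (a + 1))))
      (-(2 / ((a + 2) * (a + 1) * Complex.Gamma (a + 3) ^ 2)
        * (Complex.Gamma (a + n + 3) / Complex.Gamma (n + 1)))) f := by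
  have ne1 : a + 1 ≠ 0 := re_pos_ne_zero (by simp; linarith)
  have ne2 : a + 2 ≠ 0 := re_pos_ne_zero (by simp; linarith)
  have ne3 : a + 3 ≠ 0 := re_pos_ne_zero (by simp; linarith)
  have g1 := Gamma_add_natCast_ne_zero ha n
  have g2 := Gamma_natCast_add_one_ne_zero n
  have g3 := Gamma_add_three_ne_zero ha
  have hR := analyticAt_poleDiag (analyticAt_regularFunctional a 0) (regular_norm2_zero ha) n
  have hev := (isPearsonFamilyAt_regularFunctional ha 0).eventually_norm2 (n := n + 1)
    fun j _ => regular_norm2_zero ha j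
  have hd : HasDerivAt (fun ε => thetaOf a 0 (splitFunctional a (0, ε)) n)
      (-(2 / ((a + 2) * (a + 1) * Complex.Gamma (a + 3) ^ 2)
        * (Complex.Gamma (a + n + 3) / Complex.Gamma (n + 1)))) 0 := by
    refine (((hasDerivAt_subCoeff_split ha n).sub
      (hasDerivAt_subCoeff_split ha (n + 1))).const_sub (2 * (n : ℂ) + a + 3 - 0)).congr_deriv ?_
    -- For n = 0 both sides are 0, since `Complex.Gamma 0` is 0 and division by 0 gives 0.
    have e : (1 : ℂ) / Complex.Gamma n = n / Complex.Gamma (n + 1) := by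
      rcases n with _ | n
      · simp
      · have h4 : ((n + 1 : ℕ) : ℂ) ≠ 0 := by exact_mod_cast Nat.succ_ne_zero n
        rw [Complex.Gamma_add_one _ h4]
        have := Gamma_natCast_add_one_ne_zero n
        push_cast at h4 ⊢
        field_simp
    have e' : Complex.Gamma (a + n + 3) / (Complex.Gamma n * Complex.Gamma (a + 3) ^ 2) =
        Complex.Gamma (a + n + 3) / Complex.Gamma (a + 3) ^ 2 * (1 / Complex.Gamma n) := by
      rw [div_mul_div_comm, mul_one, mul_comm (Complex.Gamma (n : ℂ))]
    rw [e', e, Gamma_add_succ ha]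
    push_cast
    field_simp
    ring
  have h := hasBoundaryExpansion_of_split (f := f) (g := fun t => -2 * poleDiag (regularFunctional a t) n)
    ha (analyticAt_thetaOf_split ha n) (analyticAt_const.mul hR) ?_ ?_ hd ?_
  · convert h using 1
    · change _ = -2 * poleDiag (classicalFunctional a) n
      rw [classical_poleDiag ha]
      ring
    · rw [deriv_const_mul _ hR.differentiableAt, (regular_deriv_zero ha ha0 n).1]
      ring
  · filter_upwards [hev] with t ht
    rw [splitFunctional_zero_right, thetaOf_eq
      (isPearsonFamilyAt_regularFunctional ha t).pearson.self_of_nhds fun j hj => ht j (by omega)]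
    ring
  · filter_upwards [hf, self_mem_nhdsWithin] with t ht hts
    rw [ht]
    exact (thetaOf_congr (shift_splitFunctional t (Complex.slitPlane_ne_zero hts)) a t n).symm
  · refine neg_ne_zero.2 (mul_ne_zero (div_ne_zero two_ne_zero ?_) (div_ne_zero g1 g2))
    exact mul_ne_zero (mul_ne_zero ne2 ne1) (pow_ne_zero 2 g3)

theorem hasBoundaryExpansion_kappaOf (ha : -1 < a.re) (ha0 : a ≠ 0) (n : ℕ) {f : ℂ → ℂ}
    (hf : ∀ᶠ t in 𝓝[Complex.slitPlane] 0, f t = kappaOf t (laguerreFunctional a t) n) :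
    HasBoundaryExpansion a ((2 * n + a + 2) / (a + 2))
      (4 * n * (n + a + 2) * a / ((a + 3) * (a + 2) ^ 2 * (a + 1)))
      (2 / ((a + 2) * (a + 1) * Complex.Gamma (a + 3) ^ 2)
        * (Complex.Gamma (a + n + 3) / Complex.Gamma n)) f := by
  have ne1 : a + 1 ≠ 0 := re_pos_ne_zero (by simp; linarith)
  have ne2 : a + 2 ≠ 0 := re_pos_ne_zero (by simp; linarith)
  have ne3 : a + 3 ≠ 0 := re_pos_ne_zero (by simp; linarith)
  rcases n with _ | n
  -- For n = 0 the coefficient d is 0, so the splitting lemma does not apply; but κ_0(t) = t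
  -- exactly.
  · refine ⟨fun t => t, fun _ => 1, analyticAt_id, analyticAt_const, rfl, ?_, ?_⟩
    · refine (isBigO_zero _ _).congr_left fun t => ?_
      push_cast
      field_simp
      ring
    · refine (isBigO_zero _ _).congr' ?_ (EventuallyEq.refl _ _)
      filter_upwards [hf] with t ht
      rw [ht]
      simp [kappaOf, normRatio, subCoeff]
  have g1 := Gamma_add_natCast_ne_zero ha (n + 1)
  have g2 : Complex.Gamma ((n + 1 : ℕ) : ℂ) ≠ 0 := by
    push_cast
    exact Gamma_natCast_add_one_ne_zero n
  have g3 := Gamma_add_three_ne_zero ha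
  have hr := analyticAt_poleOff (analyticAt_regularFunctional a 0) (regular_norm2_zero ha) (n + 1)
  have hev := (isPearsonFamilyAt_regularFunctional ha 0).eventually_norm2 (n := n + 1)
    fun j _ => regular_norm2_zero ha j
  have hd : HasDerivAt (fun ε => kappaOf 0 (splitFunctional a (0, ε)) (n + 1))
      (2 / ((a + 2) * (a + 1) * Complex.Gamma (a + 3) ^ 2)
        * (Complex.Gamma (a + (n + 1 : ℕ) + 3) / Complex.Gamma (n + 1 : ℕ))) 0 := by
    -- The variations of ρ and of the subleading coefficient are in the ratio a + 2 to 1; their sum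
    -- cancels the factor a + 3 of the point mass.
    refine (((hasDerivAt_normRatio_split ha (n + 1)).const_sub
      ((((n + 1 : ℕ) : ℂ) + 1) * 0)).sub (hasDerivAt_subCoeff_split ha (n + 1))).congr_deriv ?_
    field_simp
    ring
  have h := hasBoundaryExpansion_of_split (f := f)
    (g := fun t => 1 - 2 * poleOff (regularFunctional a t) (n + 1))
    ha (analyticAt_kappaOf_split ha (n + 1)) (analyticAt_const.sub (analyticAt_const.mul hr))
    ?_ ?_ hd ?_
  · convert h using 1
    · change _ = 1 - 2 * poleOff (classicalFunctional a) (n + 1)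
      rw [classical_poleOff ha]
      field_simp
      ring
    · rw [deriv_const_sub, deriv_const_mul _ hr.differentiableAt,
        (regular_deriv_zero ha ha0 (n + 1)).2]
      ring
  · filter_upwards [hev] with t ht
    rw [splitFunctional_zero_right, kappaOf_eq
      (isPearsonFamilyAt_regularFunctional ha t).pearson.self_of_nhds ht]
  · filter_upwards [hf, self_mem_nhdsWithin] with t ht hts
    rw [ht]
    exact (kappaOf_congr (shift_splitFunctional t (Complex.slitPlane_ne_zero hts)) t _).symm
  · refine mul_ne_zero (div_ne_zero two_ne_zero ?_) (div_ne_zero g1 g2)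
    exact mul_ne_zero (mul_ne_zero ne2 ne1) (pow_ne_zero 2 g3)

end

/-! ### Transfer to the orthonormal polynomials and assembly. -/

theorem thetaEquationAt_congr {a t : ℂ} {n : ℕ} {θ κ θ' κ' : ℂ → ℂ} (hθ : θ' =ᶠ[𝓝 t] θ)
    (hκ : κ' =ᶠ[𝓝 t] κ) (h : ThetaEquationAt a n θ κ t) : ThetaEquationAt a n θ' κ' t := by
  refine ⟨h.1.congr_of_eventuallyEq hθ, ?_⟩
  rw [hθ.deriv_eq, hθ.eq_of_nhds, hκ.eq_of_nhds]
  exact h.2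

theorem kappaEquationAt_congr {a t : ℂ} {n : ℕ} {θ κ θ' κ' : ℂ → ℂ} (hθ : θ' =ᶠ[𝓝 t] θ)
    (hκ : κ' =ᶠ[𝓝 t] κ) (h : KappaEquationAt a n θ κ t) : KappaEquationAt a n θ' κ' t := by
  refine ⟨h.1.congr_of_eventuallyEq hκ, ?_⟩
  rw [hκ.deriv_eq, hθ.eq_of_nhds, hκ.eq_of_nhds]
  exact h.2

end DeformedLaguerre

theorem proposition3p2 (a : ℂ) (ha : -1 < a.re) (n : ℕ)
    (p : ℂ → ℕ → ℂ[X])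
    (hp : ∀ t ∈ DeformedLaguerre.opsDomain a (n + 1),
      DeformedLaguerre.IsOrthonormalSystem a t (n + 1) (p t))
    (θ κ : ℂ → ℂ)
    (hθ : ∀ t, θ t = DeformedLaguerre.theta a t (p t) n)
    (hκ : ∀ t, κ t = DeformedLaguerre.kappa t (p t) n)
    (v₁ v₂ v₃ v₄ : ℂ) (hv : v₁ + v₂ + v₃ + v₄ = 0)
    (hv₂ : v₂ - v₁ = -2) (hv₃ : v₃ - v₁ = n + a) (hv₄ : v₄ - v₁ = n) :
    -- where the objects are defined, and where the equations are non-singular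
    (IsOpen (DeformedLaguerre.opsDomain a (n + 1)) ∧
      (∀ᶠ t in 𝓝[Complex.slitPlane] (0 : ℂ), t ∈ DeformedLaguerre.opsDomain a (n + 1)) ∧
      (a.im = 0 → ∀ t : ℝ, 0 < t →
        (t : ℂ) ∈ DeformedLaguerre.opsDomain a (n + 1) ∧
          θ t ≠ 0 ∧ (a ≠ 0 → θ t + t ≠ 0))) ∧
    -- the coupled first order differential equations
    (∀ t ∈ DeformedLaguerre.opsDomain a (n + 1),
      DeformedLaguerre.ThetaEquationAt a n θ κ t ∧
        (θ t ≠ 0 → θ t + t ≠ 0 → DeformedLaguerre.KappaEquationAt a n θ κ t)) ∧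
    -- the two systems of equations are equivalent under the change of variables
    (∀ (U : Set ℂ) (Θ K q r : ℂ → ℂ), IsOpen U →
      (∀ t ∈ U, t ≠ 0 ∧ q t ≠ 0 ∧ q t ≠ 1 ∧
        Θ t = t * (q t / (1 - q t)) ∧ K t = t * (1 + q t * r t)) →
      ((∀ t ∈ U, DeformedLaguerre.ThetaEquationAt a n Θ K t ∧
          DeformedLaguerre.KappaEquationAt a n Θ K t) ↔
        ∀ t ∈ U, DeformedLaguerre.OkamotoSystemAt v₁ v₂ v₃ v₄ q r t)) ∧
    -- the solution `θ_n, κ_n` in terms of the fifth Painlevé system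
    (∃ q r : ℂ → ℂ, ∀ t ∈ DeformedLaguerre.opsDomain a (n + 1), θ t ≠ 0 → θ t + t ≠ 0 →
      q t ≠ 0 ∧ q t ≠ 1 ∧ θ t = t * (q t / (1 - q t)) ∧ κ t = t * (1 + q t * r t) ∧
        DeformedLaguerre.OkamotoSystemAt v₁ v₂ v₃ v₄ q r t ∧
        DeformedLaguerre.PainleveVAt (a ^ 2 / 2) (-2) (-(2 * n + a + 3)) (-1 / 2) q t) ∧
    -- the boundary data at `t = 0`
    ((∀ k : ℕ, a ≠ k) →
      DeformedLaguerre.HasBoundaryExpansion a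
        (-(2 / (a + 2)))
        (-(2 * a * (2 * n + a + 3) / ((a + 3) * (a + 2) ^ 2 * (a + 1))))
        (-(2 / ((a + 2) * (a + 1) * Complex.Gamma (a + 3) ^ 2)
          * (Complex.Gamma (a + n + 3) / Complex.Gamma (n + 1)))) θ ∧
      DeformedLaguerre.HasBoundaryExpansion a
        ((2 * n + a + 2) / (a + 2))
        (4 * n * (n + a + 2) * a / ((a + 3) * (a + 2) ^ 2 * (a + 1)))
        (2 / ((a + 2) * (a + 1) * Complex.Gamma (a + 3) ^ 2)
          * (Complex.Gamma (a + n + 3) / Complex.Gamma n)) κ) := by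
  have hsys : ∀ t ∈ DeformedLaguerre.opsDomain a (n + 1),
      θ t = DeformedLaguerre.thetaOf a t (DeformedLaguerre.laguerreFunctional a t) n ∧
        κ t = DeformedLaguerre.kappaOf t (DeformedLaguerre.laguerreFunctional a t) n :=
    fun t ht => ⟨(hθ t).trans (DeformedLaguerre.theta_eq_thetaOf ha ht.1 (hp t ht)),
      (hκ t).trans (DeformedLaguerre.kappa_eq_kappaOf ha ht.1 (hp t ht))⟩
  have hopen := DeformedLaguerre.isOpen_opsDomain ha (n + 1)
  have hsmall := DeformedLaguerre.eventually_mem_opsDomain ha (n + 1)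
  have hodes : ∀ t ∈ DeformedLaguerre.opsDomain a (n + 1),
      DeformedLaguerre.ThetaEquationAt a n θ κ t ∧
        (θ t ≠ 0 → θ t + t ≠ 0 → DeformedLaguerre.KappaEquationAt a n θ κ t) := by
    intro t ht
    obtain ⟨hts, hn⟩ := (DeformedLaguerre.mem_opsDomain_iff ha (n + 1)).1 ht
    have hn' : ∀ j ≤ n, DeformedLaguerre.norm2 (DeformedLaguerre.laguerreFunctional a t) j ≠ 0 :=
      fun j hj => hn j (by omega)
    have hL := DeformedLaguerre.isPearsonFamilyAt_laguerreFunctional ha hts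
    -- The choice of `p t` may jump in sign with t, but θ and κ depend only on the functional, so
    -- they agree with smooth functions on the open domain.
    have eθ : θ =ᶠ[𝓝 t]
        fun x => DeformedLaguerre.thetaOf a x (DeformedLaguerre.laguerreFunctional a x) n := by
      filter_upwards [hopen.mem_nhds ht] with x hx using (hsys x hx).1
    have eκ : κ =ᶠ[𝓝 t]
        fun x => DeformedLaguerre.kappaOf x (DeformedLaguerre.laguerreFunctional a x) n := by
      filter_upwards [hopen.mem_nhds ht] with x hx using (hsys x hx).2
    refine ⟨DeformedLaguerre.thetaEquationAt_congr eθ eκ (hL.thetaEquationAt hn'),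
      fun h1 h2 => DeformedLaguerre.kappaEquationAt_congr eθ eκ (hL.kappaEquationAt hn' ?_ ?_)⟩
    · rwa [← (hsys t ht).1]
    · rwa [← (hsys t ht).1]
  refine ⟨⟨hopen, hsmall, fun him t ht => ?_⟩, hodes, ?_, ?_, fun hak => ?_⟩
  · obtain ⟨h1, h2, h3⟩ := DeformedLaguerre.real_parameters ha him ht n
    rw [(hsys t h1).1]
    exact ⟨h1, h2, h3⟩
  · intro U Θ K q r hU h
    exact ⟨fun hE t ht => DeformedLaguerre.thetaKappa_to_okamoto hU h ht hv hv₂ hv₃ hv₄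
        (hE t ht).1 (hE t ht).2,
      fun hO t ht => DeformedLaguerre.okamoto_to_thetaKappa hU h ht hv hv₂ hv₃ hv₄ (hO t ht)⟩
  -- These invert θ = tq/(1-q) and κ = t(1+qr). On `U` one has 1 - q = t/(θ+t), which is nonzero.
  · set q : ℂ → ℂ := fun t => θ t / (θ t + t) with hq
    set r : ℂ → ℂ := fun t => (κ t / t - 1) / q t with hr
    set U : Set ℂ := {t | t ∈ DeformedLaguerre.opsDomain a (n + 1) ∧ θ t ≠ 0 ∧ θ t + t ≠ 0} with hU
    have hUo : IsOpen U := by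
      rw [isOpen_iff_mem_nhds]
      rintro t ⟨ht, h1, h2⟩
      have hc : ContinuousAt θ t := (hodes t ht).1.1.continuousAt
      filter_upwards [hopen.mem_nhds ht, hc.eventually_ne h1,
        (hc.add continuousAt_id).eventually_ne h2] with x hx hx1 hx2 using ⟨hx, hx1, hx2⟩
    have hcov : ∀ t ∈ U, t ≠ 0 ∧ q t ≠ 0 ∧ q t ≠ 1 ∧
        θ t = t * (q t / (1 - q t)) ∧ κ t = t * (1 + q t * r t) := by
      rintro t ⟨ht, h1, h2⟩
      have ht0 : t ≠ 0 := Complex.slitPlane_ne_zero ht.1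
      have hq0 : q t ≠ 0 := div_ne_zero h1 h2
      have h1q : 1 - q t = t / (θ t + t) := by
        simp only [hq]
        field_simp
        ring
      have h1q0 : 1 - q t ≠ 0 := by rw [h1q]; exact div_ne_zero ht0 h2
      refine ⟨ht0, hq0, fun h => h1q0 (by rw [h, sub_self]), ?_, ?_⟩
      · rw [h1q]
        simp only [hq]
        field_simp
      · simp only [hr]
        rw [mul_div_cancel₀ _ hq0]
        field_simp
        ring
    have hO : ∀ t ∈ U, DeformedLaguerre.OkamotoSystemAt v₁ v₂ v₃ v₄ q r t := fun t ht =>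
      DeformedLaguerre.thetaKappa_to_okamoto hUo hcov ht hv hv₂ hv₃ hv₄ (hodes t ht.1).1
        ((hodes t ht.1).2 ht.2.1 ht.2.2)
    refine ⟨q, r, fun t ht h1 h2 => ?_⟩
    have htU : t ∈ U := ⟨ht, h1, h2⟩
    obtain ⟨-, c1, c2, c3, c4⟩ := hcov t htU
    exact ⟨c1, c2, c3, c4, hO t htU, DeformedLaguerre.painleveVAt_of_okamoto hUo
      (fun t ht => ⟨(hcov t ht).1, (hcov t ht).2.1, (hcov t ht).2.2.1⟩) hv hv₂ hv₃ hv₄ hO htU⟩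
  · have ha0 : a ≠ 0 := by simpa using hak 0
    exact ⟨DeformedLaguerre.hasBoundaryExpansion_thetaOf ha ha0 n
        (hsmall.mono fun t ht => (hsys t ht).1),
      DeformedLaguerre.hasBoundaryExpansion_kappaOf ha ha0 n
        (hsmall.mono fun t ht => (hsys t ht).2)⟩
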